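/- **Setting.** Let $N\ge 1$, let $k\ge 0$ be real, and let $S_N$ act on real polynomials in $x=(x_1,\dots,x_N)$ by $(wf)(x)=f(xw)$, $(xw)_i=x_{w(i)}$, and on compositions $\alpha\in\mathbb Z_{\ge0}^N$ by $(w\alpha)_i=\alpha_{w^{-1}(i)}$; $(ij)$ is a transposition, $|\alpha|=\sum_i\alpha_i$, $\alpha^+$ is the decreasing rearrangement of $\alpha$, and $\alpha\succ\beta$ means $\alpha\ne\beta$ and $\sum_{i\le j}\alpha_i\ge\sum_{i\le j}\beta_i$ for $1\le j\le N$. Put $$T_i=\frac{\partial}{\partial x_i}+k\sum_{j\ne i}\frac{1-(ij)}{x_i-x_j},\qquad U_i=T_ix_i+k-k\sum_{j<i}(ij),$$ $$\kappa_i(\alpha)=Nk-k\bigl(\#\{s:\alpha_s>\alpha_i\}+\#\{s:s<i,\ \alpha_s=\alpha_i\}\bigr)+\alpha_i+1 .$$ **Non-symmetric Jack polynomials.** Define $p_\alpha$ by $\sum_\alpha p_\alpha(x)y^\alpha=\prod_{i=1}^N\bigl\{(1-x_iy_i)^{-1}\prod_{j=1}^N(1-x_iy_j)^{-k}\bigr\}$.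 For a partition $\lambda$ (with at most $N$ parts) let $\omega_\lambda$ be the polynomial with $U_i\omega_\lambda=\kappa_i(\lambda)\omega_\lambda$ for all $i$ and $\omega_\lambda\in p_\lambda+\operatorname{span}\{p_\beta:|\beta|=|\lambda|,\ \beta^+\succ\lambda\}$, and put $\omega_{w\lambda}=w\,\omega_\lambda$ for $w\in S_N$. For a composition $\alpha$ let $\zeta_\alpha$ be the polynomial with $U_i\zeta_\alpha=\kappa_i(\alpha)\zeta_\alpha$ for all $i$ and $\zeta_\alpha\in\omega_\alpha+\operatorname{span}\{\omega_\beta:\beta^+=\alpha^+,\ \beta\succ\alpha\}$. (These polynomials exist and are unique, and $\omega_{w\lambda}$ is well defined.) **The interval.** Let $I=[\ell+1,\ell+m]$ with $\ell\ge0$, $m\ge1$, $\ell+m\le N$, let $S_I=\{w\in S_N: w(i)=i\text{ for }i\notin I\}$, and let $\sigma_I\in S_I$ be the permutation $i\mapsto 2\ell+m+1-i$ on $I$. For $\epsilon=\pm$ put $$\mathcal E_\epsilon(\beta;I)=\prod\Bigl\{1+\frac{\epsilon k}{\kappa_j(\beta)-\kappa_i(\beta)}: i,j\in I,\ i<j,\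 \beta_i<\beta_j\Bigr\}.$$ Suppose $\alpha$ satisfies $(>,I)$, that is, $\alpha_i>\alpha_j$ whenever $i,j\in I$ and $i<j$. Put $\alpha^R=\sigma_I\alpha$ and $$j_{\alpha;I}=\mathcal E_+(\alpha^R;I)\sum_{\beta\in S_I\alpha}\frac{1}{\mathcal E_+(\beta;I)}\,\zeta_\beta,\qquad a_{\alpha;I}=\mathcal E_-(\alpha^R;I)\sum_{w\in S_I}\frac{\operatorname{sgn}(w)}{\mathcal E_-(w\alpha;I)}\,\zeta_{w\alpha}.$$ **The skew operator.** Let $\psi_1=1$ and, for $1\le s<m$, $$\tilde\psi_{s+1}=U_{\ell+1}U_{\ell+2}\cdots U_{\ell+s}\psi_s,\qquad \psi_{s+1}=\tilde\psi_{s+1}-\sum_{i=\ell+1}^{\ell+s}(i,\ell+s+1)\,\tilde\psi_{s+1}\,(i,\ell+s+1),$$ and put $\psi_I=\psi_m$. **Corollary.** For every $\alpha$ satisfying $(>,I)$, $$\psi_I\,a_{\alpha;I}=\prod_{\ell+1\le i<j\le \ell+m}\bigl(\kappa_i(\alpha)-\kappa_j(\alpha)-k\bigr)\;j_{\alpha;I}.$$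 -/

import Mathlib

noncomputable section

namespace DunklJack

open MvPolynomial

variable {N : ℕ}

/-- The operator `f ↦ w f` on polynomials, `(w f)(x) = f(x w)` with `(x w)_i = x_{w(i)}`;
so `w x_i = x_{w(i)}`. -/
def permOp (w : Equiv.Perm (Fin N)) : Module.End ℝ (MvPolynomial (Fin N) ℝ) :=
  (rename (R := ℝ) w).toLinearMap

/-- The transposition `(i j)` as an operator on polynomials. -/
def swapOp (i j : Fin N) : Module.End ℝ (MvPolynomial (Fin N) ℝ) :=
  permOp (Equiv.swap i j)

theorem dvd_sub_swapOp (i j : Fin N) (f : MvPolynomial (Fin N) ℝ) :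
    (X i - X j : MvPolynomial (Fin N) ℝ) ∣ f - swapOp i j f := by
  simp only [swapOp, permOp, AlgHom.toLinearMap_apply]
  induction f using MvPolynomial.induction_on with
  | C a => simp
  | add p q hp hq =>
    have h : p + q - rename (Equiv.swap i j) (p + q) =
        (p - rename (Equiv.swap i j) p) + (q - rename (Equiv.swap i j) q) := by
      rw [map_add]; ring
    rw [h]; exact dvd_add hp hq
  | mul_X p n hp =>
    have h : p * X n - rename (Equiv.swap i j) (p * X n) =
        (p - rename (Equiv.swap i j) p) * X n
          + rename (Equiv.swap i j) p * (X n - X (Equiv.swap i j n)) := by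
      rw [map_mul, rename_X]; ring
    rw [h]
    refine dvd_add (Dvd.dvd.mul_right hp _) (Dvd.dvd.mul_left ?_ _)
    by_cases h1 : n = i
    · subst h1; simp
    · by_cases h2 : n = j
      · subst h2
        rw [Equiv.swap_apply_right]
        exact ⟨-1, by ring⟩
      · rw [Equiv.swap_apply_of_ne_of_ne h1 h2]; simp

theorem exists_divDiff (i j : Fin N) :
    ∃ L : Module.End ℝ (MvPolynomial (Fin N) ℝ),
      ∀ f, (X i - X j) * L f = f - swapOp i j f := by
  by_cases hij : i = j
  · subst hij
    exact ⟨0, fun f => by simp [swapOp, permOp]⟩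
  · have hne : (X i - X j : MvPolynomial (Fin N) ℝ) ≠ 0 :=
      sub_ne_zero.mpr fun h => hij (X_injective h)
    choose q hq using dvd_sub_swapOp i j
    refine ⟨{ toFun := q, map_add' := fun f g => ?_, map_smul' := fun c f => ?_ },
      fun f => (hq f).symm⟩
    · apply mul_left_cancel₀ hne
      rw [mul_add, ← hq, ← hq, ← hq, map_add]; ring
    · apply mul_left_cancel₀ hne
      rw [RingHom.id_apply, mul_smul_comm, ← hq, ← hq, map_smul, smul_sub]

/-- The divided difference `f ↦ (f - (i j) f) / (x_i - x_j)` (used only for `i ≠ j`, where it is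
determined by `divDiff_spec`). -/
def divDiff (i j : Fin N) : Module.End ℝ (MvPolynomial (Fin N) ℝ) :=
  (exists_divDiff i j).choose

theorem divDiff_spec (i j : Fin N) (f : MvPolynomial (Fin N) ℝ) :
    (X i - X j) * divDiff i j f = f - swapOp i j f :=
  (exists_divDiff i j).choose_spec f

/-- The type A Dunkl operator `T_i = ∂/∂x_i + k ∑_{j ≠ i} (1 - (i j)) / (x_i - x_j)`. -/
def dunklT (k : ℝ) (i : Fin N) : Module.End ℝ (MvPolynomial (Fin N) ℝ) :=
  (pderiv (R := ℝ) i).toLinearMap + k • ∑ j ∈ Finset.univ.filter (fun j => j ≠ i), divDiff i j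

/-- The operator `T_i ρ_i = T_i x_i + k`. -/
def dunklTrho (k : ℝ) (i : Fin N) : Module.End ℝ (MvPolynomial (Fin N) ℝ) :=
  dunklT k i * LinearMap.mulLeft ℝ (X i) + k • 1

/-- `U_i = T_i ρ_i - k ∑_{j < i} (i j)`. -/
def opU (k : ℝ) (i : Fin N) : Module.End ℝ (MvPolynomial (Fin N) ℝ) :=
  dunklTrho k i - k • ∑ j ∈ Finset.univ.filter (fun j => j < i), swapOp i j

/-- `κ_i(α) = N k - k (#{s : α_s > α_i} + #{s : s < i, α_s = α_i}) + α_i + 1`. -/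
def kappa (k : ℝ) (α : Fin N → ℕ) (i : Fin N) : ℝ :=
  N * k - k * (((Finset.univ.filter fun s => α i < α s).card : ℝ)
    + ((Finset.univ.filter fun s => s < i ∧ α s = α i).card : ℝ)) + α i + 1

/-- `(w α)_i = α_{w⁻¹(i)}`. -/
def permComp (w : Equiv.Perm (Fin N)) (α : Fin N → ℕ) : Fin N → ℕ := fun i => α (w⁻¹ i)

/-- A permutation `s` for which `i ↦ α (s i)` is weakly decreasing. -/
def sortPerm (α : Fin N → ℕ) : Equiv.Perm (Fin N) :=
  Tuple.sort fun i => OrderDual.toDual (α i)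

/-- `α⁺`, the sorting of `α` to a partition. -/
def sortComp (α : Fin N → ℕ) : Fin N → ℕ := fun i => α (sortPerm α i)

/-- Strict dominance `α ≻ β` of compositions. -/
def StrictDom (α β : Fin N → ℕ) : Prop :=
  (∀ j : Fin N, ∑ i ∈ Finset.Iic j, β i ≤ ∑ i ∈ Finset.Iic j, α i) ∧ α ≠ β

/-- The power series `(1 - x_i y_j)^{-c} = ∑_n ((c)_n / n!) x_i^n y_j^n` in the variables `y`,
with coefficients polynomials in `x`. -/
def binomFactor (c : ℝ) (i j : Fin N) : MvPowerSeries (Fin N) (MvPolynomial (Fin N) ℝ) :=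
  fun e => if e = Finsupp.single j (e j) then
    C ((ascPochhammer ℝ (e j)).eval c / ((e j).factorial : ℝ)) * X i ^ (e j) else 0

/-- `F_k(x,y) = ∏_i {(1 - x_i y_i)^{-1} ∏_j (1 - x_i y_j)^{-k}}`. -/
def genF (N : ℕ) (k : ℝ) : MvPowerSeries (Fin N) (MvPolynomial (Fin N) ℝ) :=
  ∏ i : Fin N, (binomFactor 1 i i * ∏ j : Fin N, binomFactor k i j)

/-- The polynomials `p_α` with `F_k(x,y) = ∑_α p_α(x) y^α`. -/
def pPoly (k : ℝ) (α : Fin N → ℕ) : MvPolynomial (Fin N) ℝ :=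
  MvPowerSeries.coeff (Finsupp.equivFunOnFinite.symm α) (genF N k)

/-- `f` is a simultaneous eigenfunction of `U_1, …, U_N` with eigenvalues `κ_i(α)`. -/
def IsEigen (k : ℝ) (α : Fin N → ℕ) (f : MvPolynomial (Fin N) ℝ) : Prop :=
  ∀ i, opU k i f = kappa k α i • f

/-- For a partition `lam`, the multiple
`ω_lam = p_lam + ∑ {B(β,lam) p_β : |β| = |lam|, β⁺ ≻ lam}` of the non-symmetric Jack polynomial
of label `lam`. -/
def omegaPart (k : ℝ) (lam : Fin N → ℕ) : MvPolynomial (Fin N) ℝ :=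
  Classical.epsilon fun f => IsEigen k lam f ∧
    f - pPoly k lam ∈ Submodule.span ℝ
      (pPoly k '' {β | ∑ i, β i = ∑ i, lam i ∧ StrictDom (sortComp β) lam})

/-- `ω_α = w ω_{α⁺}`, where `w` is a permutation with `w α⁺ = α`. -/
def omega (k : ℝ) (α : Fin N → ℕ) : MvPolynomial (Fin N) ℝ :=
  permOp (sortPerm α) (omegaPart k (sortComp α))

/-- The non-symmetric Jack polynomial `ζ_α`: the simultaneous eigenfunction of the `U_i` of the form
`ζ_α = ω_α + ∑ {B(β,α) ω_β : β⁺ = α⁺, β ≻ α}`. -/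
def zeta (k : ℝ) (α : Fin N → ℕ) : MvPolynomial (Fin N) ℝ :=
  Classical.epsilon fun f => IsEigen k α f ∧
    f - omega k α ∈ Submodule.span ℝ
      (omega k '' {β | sortComp β = sortComp α ∧ StrictDom β α})

/-- The interval `[ℓ+1, ℓ+m]` of `{1, …, N}`; in the indexing of `Fin N` from zero it consists of
the `i` with `ℓ ≤ i < ℓ + m`. -/
def interval (N ℓ m : ℕ) : Finset (Fin N) :=
  Finset.univ.filter fun i => ℓ ≤ (i : ℕ) ∧ (i : ℕ) < ℓ + m

/-- `S_I = {w ∈ S_N : w(i) = i for i ∉ I}`. -/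
def permsOf (I : Finset (Fin N)) : Finset (Equiv.Perm (Fin N)) :=
  Finset.univ.filter fun w => ∀ i, i ∉ I → w i = i

/-- Condition `(>, I)`: `α_i > α_j` whenever `i, j ∈ I` and `i < j`. -/
def StrictlyDecreasingOn (α : Fin N → ℕ) (I : Finset (Fin N)) : Prop :=
  ∀ i ∈ I, ∀ j ∈ I, i < j → α j < α i

/-- `ℰ_ε(β; I) = ∏ {1 + ε k / (κ_j(β) - κ_i(β)) : i, j ∈ I, i < j, β_i < β_j}`, with `ε = ± 1`. -/
def calE (k ε : ℝ) (β : Fin N → ℕ) (I : Finset (Fin N)) : ℝ :=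
  ∏ q ∈ (I ×ˢ I).filter (fun q => q.1 < q.2 ∧ β q.1 < β q.2),
    (1 + ε * k / (kappa k β q.2 - kappa k β q.1))

/-- The longest element `σ_I` of `S_I` for `I = [ℓ+1, ℓ+m] ⊆ [1, N]`: `σ_I(i) = 2ℓ + m + 1 - i` on
`I` in the indexing from one, that is `i ↦ 2ℓ + m - 1 - i` in the indexing from zero. -/
def sigmaI (ℓ m : ℕ) (h : ℓ + m ≤ N) : Equiv.Perm (Fin N) :=
  Function.Involutive.toPerm
    (fun i => if hi : ℓ ≤ (i : ℕ) ∧ (i : ℕ) < ℓ + m then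
      ⟨2 * ℓ + m - 1 - (i : ℕ), by omega⟩ else i) <| by
    intro i
    by_cases hi : ℓ ≤ (i : ℕ) ∧ (i : ℕ) < ℓ + m
    · have h2 : ℓ ≤ 2 * ℓ + m - 1 - (i : ℕ) ∧ 2 * ℓ + m - 1 - (i : ℕ) < ℓ + m := by omega
      simp only [hi, h2, and_self, dite_true]
      ext
      simp only
      omega
    · simp only [hi, dite_false]

/-- `α^R = σ_I α`. -/
def revComp (α : Fin N → ℕ) (ℓ m : ℕ) (h : ℓ + m ≤ N) : Fin N → ℕ :=
  permComp (sigmaI ℓ m h) α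

/-- The `S_I`-invariant element
`j_{α;I} = ℰ_+(α^R; I) ∑_{β ∈ S_I α} ζ_β / ℰ_+(β; I)`, for `I = [ℓ+1, ℓ+m]`. -/
def jInv (k : ℝ) (α : Fin N → ℕ) (ℓ m : ℕ) (h : ℓ + m ≤ N) : MvPolynomial (Fin N) ℝ :=
  calE k 1 (revComp α ℓ m h) (interval N ℓ m) •
    ∑ β ∈ (permsOf (interval N ℓ m)).image (fun w => permComp w α),
      (1 / calE k 1 β (interval N ℓ m)) • zeta k β

/-- The `S_I`-alternating element
`a_{α;I} = ℰ_-(α^R; I) ∑_{w ∈ S_I} sgn(w) ζ_{wα} / ℰ_-(wα; I)`, for `I = [ℓ+1, ℓ+m]`. -/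
def aAlt (k : ℝ) (α : Fin N → ℕ) (ℓ m : ℕ) (h : ℓ + m ≤ N) : MvPolynomial (Fin N) ℝ :=
  calE k (-1) (revComp α ℓ m h) (interval N ℓ m) •
    ∑ w ∈ permsOf (interval N ℓ m),
      (((Equiv.Perm.sign w : ℤ) : ℝ) / calE k (-1) (permComp w α) (interval N ℓ m)) •
        zeta k (permComp w α)

/-- The operators `ψ_s` attached to `[ℓ+1, ℓ+s] ⊆ [1, N]`: `ψ_1 = 1` and
`ψ_{s+1} = ψ̃_{s+1} - ∑_{i=ℓ+1}^{ℓ+s} (i, ℓ+s+1) ψ̃_{s+1} (i, ℓ+s+1)` with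
`ψ̃_{s+1} = U_{ℓ+1} ⋯ U_{ℓ+s} ψ_s`. Products are compositions, and `ψ_I = ψ_m` for
`I = [ℓ+1, ℓ+m]`. The recursion is started at `ψ_0 = 1`, which gives `ψ_1 = 1`. -/
def psi (k : ℝ) (ℓ : ℕ) : (s : ℕ) → ℓ + s ≤ N → Module.End ℝ (MvPolynomial (Fin N) ℝ)
  | 0, _ => 1
  | s + 1, h =>
    let t : Fin N := ⟨ℓ + s, by omega⟩
    let psiTilde : Module.End ℝ (MvPolynomial (Fin N) ℝ) :=
      (List.ofFn fun r : Fin s => opU k (⟨ℓ + r, by omega⟩ : Fin N)).prod *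
        psi k ℓ s (by omega)
    psiTilde - ∑ i ∈ interval N ℓ s, swapOp i t * psiTilde * swapOp i t

theorem psi_one (k : ℝ) (ℓ : ℕ) (h : ℓ + 1 ≤ N) : psi k ℓ 1 h = 1 := by
  have h0 : interval N ℓ 0 = ∅ := by
    ext i
    simp only [interval, Finset.mem_filter, Finset.notMem_empty, iff_false]
    omega
  simp [psi, h0]

end DunklJack

end

noncomputable section

namespace DunklJack

open MvPolynomial

variable {N : ℕ}

/-! Both sides are multiples of the symmetrization Σ_{w ∈ S_I} w ζ_α, and the scalar comes out of an
induction on the length of I.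

The main input is the action of an adjacent transposition s = (i, i+1) for α_i > α_{i+1}
(`swapOp_zeta`): s ζ_α = ζ_{sα} + k/(κ_i − κ_{i+1}) ζ_α. In j and a the terms for w and sw therefore
pair off into multiples of (1 ± s) ζ_{wα}, so j is invariant and a is alternating (`permOp_altSum`).
By the same relation, symmetrizing ζ_{wα} instead of ζ_α costs a factor 1 − k/(κ_a − κ_b) for each
inversion a < b of w (`symSum_zeta`). Sorting the terms by the entry α_r that lands in the last
place t of I expresses j and a through those of I without t (`altSum_succ`).

In the induction step, alternation turns ψ_I a into (1 + Σ_i (i t)) ψ̃ a. By the induction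
hypothesis ψ sends each shorter alternating element to a multiple of a symmetrization; the product
of the U_i acts on that by the scalar ∏ κ_i, and 1 + Σ_i (i t) completes it to a symmetrization over
S_I. The contributions of the various r add up to the expected scalar times Σ_r ∏_{i≠r} κ_i/(κ_i −
κ_r), which is 1 by Lagrange interpolation at 0. A second Lagrange identity, Σ_r ∏_{i≠r} (1 + k/(κ_i
− κ_r)) = |I|, identifies j with the symmetrization (`altSum_one_eq_symSum`).

Since `omegaPart` and `zeta` are given by `Classical.epsilon`, their existence has to be proved. The
U_i commute and are triangular on monomials; the generating function F_k satisfies U_i^x F_k = U_i^y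
F_k, which transposes this into triangularity on the p_α; and κ is injective on compositions. Linear
algebra for commuting triangular operators then yields the eigenvectors, and the uniqueness argument
that yields `swapOp_zeta`. -/

/-! ### Permutations, divided differences and commutativity of the Dunkl operators. -/

theorem permOp_mul (u v : Equiv.Perm (Fin N)) : permOp (u * v) = permOp u * permOp v := by
  refine LinearMap.ext fun f => ?_
  simp only [permOp, AlgHom.toLinearMap_apply, Module.End.mul_apply, rename_rename]
  rfl

theorem permOp_one : permOp (1 : Equiv.Perm (Fin N)) = 1 := by
  refine LinearMap.ext fun f => ?_
  simp only [permOp, AlgHom.toLinearMap_apply, Module.End.one_apply]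
  exact rename_id_apply f

theorem permOp_apply_mul (w : Equiv.Perm (Fin N)) (f g : MvPolynomial (Fin N) ℝ) :
    permOp w (f * g) = permOp w f * permOp w g := by
  simp [permOp]

theorem permOp_X (w : Equiv.Perm (Fin N)) (i : Fin N) : permOp w (X i) = X (w i) := by
  simp [permOp]

/-- Multiplication by the variable `x_i`. -/
def mulX (i : Fin N) : Module.End ℝ (MvPolynomial (Fin N) ℝ) := LinearMap.mulLeft ℝ (X i)

theorem mulX_apply (i : Fin N) (f : MvPolynomial (Fin N) ℝ) : mulX i f = X i * f := rfl

theorem permOp_mul_mulX (w : Equiv.Perm (Fin N)) (i : Fin N) :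
    permOp w * mulX i = mulX (w i) * permOp w := by
  refine LinearMap.ext fun f => ?_
  simp only [Module.End.mul_apply, mulX_apply, permOp_apply_mul, permOp_X]

theorem swapOp_mul_mulX (i j l : Fin N) :
    swapOp i j * mulX l = mulX (Equiv.swap i j l) * swapOp i j :=
  permOp_mul_mulX _ _

theorem swapOp_comm (i j : Fin N) : swapOp i j = swapOp j i := by
  rw [swapOp, Equiv.swap_comm, swapOp]

theorem swapOp_mul_self (i j : Fin N) : swapOp i j * swapOp i j = 1 := by
  rw [swapOp, ← permOp_mul, Equiv.swap_mul_self, permOp_one]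

theorem permOp_mul_swapOp (w : Equiv.Perm (Fin N)) (i j : Fin N) :
    permOp w * swapOp i j = swapOp (w i) (w j) * permOp w := by
  rw [swapOp, swapOp, ← permOp_mul, ← permOp_mul, Equiv.mul_swap_eq_swap_mul]

theorem X_sub_X_ne_zero {i j : Fin N} (h : i ≠ j) :
    (X i - X j : MvPolynomial (Fin N) ℝ) ≠ 0 :=
  sub_ne_zero.mpr fun e => h (X_injective e)

theorem divDiff_unique {i j : Fin N} (h : i ≠ j) {f g : MvPolynomial (Fin N) ℝ}
    (hg : (X i - X j) * g = f - swapOp i j f) : divDiff i j f = g :=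
  mul_left_cancel₀ (X_sub_X_ne_zero h) ((divDiff_spec i j f).trans hg.symm)

theorem permOp_mul_divDiff (w : Equiv.Perm (Fin N)) {i j : Fin N} (h : i ≠ j) :
    permOp w * divDiff i j = divDiff (w i) (w j) * permOp w := by
  refine LinearMap.ext fun f => ?_
  simp only [Module.End.mul_apply]
  refine (divDiff_unique (w.injective.ne h) ?_).symm
  have h1 := congrArg (permOp w) (divDiff_spec i j f)
  rw [permOp_apply_mul, map_sub, map_sub, permOp_X, permOp_X] at h1
  rw [h1]
  congr 1
  exact congrArg (fun A => A f) (permOp_mul_swapOp w i j)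

theorem divDiff_mul_mulX_of_ne {i j l : Fin N} (h : i ≠ j) (hi : l ≠ i) (hj : l ≠ j) :
    divDiff i j * mulX l = mulX l * divDiff i j := by
  refine LinearMap.ext fun f => ?_
  simp only [Module.End.mul_apply, mulX_apply]
  refine divDiff_unique h ?_
  rw [swapOp, permOp_apply_mul, permOp_X, Equiv.swap_apply_of_ne_of_ne hi hj, ← swapOp]
  linear_combination X l * divDiff_spec i j f

theorem divDiff_mul_mulX_right {i j : Fin N} (h : i ≠ j) :
    divDiff i j * mulX j = mulX j * divDiff i j - swapOp i j := by
  refine LinearMap.ext fun f => ?_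
  simp only [Module.End.mul_apply, mulX_apply, LinearMap.sub_apply]
  refine divDiff_unique h ?_
  rw [swapOp, permOp_apply_mul, permOp_X, Equiv.swap_apply_right, ← swapOp]
  linear_combination X j * divDiff_spec i j f

theorem divDiff_mul_mulX_left {i j : Fin N} (h : i ≠ j) :
    divDiff i j * mulX i = mulX i * divDiff i j + swapOp i j := by
  refine LinearMap.ext fun f => ?_
  simp only [Module.End.mul_apply, mulX_apply, LinearMap.add_apply]
  refine divDiff_unique h ?_
  rw [swapOp, permOp_apply_mul, permOp_X, Equiv.swap_apply_left, ← swapOp]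
  linear_combination X i * divDiff_spec i j f

theorem permOp_mul_dunklT (k : ℝ) (w : Equiv.Perm (Fin N)) (i : Fin N) :
    permOp w * dunklT k i = dunklT k (w i) * permOp w := by
  rw [dunklT, dunklT, mul_add, add_mul, mul_smul_comm, smul_mul_assoc, Finset.mul_sum,
    Finset.sum_mul]
  congr 1
  · refine LinearMap.ext fun f => ?_
    simp only [Module.End.mul_apply, permOp, AlgHom.toLinearMap_apply,
      Derivation.coeFn_coe]
    exact (pderiv_rename w.injective i f).symm
  · congr 1
    refine Finset.sum_equiv w (by simp) fun j hj => ?_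
    exact permOp_mul_divDiff w (Finset.mem_filter.1 hj).2.symm

theorem dunklT_mul_mulX_of_ne (k : ℝ) {i j : Fin N} (h : i ≠ j) :
    dunklT k i * mulX j = mulX j * dunklT k i - k • swapOp i j := by
  have h1 : (pderiv (R := ℝ) i).toLinearMap * mulX j = mulX j * (pderiv (R := ℝ) i).toLinearMap := by
    refine LinearMap.ext fun f => ?_
    simp [mulX_apply, Derivation.leibniz, pderiv_X_of_ne h.symm]
  have hj : j ∈ Finset.univ.filter (fun l => l ≠ i) := by simp [h.symm]
  rw [dunklT, add_mul, mul_add, h1, smul_mul_assoc, mul_smul_comm, Finset.mul_sum, Finset.sum_mul,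
    ← Finset.add_sum_erase _ _ hj, ← Finset.add_sum_erase _ _ hj, divDiff_mul_mulX_right h,
    Finset.sum_congr rfl fun l hl => divDiff_mul_mulX_of_ne (i := i) (j := l) (l := j)
      (by simp at hl; tauto) h.symm (by simp at hl; tauto)]
  module

theorem dunklT_mul_mulX_self (k : ℝ) (i : Fin N) :
    dunklT k i * mulX i = mulX i * dunklT k i + 1 +
      k • ∑ j ∈ Finset.univ.filter (fun j => j ≠ i), swapOp i j := by
  have h1 : (pderiv (R := ℝ) i).toLinearMap * mulX i =
      mulX i * (pderiv (R := ℝ) i).toLinearMap + 1 := by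
    refine LinearMap.ext fun f => ?_
    simp [mulX_apply, Derivation.leibniz]
  rw [dunklT, add_mul, mul_add, h1, smul_mul_assoc, mul_smul_comm, Finset.mul_sum, Finset.sum_mul,
    Finset.sum_congr rfl fun l hl => divDiff_mul_mulX_left (i := i) (j := l)
      (by simp at hl; tauto), Finset.sum_add_distrib]
  module

theorem dunklT_one (k : ℝ) (i : Fin N) : dunklT k i 1 = 0 := by
  simp only [dunklT, LinearMap.add_apply, LinearMap.smul_apply, LinearMap.sum_apply]
  rw [Finset.sum_eq_zero fun j hj => divDiff_unique (by simp at hj; tauto) (by simp [swapOp, permOp])]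
  simp

theorem swapOp_mul_dunklT (k : ℝ) (i j l : Fin N) :
    swapOp i j * dunklT k l = dunklT k (Equiv.swap i j l) * swapOp i j :=
  permOp_mul_dunklT k _ _

theorem swapOp_mul_dunklT_of_ne (k : ℝ) {i j l : Fin N} (hi : l ≠ i) (hj : l ≠ j) :
    swapOp i j * dunklT k l = dunklT k l * swapOp i j := by
  rw [swapOp_mul_dunklT, Equiv.swap_apply_of_ne_of_ne hi hj]

/-- The polynomials are generated from 1 by the multiplications x_l. This reduces the commutativity
of the T_i to relations between T_i, x_l and transpositions. -/
theorem eq_zero_of_commute_mulX (A : Module.End ℝ (MvPolynomial (Fin N) ℝ))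
    (h1 : A 1 = 0) (h : ∀ l, A * mulX l = mulX l * A) : A = 0 := by
  refine LinearMap.ext fun f => ?_
  rw [LinearMap.zero_apply]
  induction f using MvPolynomial.induction_on with
  | C a => rw [show (C a : MvPolynomial (Fin N) ℝ) = a • 1 by rw [smul_eq_C_mul, mul_one], map_smul,
      h1, smul_zero]
  | add p q hp hq => rw [map_add, hp, hq, add_zero]
  | mul_X p n hp =>
    have := congrArg (fun B => B p) (h n)
    simp only [Module.End.mul_apply, mulX_apply, hp, mul_zero] at this
    rw [mul_comm, this]

/-- With S the sum of the (i l) over l ≠ i, j, moving x_i to the left past T_i T_j and past T_j T_i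
produces the same extra term T_j + k T_j S. -/
theorem commutator_dunklT_mulX_self (k : ℝ) {i j : Fin N} (h : i ≠ j) :
    (dunklT k i * dunklT k j - dunklT k j * dunklT k i) * mulX i =
      mulX i * (dunklT k i * dunklT k j - dunklT k j * dunklT k i) := by
  have hj : j ∈ Finset.univ.filter (fun l => l ≠ i) := by simp [h.symm]
  set S := ∑ l ∈ (Finset.univ.filter (fun l => l ≠ i)).erase j, swapOp i l with hS
  have e1 := dunklT_mul_mulX_self k i
  rw [← Finset.add_sum_erase _ _ hj, ← hS] at e1
  have e2 := dunklT_mul_mulX_of_ne k h.symm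
  rw [swapOp_comm] at e2
  have e3 : S * dunklT k j = dunklT k j * S := by
    rw [hS, Finset.sum_mul, Finset.mul_sum]
    refine Finset.sum_congr rfl fun l hl => swapOp_mul_dunklT_of_ne k h.symm ?_
    simp at hl; tauto
  have e4 : swapOp i j * dunklT k i = dunklT k j * swapOp i j := by
    rw [swapOp_mul_dunklT, Equiv.swap_apply_left]
  have e5 : swapOp i j * dunklT k j = dunklT k i * swapOp i j := by
    rw [swapOp_mul_dunklT, Equiv.swap_apply_right]
  generalize dunklT k i = A at *
  generalize dunklT k j = B at *
  generalize mulX i = x at *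
  generalize swapOp i j = s at *
  have f1 : A * B * x = x * (A * B) + B + k • (B * S) := by
    rw [mul_assoc, e2, mul_sub, ← mul_assoc, e1, add_mul, add_mul, one_mul, smul_mul_assoc, add_mul,
      e5, e3, mul_smul_comm, mul_assoc]
    module
  have f2 : B * A * x = x * (B * A) + B + k • (B * S) := by
    rw [mul_assoc, e1, mul_add, mul_add, ← mul_assoc, e2, sub_mul, smul_mul_assoc, e4, mul_one,
      mul_smul_comm, mul_add, mul_assoc]
    module
  rw [sub_mul, mul_sub, f1, f2]
  abel

theorem dunklT_commute (k : ℝ) (i j : Fin N) :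
    dunklT k i * dunklT k j = dunklT k j * dunklT k i := by
  by_cases h : i = j
  · rw [h]
  refine sub_eq_zero.1 (eq_zero_of_commute_mulX _ ?_ fun l => ?_)
  · simp [dunklT_one]
  by_cases hi : l = i
  · rw [hi]; exact commutator_dunklT_mulX_self k h
  by_cases hj : l = j
  · have := commutator_dunklT_mulX_self k (Ne.symm h)
    rw [sub_mul, mul_sub] at this ⊢
    rw [hj, ← neg_sub, this, neg_sub]
  have e1 := dunklT_mul_mulX_of_ne k (Ne.symm hi)
  have e2 := dunklT_mul_mulX_of_ne k (Ne.symm hj)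
  have e3 := swapOp_mul_dunklT_of_ne k (i := i) (j := l) (l := j) (Ne.symm h) (Ne.symm hj)
  have e4 := swapOp_mul_dunklT_of_ne k (i := j) (j := l) (l := i) h (Ne.symm hi)
  rw [sub_mul, mul_sub, mul_assoc, e2, mul_sub, ← mul_assoc, e1, mul_assoc (dunklT k j), e1, mul_sub,
    ← mul_assoc, e2, sub_mul, sub_mul, mul_smul_comm, mul_smul_comm, smul_mul_assoc, smul_mul_assoc,
    e3, e4, mul_assoc, mul_assoc]
  abel

/-! ### Commutativity and exchange relations of the U_i. -/

/-- The operator `T_i x_i`. -/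
def dunklD (k : ℝ) (i : Fin N) : Module.End ℝ (MvPolynomial (Fin N) ℝ) := dunklT k i * mulX i

theorem permOp_mul_dunklD (k : ℝ) (w : Equiv.Perm (Fin N)) (i : Fin N) :
    permOp w * dunklD k i = dunklD k (w i) * permOp w := by
  rw [dunklD, ← mul_assoc, permOp_mul_dunklT, mul_assoc, permOp_mul_mulX, ← mul_assoc, dunklD]

theorem swapOp_mul_dunklD_of_ne (k : ℝ) {i j l : Fin N} (hi : l ≠ i) (hj : l ≠ j) :
    swapOp i j * dunklD k l = dunklD k l * swapOp i j := by
  rw [swapOp, permOp_mul_dunklD, Equiv.swap_apply_of_ne_of_ne hi hj]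

/-- Moving x_i past T_j gives D_i D_j = T_i T_j x_i x_j + k D_i (i j), and the first term is
symmetric in i and j. -/
theorem dunklD_commutator (k : ℝ) {i j : Fin N} (h : i ≠ j) :
    dunklD k i * dunklD k j - dunklD k j * dunklD k i =
      k • ((dunklD k i - dunklD k j) * swapOp i j) := by
  have key : ∀ {i j : Fin N}, i ≠ j → dunklD k i * dunklD k j =
      dunklT k i * dunklT k j * (mulX i * mulX j) + k • (dunklD k i * swapOp i j) := by
    intro i j h
    have e := dunklT_mul_mulX_of_ne k (Ne.symm h)
    have e1 : mulX i * dunklT k j = dunklT k j * mulX i + k • swapOp i j := by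
      rw [e, swapOp_comm]; abel
    have e2 : swapOp i j * mulX j = mulX i * swapOp i j := by
      rw [swapOp_mul_mulX, Equiv.swap_apply_right]
    rw [dunklD, dunklD, mul_assoc, ← mul_assoc (mulX i), e1, add_mul, mul_add, smul_mul_assoc, e2,
      mul_smul_comm]
    simp only [mul_assoc]
  have hx : (mulX i * mulX j : Module.End ℝ (MvPolynomial (Fin N) ℝ)) = mulX j * mulX i := by
    refine LinearMap.ext fun f => ?_
    simp only [Module.End.mul_apply, mulX_apply]; ring
  rw [key h, key h.symm, hx, dunklT_commute k i j, swapOp_comm j i, sub_mul, smul_sub]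
  abel

/-- The Jucys–Murphy element `∑_{j < i} (i j)` as an operator. -/
def murphy (i : Fin N) : Module.End ℝ (MvPolynomial (Fin N) ℝ) :=
  ∑ j ∈ Finset.univ.filter (fun j => j < i), swapOp i j

theorem opU_eq (k : ℝ) (i : Fin N) : opU k i = dunklD k i + k • 1 - k • murphy i := rfl

theorem permOp_mul_murphy {w : Equiv.Perm (Fin N)} {i : Fin N} (hi : w i = i)
    (h : ∀ j, j < i ↔ w j < i) : permOp w * murphy i = murphy i * permOp w := by
  rw [murphy, Finset.mul_sum, Finset.sum_mul]
  refine Finset.sum_equiv w (by simpa using h) fun j _ => ?_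
  rw [permOp_mul_swapOp, hi]

theorem swapOp_mul_murphy {a b i : Fin N} (ha : a < i) (hb : b < i) :
    swapOp a b * murphy i = murphy i * swapOp a b := by
  refine permOp_mul_murphy (Equiv.swap_apply_of_ne_of_ne ha.ne' hb.ne') fun j => ?_
  rcases eq_or_ne j a with rfl | h1
  · simp [ha, hb]
  rcases eq_or_ne j b with rfl | h2
  · simp [ha, hb]
  rw [Equiv.swap_apply_of_ne_of_ne h1 h2]

theorem murphy_commute_of_lt {i j : Fin N} (h : i < j) :
    murphy i * murphy j = murphy j * murphy i := by
  rw [murphy, Finset.sum_mul, Finset.mul_sum]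
  refine Finset.sum_congr rfl fun l hl => ?_
  have : l < i := by simpa using hl
  exact swapOp_mul_murphy h (this.trans h)

theorem murphy_mul_dunklD (k : ℝ) {i j : Fin N} (h : i < j) :
    murphy i * dunklD k j = dunklD k j * murphy i := by
  rw [murphy, Finset.sum_mul, Finset.mul_sum]
  refine Finset.sum_congr rfl fun l hl => ?_
  have : l < i := by simpa using hl
  exact swapOp_mul_dunklD_of_ne k h.ne' (this.trans h).ne'

/-- Only the summand (i j) of the Jucys–Murphy element fails to commute with D_i. After
multiplication by k the result equals the commutator of D_i and D_j, so the two contributions to the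
commutator of U_i and U_j cancel. -/
theorem murphy_mul_dunklD_sub (k : ℝ) {i j : Fin N} (h : i < j) :
    dunklD k i * murphy j - murphy j * dunklD k i = (dunklD k i - dunklD k j) * swapOp i j := by
  have hi : i ∈ Finset.univ.filter (fun l => l < j) := by simpa using h
  have e : ∀ l ∈ (Finset.univ.filter (fun l => l < j)).erase i,
      swapOp j l * dunklD k i = dunklD k i * swapOp j l := fun l hl =>
    swapOp_mul_dunklD_of_ne k h.ne (by simp at hl; tauto)
  have e1 : swapOp i j * dunklD k i = dunklD k j * swapOp i j := by
    rw [swapOp, permOp_mul_dunklD, Equiv.swap_apply_left]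
  rw [murphy, ← Finset.add_sum_erase _ _ hi, add_mul, mul_add, Finset.sum_mul, Finset.mul_sum,
    Finset.sum_congr rfl e, swapOp_comm, e1, sub_mul]
  abel

theorem opU_commute_of_lt (k : ℝ) {i j : Fin N} (h : i < j) :
    opU k i * opU k j = opU k j * opU k i := by
  have e1 := dunklD_commutator k h.ne
  have e2 := murphy_mul_dunklD k h
  have e3 := murphy_mul_dunklD_sub k h
  have e4 := murphy_commute_of_lt h
  rw [opU_eq, opU_eq]
  rw [← e3] at e1
  generalize dunklD k i = A at *
  generalize dunklD k j = B at *
  generalize murphy i = a at *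
  generalize murphy j = b at *
  rw [← sub_eq_zero]
  have : (A + k • 1 - k • a) * (B + k • 1 - k • b) - (B + k • 1 - k • b) * (A + k • 1 - k • a) =
      (A * B - B * A - k • (A * b - b * A)) - k • (a * B - B * a) + (k * k) • (a * b - b * a) := by
    simp only [add_mul, mul_add, sub_mul, mul_sub, smul_mul_assoc, mul_smul_comm, mul_one, one_mul]
    module
  rw [this, e1, e2, e4]
  simp

theorem opU_commute (k : ℝ) (i j : Fin N) : Commute (opU k i) (opU k j) := by
  rcases lt_trichotomy i j with h | rfl | h
  · exact opU_commute_of_lt k h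
  · exact Commute.refl _
  · exact (opU_commute_of_lt k h).symm

theorem swapOp_mul_opU_of_ne (k : ℝ) {i j l : Fin N} (hij : (j : ℕ) = i + 1) (hi : l ≠ i)
    (hj : l ≠ j) : swapOp i j * opU k l = opU k l * swapOp i j := by
  have e : swapOp i j * murphy l = murphy l * swapOp i j := by
    refine permOp_mul_murphy (Equiv.swap_apply_of_ne_of_ne hi hj) fun a => ?_
    have h1 : (l : ℕ) ≠ i := fun h => hi (Fin.ext h)
    have h2 : (l : ℕ) ≠ j := fun h => hj (Fin.ext h)
    rw [Equiv.swap_apply_def]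
    split_ifs with c1 c2
    · subst c1; rw [Fin.lt_def, Fin.lt_def]; omega
    · subst c2; rw [Fin.lt_def, Fin.lt_def]; omega
    · rfl
  rw [opU_eq, mul_sub, mul_add, sub_mul, add_mul, swapOp_mul_dunklD_of_ne k hi hj, mul_smul_comm,
    smul_mul_assoc, mul_smul_comm, smul_mul_assoc, e, mul_one, one_mul]

/-- The relation of the degenerate affine Hecke algebra. The D_i are simply permuted; the constant k
arises because conjugating the i-th Jucys–Murphy element by (i j) gives the j-th one without its
summand (i j). -/
theorem swapOp_mul_opU (k : ℝ) {i j : Fin N} (hij : (j : ℕ) = i + 1) :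
    swapOp i j * opU k i = opU k j * swapOp i j + k • 1 := by
  have e1 : swapOp i j * dunklD k i = dunklD k j * swapOp i j := by
    rw [swapOp, permOp_mul_dunklD, Equiv.swap_apply_left]
  have hlt : i < j := by rw [Fin.lt_def]; omega
  have hi : i ∈ Finset.univ.filter (fun l => l < j) := by simpa using hlt
  have e2 : swapOp i j * murphy i = (murphy j - swapOp i j) * swapOp i j := by
    rw [murphy, murphy, ← Finset.add_sum_erase _ _ hi, swapOp_comm j i, add_sub_cancel_left,
      Finset.mul_sum, Finset.sum_mul]
    have e : (Finset.univ.filter fun l => l < j).erase i = Finset.univ.filter fun l => l < i := by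
      ext l
      simp only [Finset.mem_filter, Finset.mem_univ, true_and, Finset.mem_erase, Fin.lt_def,
        ne_eq, Fin.ext_iff]
      omega
    rw [e]
    refine Finset.sum_congr rfl fun l hl => ?_
    have hl : l < i := (Finset.mem_filter.1 hl).2
    rw [swapOp, permOp_mul_swapOp, Equiv.swap_apply_left,
      Equiv.swap_apply_of_ne_of_ne hl.ne (hl.trans hlt).ne]
  rw [opU_eq, opU_eq, mul_sub, mul_add, sub_mul, add_mul, e1, mul_smul_comm, mul_smul_comm, e2,
    smul_mul_assoc, smul_mul_assoc, sub_mul, swapOp_mul_self, mul_one, one_mul]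
  module

theorem opU_mul_swapOp (k : ℝ) {i j : Fin N} (hij : (j : ℕ) = i + 1) :
    opU k i * swapOp i j = swapOp i j * opU k j + k • 1 := by
  have h := congrArg (fun A => swapOp i j * A * swapOp i j) (swapOp_mul_opU k hij)
  simp only [mul_add, add_mul, mul_smul_comm, smul_mul_assoc, mul_one, swapOp_mul_self] at h
  rw [← mul_assoc, ← mul_assoc, swapOp_mul_self, one_mul] at h
  rw [h, mul_assoc, mul_assoc, swapOp_mul_self, mul_one]

/-! ### Monomials and the divided differences of monomials. -/

/-- The monomial `x^β`. -/
def mon (β : Fin N → ℕ) : MvPolynomial (Fin N) ℝ :=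
  monomial (Finsupp.equivFunOnFinite.symm β) 1

/-- The coefficient of `x^α`. -/
def coefAt (α : Fin N → ℕ) : MvPolynomial (Fin N) ℝ →ₗ[ℝ] ℝ :=
  lcoeff ℝ (Finsupp.equivFunOnFinite.symm α)

theorem coefAt_mon (α β : Fin N → ℕ) : coefAt α (mon β) = if β = α then 1 else 0 := by
  simp [coefAt, mon, coeff_monomial]

theorem X_mul_mon (i : Fin N) (β : Fin N → ℕ) :
    X i * mon β = mon (Function.update β i (β i + 1)) := by
  rw [mon, mon, X, monomial_mul, one_mul]
  refine congrArg (fun e => monomial e (1 : ℝ)) (Finsupp.ext fun l => ?_)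
  rcases eq_or_ne l i with rfl | h
  · simp [add_comm]
  · simp [h, Finsupp.single_eq_of_ne h]

theorem permOp_mon (w : Equiv.Perm (Fin N)) (β : Fin N → ℕ) :
    permOp w (mon β) = mon (permComp w β) := by
  rw [permOp, AlgHom.toLinearMap_apply, mon, mon, rename_monomial]
  refine congrArg (fun e => monomial e (1 : ℝ)) (Finsupp.ext fun l => ?_)
  obtain ⟨l, rfl⟩ := w.surjective l
  rw [Finsupp.mapDomain_apply w.injective]
  simp [permComp]

theorem pderiv_X_mul_mon (i : Fin N) (β : Fin N → ℕ) :
    pderiv (R := ℝ) i (X i * mon β) = ((β i : ℝ) + 1) • mon β := by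
  rw [X_mul_mon, mon, mon, pderiv_monomial, smul_monomial]
  congr 1
  · refine congrArg (fun e => monomial (R := ℝ) e) (Finsupp.ext fun l => ?_)
    rcases eq_or_ne l i with rfl | h
    · simp
    · simp [h, Finsupp.single_eq_of_ne h]
  · simp

theorem permComp_mul (u v : Equiv.Perm (Fin N)) (α : Fin N → ℕ) :
    permComp (u * v) α = permComp u (permComp v α) := by
  funext i; simp [permComp]

theorem permComp_one (α : Fin N → ℕ) : permComp 1 α = α := rfl

theorem permComp_swap_apply (i j l : Fin N) (α : Fin N → ℕ) :
    permComp (Equiv.swap i j) α l = α (Equiv.swap i j l) := by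
  simp [permComp]

theorem permComp_swap (i j : Fin N) (α : Fin N → ℕ) :
    permComp (Equiv.swap i j) α = Function.update (Function.update α i (α j)) j (α i) := by
  funext l
  rw [permComp_swap_apply]
  rcases eq_or_ne l j with rfl | h1
  · simp
  rcases eq_or_ne l i with rfl | h2
  · simp [h1]
  · simp [h1, h2, Equiv.swap_apply_of_ne_of_ne h2 h1]

/-- The operator `f ↦ (x_i f - x_j (i j) f) / (x_i - x_j)`. -/
def nabla (i j : Fin N) : Module.End ℝ (MvPolynomial (Fin N) ℝ) := divDiff i j * mulX i

theorem nabla_spec (i j : Fin N) (f : MvPolynomial (Fin N) ℝ) :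
    (X i - X j) * nabla i j f = X i * f - X j * swapOp i j f := by
  rw [nabla, Module.End.mul_apply, divDiff_spec, mulX_apply, swapOp, permOp_apply_mul, permOp_X,
    Equiv.swap_apply_left]

theorem nabla_unique {i j : Fin N} (h : i ≠ j) {f g : MvPolynomial (Fin N) ℝ}
    (hg : (X i - X j) * g = X i * f - X j * swapOp i j f) : nabla i j f = g :=
  mul_left_cancel₀ (X_sub_X_ne_zero h) ((nabla_spec i j f).trans hg.symm)

theorem X_left_mul_mon_update {i j : Fin N} (h : i ≠ j) (β : Fin N → ℕ) (p q : ℕ) :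
    X i * mon (Function.update (Function.update β i p) j q) =
      mon (Function.update (Function.update β i (p + 1)) j q) := by
  rw [X_mul_mon, Function.update_of_ne h, Function.update_self, Function.update_comm h,
    Function.update_idem, Function.update_comm h.symm]

theorem X_right_mul_mon_update {i j : Fin N} (β : Fin N → ℕ) (p q : ℕ) :
    X j * mon (Function.update (Function.update β i p) j q) =
      mon (Function.update (Function.update β i p) j (q + 1)) := by
  rw [X_mul_mon, Function.update_self, Function.update_idem]

theorem X_mul_mon_sub {i j : Fin N} (h : i ≠ j) (β : Fin N → ℕ) :
    X i * mon β - X j * swapOp i j (mon β) =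
      mon (Function.update (Function.update β i (β i + 1)) j (β j)) -
        mon (Function.update (Function.update β i (β j)) j (β i + 1)) := by
  have e : Function.update (Function.update β i (β i + 1)) j (β j) =
      Function.update β i (β i + 1) := by
    rw [Function.update_comm h, Function.update_eq_self]
  rw [swapOp, permOp_mon, permComp_swap, X_right_mul_mon_update, X_mul_mon, e]

/-- A telescoping geometric sum in which the exponent of x_i runs from β_j to β_i inclusive, so that
both x^β and its image under (i j) occur. In `nabla_mon_of_lt` both ends are missing and the sign is
reversed; this asymmetry creates the counting terms of κ. -/
theorem nabla_mon_of_le {i j : Fin N} (h : i ≠ j) {β : Fin N → ℕ} (hβ : β j ≤ β i) :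
    nabla i j (mon β) = ∑ l ∈ Finset.range (β i - β j + 1),
      mon (Function.update (Function.update β i (β j + l)) j (β i - l)) := by
  refine nabla_unique h ?_
  rw [X_mul_mon_sub h, Finset.mul_sum]
  have e : ∀ l ∈ Finset.range (β i - β j + 1), (X i - X j) *
      mon (Function.update (Function.update β i (β j + l)) j (β i - l)) =
      mon (Function.update (Function.update β i (β j + (l + 1))) j (β i + 1 - (l + 1))) -
        mon (Function.update (Function.update β i (β j + l)) j (β i + 1 - l)) := by
    intro l hl
    rw [Finset.mem_range] at hl
    rw [sub_mul, X_left_mul_mon_update h, X_right_mul_mon_update,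
      show β i + 1 - l = β i - l + 1 by omega, show β i + 1 - (l + 1) = β i - l by omega, add_assoc]
  rw [Finset.sum_congr rfl e, Finset.sum_range_sub
    (fun l => mon (Function.update (Function.update β i (β j + l)) j (β i + 1 - l)))]
  rw [show β j + (β i - β j + 1) = β i + 1 by omega,
    show β i + 1 - (β i - β j + 1) = β j by omega, add_zero, Nat.sub_zero]

theorem nabla_mon_of_lt {i j : Fin N} (h : i ≠ j) {β : Fin N → ℕ} (hβ : β i < β j) :
    nabla i j (mon β) = -∑ l ∈ Finset.range (β j - β i - 1),
      mon (Function.update (Function.update β i (β i + 1 + l)) j (β j - 1 - l)) := by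
  refine nabla_unique h ?_
  rw [X_mul_mon_sub h, mul_neg, Finset.mul_sum]
  have e : ∀ l ∈ Finset.range (β j - β i - 1), (X i - X j) *
      mon (Function.update (Function.update β i (β i + 1 + l)) j (β j - 1 - l)) =
      mon (Function.update (Function.update β i (β i + 1 + (l + 1))) j (β j - (l + 1))) -
        mon (Function.update (Function.update β i (β i + 1 + l)) j (β j - l)) := by
    intro l hl
    rw [Finset.mem_range] at hl
    rw [sub_mul, X_left_mul_mon_update h, X_right_mul_mon_update,
      show β j - 1 - l + 1 = β j - l by omega, show β j - (l + 1) = β j - 1 - l by omega,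
      ← add_assoc]
  rw [Finset.sum_congr rfl e, Finset.sum_range_sub
    (fun l => mon (Function.update (Function.update β i (β i + 1 + l)) j (β j - l)))]
  rw [show β i + 1 + (β j - β i - 1) = β j by omega,
    show β j - (β j - β i - 1) = β i + 1 by omega, add_zero, Nat.sub_zero, neg_sub]

/-! ### Dominance orders and triangularity of the U_i on monomials. -/

theorem sortComp_eq_comp (α : Fin N → ℕ) : sortComp α = α ∘ sortPerm α := rfl

theorem sortComp_antitone (α : Fin N → ℕ) : Antitone (sortComp α) := fun _ _ hij =>
  OrderDual.toDual_le_toDual.1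
    (Tuple.monotone_sort (fun i => OrderDual.toDual (α i)) hij)

theorem sortComp_permComp (w : Equiv.Perm (Fin N)) (α : Fin N → ℕ) :
    sortComp (permComp w α) = sortComp α := by
  have := Tuple.comp_perm_comp_sort_eq_comp_sort (f := fun i => OrderDual.toDual (α i)) (σ := w⁻¹)
  funext i
  exact OrderDual.toDual.injective (congrFun this i)

theorem sum_le_sum_Iic_of_antitone {f : Fin N → ℕ} (hf : Antitone f) (m : Fin N)
    {S : Finset (Fin N)} (hS : S.card = (Finset.Iic m).card) :
    ∑ i ∈ S, f i ≤ ∑ i ∈ Finset.Iic m, f i := by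
  have h1 : ∑ i ∈ S \ Finset.Iic m, f i ≤ (S \ Finset.Iic m).card • f m :=
    Finset.sum_le_card_nsmul _ _ _ fun i hi => hf (by simp at hi; exact hi.2.le)
  have h2 : (Finset.Iic m \ S).card • f m ≤ ∑ i ∈ Finset.Iic m \ S, f i :=
    Finset.card_nsmul_le_sum _ _ _ fun i hi => hf (by simp at hi; exact hi.1)
  rw [Finset.card_sdiff_comm hS] at h1
  have h3 := Finset.sum_inter_add_sum_sdiff S (Finset.Iic m) f
  have h4 := Finset.sum_inter_add_sum_sdiff (Finset.Iic m) S f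
  rw [Finset.inter_comm] at h4
  omega

theorem sum_le_sum_sortComp (α : Fin N → ℕ) (m : Fin N) {S : Finset (Fin N)}
    (hS : S.card = (Finset.Iic m).card) :
    ∑ i ∈ S, α i ≤ ∑ i ∈ Finset.Iic m, sortComp α i := by
  have h := sum_le_sum_Iic_of_antitone (sortComp_antitone α) m
    (S := S.map (sortPerm α)⁻¹.toEmbedding) (by simpa using hS)
  rw [Finset.sum_map] at h
  simpa [sortComp] using h

/-- A partial sum of the sorted composition is the largest sum over subsets of that size, so
dominance of the sortings can be tested on arbitrary subsets. -/
theorem sortComp_dominates {α β : Fin N → ℕ} (h : ∀ S : Finset (Fin N), ∃ S' : Finset (Fin N),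
    S'.card = S.card ∧ ∑ i ∈ S, β i ≤ ∑ i ∈ S', α i) (j : Fin N) :
    ∑ i ∈ Finset.Iic j, sortComp β i ≤ ∑ i ∈ Finset.Iic j, sortComp α i := by
  obtain ⟨S', h1, h2⟩ := h ((Finset.Iic j).map (sortPerm β).toEmbedding)
  rw [Finset.sum_map] at h2
  rw [Finset.card_map] at h1
  exact le_trans h2 (sum_le_sum_sortComp α j h1)

/-- Moving two entries closer together, with fixed sum, lowers the sorting. A subset containing i
but not j is compared with the one where j replaces i, any other subset with itself. Strictness
holds because the sum of squares depends only on the sorting and drops. -/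
theorem strictDom_sortComp_update {β : Fin N → ℕ} {i j : Fin N} (hij : i ≠ j) {p q : ℕ}
    (h1 : β i < p) (h2 : p < β j) (h3 : p + q = β i + β j) :
    StrictDom (sortComp β) (sortComp (Function.update (Function.update β i p) j q)) := by
  set γ := Function.update (Function.update β i p) j q with hγ
  have gi : γ i = p := by simp [hγ, hij]
  have gj : γ j = q := by simp [hγ]
  have gl : ∀ l, l ≠ i → l ≠ j → γ l = β l := fun l hi hj => by simp [hγ, hi, hj]
  refine ⟨sortComp_dominates fun S => ?_, fun h => ?_⟩
  · have e0 : ∀ T : Finset (Fin N), i ∉ T → j ∉ T → ∑ l ∈ T, γ l = ∑ l ∈ T, β l :=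
      fun T hi hj => Finset.sum_congr rfl fun l hl =>
        gl l (fun h => hi (h ▸ hl)) (fun h => hj (h ▸ hl))
    by_cases hi : i ∈ S
    · by_cases hj : j ∈ S
      · refine ⟨S, rfl, le_of_eq ?_⟩
        have hj' : j ∈ S.erase i := by simp [hj, hij.symm]
        have := e0 ((S.erase i).erase j) (by simp) (by simp)
        rw [← Finset.add_sum_erase _ _ hi, ← Finset.add_sum_erase _ _ hj',
          ← Finset.add_sum_erase S β hi, ← Finset.add_sum_erase _ β hj']
        omega
      · refine ⟨insert j (S.erase i), ?_, ?_⟩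
        · rw [Finset.card_insert_of_notMem (by simp [hj]), Finset.card_erase_add_one hi]
        · have := e0 (S.erase i) (by simp) (by simp [hj])
          rw [Finset.sum_insert (by simp [hj]), ← Finset.add_sum_erase _ _ hi]
          omega
    · refine ⟨S, rfl, ?_⟩
      by_cases hj : j ∈ S
      · have := e0 (S.erase j) (by simp [hi]) (by simp)
        rw [← Finset.add_sum_erase _ _ hj, ← Finset.add_sum_erase _ β hj]
        omega
      · exact (e0 S hi hj).le
  · have e1 : ∀ α : Fin N → ℕ, ∑ l, sortComp α l ^ 2 = ∑ l, α l ^ 2 := fun α =>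
      Equiv.sum_comp (sortPerm α) fun l => α l ^ 2
    have e2 : ∑ l, β l ^ 2 = ∑ l, γ l ^ 2 := by rw [← e1 β, h, e1]
    have hi := Finset.mem_univ i
    have hj : j ∈ Finset.univ.erase i := by simp [hij.symm]
    rw [← Finset.add_sum_erase _ _ hi, ← Finset.add_sum_erase _ _ hj,
      ← Finset.add_sum_erase _ (fun l => γ l ^ 2) hi,
      ← Finset.add_sum_erase _ (fun l => γ l ^ 2) hj,
      Finset.sum_congr rfl (g := fun l => γ l ^ 2) fun l hl => by
        simp at hl; rw [gl l hl.2 hl.1], gi, gj] at e2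
    nlinarith

theorem strictDom_swap {β : Fin N → ℕ} {i j : Fin N} (hij : i < j) (hβ : β i < β j) :
    StrictDom (permComp (Equiv.swap i j) β) β := by
  refine ⟨fun m => ?_, fun h => ?_⟩
  · by_cases hm : j ≤ m
    · refine le_of_eq (Finset.sum_equiv (Equiv.swap i j) (fun l => ?_) fun l _ => ?_)
      · rw [Finset.mem_Iic, Finset.mem_Iic, Equiv.swap_apply_def]
        split_ifs with c1 c2
        · subst c1; exact iff_of_true (hij.le.trans hm) hm
        · subst c2; exact iff_of_true hm (hij.le.trans hm)
        · rfl
      · rw [permComp_swap_apply, Equiv.swap_apply_self]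
    · refine Finset.sum_le_sum fun l hl => ?_
      have hl : l ≤ m := by simpa using hl
      rw [permComp_swap_apply]
      rcases eq_or_ne l i with rfl | h1
      · rw [Equiv.swap_apply_left]; exact hβ.le
      · rw [Equiv.swap_apply_of_ne_of_ne h1 (fun h : l = j => hm (h ▸ hl))]
  · have := congrFun h i
    rw [permComp_swap_apply, Equiv.swap_apply_left] at this
    omega

/-- The strict order on compositions for which the `U_i` are triangular on monomials: first the
dominance order on the sorted compositions, then the dominance order. -/
def TriLt (α β : Fin N → ℕ) : Prop :=
  StrictDom (sortComp β) (sortComp α) ∨ (sortComp α = sortComp β ∧ StrictDom β α)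

theorem StrictDom.trans {α β γ : Fin N → ℕ} (h1 : StrictDom α β) (h2 : StrictDom β γ) :
    StrictDom α γ := by
  refine ⟨fun j => (h2.1 j).trans (h1.1 j), fun h => h1.2 ?_⟩
  subst h
  have e : ∀ j, ∑ i ∈ Finset.Iic j, α i = ∑ i ∈ Finset.Iic j, β i := fun j =>
    le_antisymm (h2.1 j) (h1.1 j)
  funext j
  have e1 := e j
  have hj : j ∈ Finset.Iic j := by simp
  rw [← Finset.add_sum_erase _ _ hj, ← Finset.add_sum_erase _ _ hj] at e1
  suffices ∑ i ∈ (Finset.Iic j).erase j, α i = ∑ i ∈ (Finset.Iic j).erase j, β i by omega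
  by_cases h0 : (j : ℕ) = 0
  · have : (Finset.Iic j).erase j = ∅ := by
      ext l
      simp only [Finset.mem_erase, Finset.mem_Iic, Finset.notMem_empty, iff_false, not_and, ne_eq,
        Fin.ext_iff, Fin.le_def]
      omega
    rw [this, Finset.sum_empty, Finset.sum_empty]
  · have : (Finset.Iic j).erase j = Finset.Iic ⟨j - 1, by omega⟩ := by
      ext l
      simp only [Finset.mem_erase, Finset.mem_Iic, ne_eq, Fin.ext_iff, Fin.le_def]
      omega
    rw [this, e]

theorem StrictDom.irrefl (α : Fin N → ℕ) : ¬ StrictDom α α := fun h => h.2 rfl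

theorem TriLt.trans {α β γ : Fin N → ℕ} (h1 : TriLt α β) (h2 : TriLt β γ) : TriLt α γ := by
  rcases h1 with h1 | ⟨e1, h1⟩ <;> rcases h2 with h2 | ⟨e2, h2⟩
  · exact Or.inl (h2.trans h1)
  · exact Or.inl (e2 ▸ h1)
  · exact Or.inl (e1 ▸ h2)
  · exact Or.inr ⟨e1.trans e2, h2.trans h1⟩

theorem TriLt.irrefl (α : Fin N → ℕ) : ¬ TriLt α α := by
  rintro (h | ⟨_, h⟩) <;> exact StrictDom.irrefl _ h

theorem sum_permComp (w : Equiv.Perm (Fin N)) (β : Fin N → ℕ) :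
    ∑ l, permComp w β l = ∑ l, β l := Equiv.sum_comp w⁻¹ β

theorem sum_update_update {β : Fin N → ℕ} {i j : Fin N} (hij : i ≠ j) {p q : ℕ}
    (h : p + q = β i + β j) :
    ∑ l, Function.update (Function.update β i p) j q l = ∑ l, β l := by
  have hi := Finset.mem_univ i
  have hj : j ∈ Finset.univ.erase i := by simp [hij.symm]
  rw [← Finset.add_sum_erase _ _ hi, ← Finset.add_sum_erase _ _ hj,
    ← Finset.add_sum_erase _ (fun l => β l) hi, ← Finset.add_sum_erase _ (fun l => β l) hj,
    Finset.sum_congr rfl (g := fun l => β l) fun l hl => by simp at hl; simp [hl.1, hl.2],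
    Function.update_self, Function.update_of_ne hij, Function.update_self]
  omega

/-- The span of the monomials below `x^β`. -/
def lowerSpan (β : Fin N → ℕ) : Submodule ℝ (MvPolynomial (Fin N) ℝ) :=
  Submodule.span ℝ (mon '' {γ | ∑ l, γ l = ∑ l, β l ∧ TriLt γ β})

theorem mon_update_mem_lowerSpan {β : Fin N → ℕ} {i j : Fin N} (hij : i ≠ j) {p q : ℕ}
    (h1 : min (β i) (β j) < p) (h2 : p < max (β i) (β j)) (h3 : p + q = β i + β j) :
    mon (Function.update (Function.update β i p) j q) ∈ lowerSpan β := by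
  refine Submodule.subset_span ⟨_, ⟨sum_update_update hij h3, Or.inl ?_⟩, rfl⟩
  rcases le_total (β i) (β j) with h | h
  · rw [min_eq_left h] at h1; rw [max_eq_right h] at h2
    exact strictDom_sortComp_update hij h1 h2 h3
  · rw [min_eq_right h] at h1; rw [max_eq_left h] at h2
    rw [Function.update_comm hij]
    exact strictDom_sortComp_update hij.symm (by omega) (by omega) (by omega)

theorem mon_swap_mem_lowerSpan {β : Fin N → ℕ} {i j : Fin N} (hij : i < j) (hβ : β j < β i) :
    mon (permComp (Equiv.swap i j) β) ∈ lowerSpan β := by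
  refine Submodule.subset_span ⟨_, ⟨sum_permComp _ _, Or.inr ⟨sortComp_permComp _ _, ?_⟩⟩, rfl⟩
  have := strictDom_swap (β := permComp (Equiv.swap i j) β) hij
    (by simpa [permComp_swap_apply] using hβ)
  rwa [← permComp_mul, Equiv.swap_mul_self, permComp_one] at this

theorem nabla_mon_mem {i j : Fin N} (h : i ≠ j) (β : Fin N → ℕ) :
    nabla i j (mon β) - (if β j ≤ β i then mon β else 0) -
      (if β j < β i then mon (permComp (Equiv.swap i j) β) else 0) ∈ lowerSpan β := by
  rcases lt_trichotomy (β i) (β j) with hlt | heq | hgt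
  · rw [if_neg (by omega), if_neg (by omega), nabla_mon_of_lt h hlt, sub_zero, sub_zero]
    refine Submodule.neg_mem _ (Submodule.sum_mem _ fun l hl => ?_)
    rw [Finset.mem_range] at hl
    exact mon_update_mem_lowerSpan h (by omega) (by omega) (by omega)
  · rw [if_pos (by omega), if_neg (by omega), nabla_mon_of_le h heq.ge, heq, Nat.sub_self, zero_add,
      Finset.sum_range_one, add_zero, Nat.sub_zero, ← heq, Function.update_eq_self, heq,
      Function.update_eq_self]
    simp
  · rw [if_pos hgt.le, if_pos hgt, nabla_mon_of_le h hgt.le, Finset.sum_range_succ,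
      show β i - β j = (β i - β j - 1) + 1 by omega, Finset.sum_range_succ', add_zero, Nat.sub_zero,
      ← permComp_swap, show β j + (β i - β j - 1 + 1) = β i by omega,
      show β i - (β i - β j - 1 + 1) = β j by omega, Function.update_eq_self,
      Function.update_eq_self, add_sub_assoc, sub_self, add_zero, add_sub_assoc, sub_self, add_zero]
    refine Submodule.sum_mem _ fun l hl => ?_
    rw [Finset.mem_range] at hl
    exact mon_update_mem_lowerSpan h (by omega) (by omega) (by omega)

theorem opU_apply (k : ℝ) (i : Fin N) (f : MvPolynomial (Fin N) ℝ) :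
    opU k i f = pderiv (R := ℝ) i (X i * f) + k • f +
      k • ∑ j ∈ Finset.univ.filter (fun j => j ≠ i),
        (nabla i j f - if j < i then swapOp i j f else 0) := by
  have e : ∑ j ∈ Finset.univ.filter (fun j => j ≠ i), (if j < i then swapOp i j f else 0) =
      ∑ j ∈ Finset.univ.filter (fun j => j < i), swapOp i j f := by
    rw [← Finset.sum_filter, Finset.filter_filter]
    refine Finset.sum_congr (Finset.filter_congr fun j _ => ?_) fun _ _ => rfl
    exact ⟨fun h => h.2, fun h => ⟨h.ne, h⟩⟩
  rw [Finset.sum_sub_distrib, e]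
  simp only [opU, dunklTrho, dunklT, LinearMap.sub_apply, LinearMap.add_apply, add_mul,
    LinearMap.smul_apply, LinearMap.sum_apply, Module.End.mul_apply, LinearMap.mulLeft_apply,
    Module.End.one_apply, Derivation.coeFn_coe, nabla, mulX_apply, smul_sub]
  abel

/-- κ as a diagonal coefficient: an index j ≠ i with β_j ≤ β_i contributes x^β once through `nabla`,
and the summand (i j) of U_i removes it again when j < i and β_j = β_i. -/
theorem kappa_eq_sum (k : ℝ) (β : Fin N → ℕ) (i : Fin N) :
    kappa k β i = β i + 1 + k + k * ∑ j ∈ Finset.univ.filter (fun j => j ≠ i),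
      ((if β j ≤ β i then (1 : ℝ) else 0) - if j < i ∧ β j = β i then 1 else 0) := by
  have e1 : ∑ j ∈ Finset.univ.filter (fun j => j ≠ i),
      ((if β j ≤ β i then (1 : ℝ) else 0) - if j < i ∧ β j = β i then 1 else 0) =
      ∑ j, (1 - (if β i < β j then (1 : ℝ) else 0) - if j < i ∧ β j = β i then 1 else 0) - 1 := by
    rw [← Finset.add_sum_erase _ _ (Finset.mem_univ i), Finset.filter_ne']
    simp only [lt_irrefl, false_and, if_false, sub_zero, add_sub_cancel_left]
    refine Finset.sum_congr rfl fun j _ => ?_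
    congr 1
    by_cases h : β i < β j
    · rw [if_neg (not_le.2 h), if_pos h]; ring
    · rw [if_pos (not_lt.1 h), if_neg h]; ring
  rw [e1, kappa, Finset.sum_sub_distrib, Finset.sum_sub_distrib, Finset.sum_boole, Finset.sum_boole]
  simp
  ring

/-- The interior monomials of `nabla` have a strictly smaller sorting. The monomial with exponents i
and j interchanged cancels between `nabla` and (i j) if β_j < β_i and j < i; in the other cases
where it survives it lies below x^β in the dominance order. -/
theorem opU_mon_sub_mem (k : ℝ) (i : Fin N) (β : Fin N → ℕ) :
    opU k i (mon β) - kappa k β i • mon β ∈ lowerSpan β := by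
  have e : opU k i (mon β) - kappa k β i • mon β =
      k • ∑ j ∈ Finset.univ.filter (fun j => j ≠ i),
        ((nabla i j (mon β) - if j < i then swapOp i j (mon β) else 0) -
          ((if β j ≤ β i then (1 : ℝ) else 0) - if j < i ∧ β j = β i then 1 else 0) • mon β) := by
    rw [opU_apply, kappa_eq_sum, pderiv_X_mul_mon, Finset.sum_sub_distrib (g := fun j =>
      ((if β j ≤ β i then (1 : ℝ) else 0) - if j < i ∧ β j = β i then 1 else 0) • mon β),
      ← Finset.sum_smul]
    module
  rw [e]
  refine Submodule.smul_mem _ _ (Submodule.sum_mem _ fun j hj => ?_)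
  have hj : j ≠ i := by simpa using hj
  have h := nabla_mon_mem hj.symm β
  have hs : swapOp i j (mon β) = mon (permComp (Equiv.swap i j) β) := permOp_mon _ _
  rw [hs]
  rcases lt_trichotomy (β i) (β j) with hlt | heq | hgt
  · rw [if_neg (by omega), if_neg (by omega), sub_zero, sub_zero] at h
    rw [if_neg (c := β j ≤ β i) (by omega), if_neg (c := _ ∧ _) (by omega), sub_zero, zero_smul,
      sub_zero]
    refine Submodule.sub_mem _ h ?_
    split_ifs with c
    · rw [Equiv.swap_comm]
      exact mon_swap_mem_lowerSpan c hlt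
    · exact Submodule.zero_mem _
  · rw [if_pos (by omega), if_neg (by omega), sub_zero] at h
    have hb : permComp (Equiv.swap i j) β = β := by
      rw [permComp_swap, ← heq, Function.update_eq_self, heq, Function.update_eq_self]
    rw [hb, if_pos (c := β j ≤ β i) (by omega)]
    convert h using 1
    by_cases c : j < i
    · rw [if_pos c, if_pos ⟨c, heq.symm⟩]; module
    · rw [if_neg c, if_neg (fun h => c h.1)]; module
  · rw [if_pos (by omega), if_pos (by omega)] at h
    rw [if_pos (c := β j ≤ β i) (by omega), if_neg (c := _ ∧ _) (by omega), sub_zero, one_smul]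
    by_cases c : j < i
    · rw [if_pos c]
      convert h using 1
      abel
    · rw [if_neg c]
      convert Submodule.add_mem _ h
        (mon_swap_mem_lowerSpan (lt_of_le_of_ne (not_lt.1 c) hj.symm) hgt) using 1
      abel

/-! ### The factors of the generating function as power series in x_i y_j. -/

/-- The power series `∑_n a_n x_i^n y_j^n`. -/
def diagSeries (a : ℕ → ℝ) (i j : Fin N) : MvPowerSeries (Fin N) (MvPolynomial (Fin N) ℝ) :=
  fun e => if e = Finsupp.single j (e j) then C (a (e j)) * X i ^ (e j) else 0

/-- The series `x_i y_j`. -/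
def xyMul (i j : Fin N) : MvPowerSeries (Fin N) (MvPolynomial (Fin N) ℝ) :=
  MvPowerSeries.C (X i) * MvPowerSeries.X j

theorem xyMul_eq (i j : Fin N) :
    xyMul i j = MvPowerSeries.monomial (Finsupp.single j 1) (X i : MvPolynomial (Fin N) ℝ) := by
  rw [xyMul, MvPowerSeries.X, ← MvPowerSeries.monomial_zero_eq_C_apply,
    MvPowerSeries.monomial_mul_monomial, zero_add, mul_one]

theorem coeff_diagSeries (a : ℕ → ℝ) (i j : Fin N) (e : Fin N →₀ ℕ) :
    MvPowerSeries.coeff e (diagSeries a i j) =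
      if e = Finsupp.single j (e j) then C (a (e j)) * X i ^ (e j) else 0 := rfl

theorem diagSeries_add (a b : ℕ → ℝ) (i j : Fin N) :
    diagSeries (a + b) i j = diagSeries a i j + diagSeries b i j := by
  ext1 e
  rw [map_add, coeff_diagSeries, coeff_diagSeries, coeff_diagSeries]
  split_ifs
  · rw [Pi.add_apply, map_add, add_mul]
  · rw [add_zero]

theorem diagSeries_smul (c : ℝ) (a : ℕ → ℝ) (i j : Fin N) :
    diagSeries (c • a) i j = c • diagSeries a i j := by
  ext1 e
  change _ = c • MvPowerSeries.coeff e (diagSeries a i j)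
  rw [coeff_diagSeries, coeff_diagSeries]
  split_ifs
  · rw [Pi.smul_apply, smul_eq_mul, map_mul, smul_eq_C_mul, mul_assoc]
  · rw [smul_zero]

theorem diagSeries_single (i j : Fin N) : diagSeries (Pi.single 0 1) i j = 1 := by
  ext1 e
  rw [coeff_diagSeries, MvPowerSeries.coeff_one]
  by_cases h : e = 0
  · subst h; simp
  · rw [if_neg h]
    split_ifs with h1
    · have : e j ≠ 0 := fun h2 => h (by rw [h1, h2, Finsupp.single_zero])
      simp [Pi.single_eq_of_ne this]
    · rfl

theorem xyMul_mul_diagSeries (a : ℕ → ℝ) (i j : Fin N) :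
    xyMul i j * diagSeries a i j = diagSeries (fun n => if n = 0 then 0 else a (n - 1)) i j := by
  ext1 e
  rw [xyMul_eq, MvPowerSeries.coeff_monomial_mul, coeff_diagSeries, coeff_diagSeries]
  by_cases h : e j = 0
  · rw [if_neg, h]
    · simp
    · rw [Finsupp.single_le_iff]; omega
  · rw [if_pos (by rw [Finsupp.single_le_iff]; omega)]
    have e1 : (e - Finsupp.single j 1 : Fin N →₀ ℕ) j = e j - 1 := by simp
    rw [e1, if_neg h]
    have e2 : e - Finsupp.single j 1 = Finsupp.single j (e j - 1) ↔ e = Finsupp.single j (e j) := by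
      constructor
      · intro h2
        have h3 : Finsupp.single j 1 ≤ e := by rw [Finsupp.single_le_iff]; omega
        rw [← tsub_add_cancel_of_le h3, h2, ← Finsupp.single_add]
        simp
      · intro h2
        conv_lhs => rw [h2]
        rw [← Finsupp.single_tsub]
    simp only [e2]
    split_ifs
    · rw [mul_left_comm, mul_pow_sub_one h]
    · rw [mul_zero]

/-- The coefficients `(c)_n / n!` of `(1 - t)^{-c}`. -/
def binomSeq (c : ℝ) (n : ℕ) : ℝ := (ascPochhammer ℝ n).eval c / (n.factorial : ℝ)

theorem binomFactor_eq (c : ℝ) (i j : Fin N) :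
    binomFactor c i j = diagSeries (binomSeq c) i j := rfl

theorem binomSeq_succ (c : ℝ) (n : ℕ) :
    ((n + 1 : ℕ) : ℝ) * binomSeq c (n + 1) = (c + n) * binomSeq c n := by
  have h1 : ((n + 1 : ℕ) : ℝ) ≠ 0 := by positivity
  have h2 : (n.factorial : ℝ) ≠ 0 := by positivity
  rw [binomSeq, binomSeq, ascPochhammer_succ_eval, Nat.factorial_succ, Nat.cast_mul]
  field_simp

theorem binomSeq_one (n : ℕ) : binomSeq 1 n = 1 := by
  have h2 : (n.factorial : ℝ) ≠ 0 := by positivity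
  rw [binomSeq, ascPochhammer_eval_one, div_self h2]

theorem one_sub_xyMul_mul_binomFactor (i j : Fin N) :
    (1 - xyMul i j) * binomFactor 1 i j = 1 := by
  rw [sub_mul, one_mul, sub_eq_iff_eq_add, binomFactor_eq, xyMul_mul_diagSeries,
    ← diagSeries_single i j, ← diagSeries_add]
  congr 1
  funext n
  rcases n with _ | n
  · simp [binomSeq_one]
  · simp [binomSeq_one]

/-- The series `∑_n n a_n x_i^n y_j^n` for `a_n = (c)_n / n!`. -/
theorem diagSeries_mul_binomSeq (c : ℝ) (i j : Fin N) :
    diagSeries (fun n => n * binomSeq c n) i j =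
      (c • (xyMul i j * binomFactor 1 i j)) * binomFactor c i j := by
  have h : (1 - xyMul i j) * diagSeries (fun n => n * binomSeq c n) i j =
      c • (xyMul i j * binomFactor c i j) := by
    rw [sub_mul, one_mul, sub_eq_iff_eq_add, binomFactor_eq, xyMul_mul_diagSeries,
      xyMul_mul_diagSeries, ← diagSeries_smul, ← diagSeries_add]
    congr 1
    funext n
    rcases n with _ | n
    · simp
    · have := binomSeq_succ c n
      simp only [Pi.add_apply, Pi.smul_apply, smul_eq_mul, if_neg (Nat.succ_ne_zero n),
        Nat.add_sub_cancel]
      rw [this]; ring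
  have h1 := one_sub_xyMul_mul_binomFactor i j
  calc _ = ((1 - xyMul i j) * binomFactor 1 i j) *
        diagSeries (fun n => n * binomSeq c n) i j := by rw [h1, one_mul]
    _ = binomFactor 1 i j * ((1 - xyMul i j) * diagSeries (fun n => n * binomSeq c n) i j) := by
        ring
    _ = _ := by
        rw [h, mul_smul_comm, smul_mul_assoc]
        congr 1
        ring

/-! ### Operators in x and in y on the generating function, and their agreement for U_i. -/

/-- An operator on polynomials in `x`, applied to the coefficients of a power series in `y`. -/
def actX (A : Module.End ℝ (MvPolynomial (Fin N) ℝ))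
    (F : MvPowerSeries (Fin N) (MvPolynomial (Fin N) ℝ)) :
    MvPowerSeries (Fin N) (MvPolynomial (Fin N) ℝ) := fun e => A (MvPowerSeries.coeff e F)

/-- A degree-preserving operator, applied in the variables `y` of a power series. -/
def actY (A : Module.End ℝ (MvPolynomial (Fin N) ℝ))
    (F : MvPowerSeries (Fin N) (MvPolynomial (Fin N) ℝ)) :
    MvPowerSeries (Fin N) (MvPolynomial (Fin N) ℝ) := fun e =>
  ∑ d ∈ Finset.finsuppAntidiag Finset.univ e.degree,
    coeff e (A (monomial d 1)) • MvPowerSeries.coeff d F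

theorem coeff_actX (A : Module.End ℝ (MvPolynomial (Fin N) ℝ))
    (F : MvPowerSeries (Fin N) (MvPolynomial (Fin N) ℝ)) (e : Fin N →₀ ℕ) :
    MvPowerSeries.coeff e (actX A F) = A (MvPowerSeries.coeff e F) := rfl

theorem coeff_actY (A : Module.End ℝ (MvPolynomial (Fin N) ℝ))
    (F : MvPowerSeries (Fin N) (MvPolynomial (Fin N) ℝ)) (e : Fin N →₀ ℕ) :
    MvPowerSeries.coeff e (actY A F) = ∑ d ∈ Finset.finsuppAntidiag Finset.univ e.degree,
      coeff e (A (monomial d 1)) • MvPowerSeries.coeff d F := rfl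

theorem mem_antidiag {d : Fin N →₀ ℕ} {n : ℕ} :
    d ∈ Finset.finsuppAntidiag Finset.univ n ↔ d.degree = n := by
  rw [Finset.mem_finsuppAntidiag, Finsupp.degree_eq_sum]
  simp

/-- Simultaneous renaming of the `x` in the coefficients. -/
theorem actX_permOp (w : Equiv.Perm (Fin N))
    (F : MvPowerSeries (Fin N) (MvPolynomial (Fin N) ℝ)) :
    actX (permOp w) F = MvPowerSeries.map (rename (R := ℝ) w).toRingHom F := by
  ext1 e
  rw [coeff_actX, MvPowerSeries.coeff_map]
  rfl

theorem coeff_rename_perm (w : Equiv.Perm (Fin N))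
    (F : MvPowerSeries (Fin N) (MvPolynomial (Fin N) ℝ)) (e : Fin N →₀ ℕ) :
    MvPowerSeries.coeff (Finsupp.mapDomain w e) (MvPowerSeries.rename w F) =
      MvPowerSeries.coeff e F := by
  have := MvPowerSeries.coeff_embDomain_rename w.toEmbedding F e
  rwa [Finsupp.embDomain_eq_mapDomain] at this

theorem degree_mapDomain_perm (w : Equiv.Perm (Fin N)) (e : Fin N →₀ ℕ) :
    (Finsupp.mapDomain w e).degree = e.degree := by
  rw [Finsupp.degree_eq_sum, Finsupp.degree_eq_sum, ← Equiv.sum_comp w]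
  simp [Finsupp.mapDomain_apply w.injective]

theorem permOp_monomial (w : Equiv.Perm (Fin N)) (d : Fin N →₀ ℕ) :
    permOp w (monomial d 1) = monomial (Finsupp.mapDomain w d) 1 := by
  rw [permOp, AlgHom.toLinearMap_apply, rename_monomial]

theorem sum_coeff_permOp_smul (w : Equiv.Perm (Fin N))
    (F : MvPowerSeries (Fin N) (MvPolynomial (Fin N) ℝ)) (e : Fin N →₀ ℕ) :
    ∑ d ∈ Finset.finsuppAntidiag Finset.univ e.degree,
      coeff e (permOp w (monomial d 1)) • MvPowerSeries.coeff d F =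
    MvPowerSeries.coeff e (MvPowerSeries.rename w F) := by
  obtain ⟨e', rfl⟩ : ∃ e', Finsupp.mapDomain w e' = e :=
    ⟨Finsupp.mapDomain w.symm e, by rw [← Finsupp.mapDomain_comp]; simp⟩
  rw [coeff_rename_perm, Finset.sum_eq_single e']
  · rw [permOp_monomial, coeff_monomial, if_pos rfl, one_smul]
  · intro d _ hd
    rw [permOp_monomial, coeff_monomial,
      if_neg fun h => hd (Finsupp.mapDomain_injective w.injective h), zero_smul]
  · intro h
    exact absurd (mem_antidiag.2 (degree_mapDomain_perm w e').symm) h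

theorem actY_permOp (w : Equiv.Perm (Fin N))
    (F : MvPowerSeries (Fin N) (MvPolynomial (Fin N) ℝ)) :
    actY (permOp w) F = MvPowerSeries.rename w F := by
  ext1 e
  rw [coeff_actY, sum_coeff_permOp_smul]

/-- Multiplication by y_i raises the degree by one, so the sum runs over degree `e.degree - 1`. The
truncated subtraction is harmless: for e = 0 both sides vanish, since x_i divides the polynomial
whose coefficient is taken. Operator identities after multiplication by x_i thereby pass to power
series. -/
theorem coeff_X_mul_actY (A : Module.End ℝ (MvPolynomial (Fin N) ℝ)) (i : Fin N)
    (F : MvPowerSeries (Fin N) (MvPolynomial (Fin N) ℝ)) (e : Fin N →₀ ℕ) :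
    MvPowerSeries.coeff e (MvPowerSeries.X i * actY A F) =
      ∑ d ∈ Finset.finsuppAntidiag Finset.univ (e.degree - 1),
        coeff e (X i * A (monomial d 1)) • MvPowerSeries.coeff d F := by
  rw [MvPowerSeries.X, MvPowerSeries.coeff_monomial_mul]
  split_ifs with h
  · have h1 : (e - Finsupp.single i 1).degree = e.degree - 1 := by
      conv_rhs => rw [← tsub_add_cancel_of_le h, map_add, Finsupp.degree_single]
      simp
    have h2 : i ∈ e.support := by
      rw [Finsupp.single_le_iff] at h
      rw [Finsupp.mem_support_iff]; omega
    rw [coeff_actY, one_mul, h1]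
    refine Finset.sum_congr rfl fun d _ => ?_
    rw [coeff_X_mul', if_pos h2]
  · have h2 : i ∉ e.support := by
      rw [Finsupp.single_le_iff] at h
      rw [Finsupp.notMem_support_iff]; omega
    refine (Finset.sum_eq_zero fun d _ => ?_).symm
    rw [coeff_X_mul', if_neg h2, zero_smul]

theorem actY_one (F : MvPowerSeries (Fin N) (MvPolynomial (Fin N) ℝ)) : actY 1 F = F := by
  rw [← permOp_one, actY_permOp]
  exact MvPowerSeries.rename_id_apply F

theorem X_sub_X_mul_actY_nabla (i j : Fin N)
    (F : MvPowerSeries (Fin N) (MvPolynomial (Fin N) ℝ)) :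
    (MvPowerSeries.X i - MvPowerSeries.X j) * actY (nabla i j) F =
      MvPowerSeries.X i * F - MvPowerSeries.X j * actY (swapOp i j) F := by
  suffices h : (MvPowerSeries.X i - MvPowerSeries.X j) * actY (nabla i j) F =
      MvPowerSeries.X i * actY 1 F - MvPowerSeries.X j * actY (swapOp i j) F by rwa [actY_one] at h
  ext1 e
  rw [sub_mul, map_sub, map_sub, coeff_X_mul_actY, coeff_X_mul_actY, coeff_X_mul_actY,
    coeff_X_mul_actY, ← Finset.sum_sub_distrib, ← Finset.sum_sub_distrib]
  refine Finset.sum_congr rfl fun d _ => ?_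
  rw [← sub_smul, ← sub_smul, ← coeff_sub, ← coeff_sub, ← sub_mul, nabla_spec,
    Module.End.one_apply]

theorem X_sub_X_mul_actX_nabla (i j : Fin N)
    (F : MvPowerSeries (Fin N) (MvPolynomial (Fin N) ℝ)) :
    (MvPowerSeries.C (X i) - MvPowerSeries.C (X j)) * actX (nabla i j) F =
      MvPowerSeries.C (X i) * F - MvPowerSeries.C (X j) * actX (swapOp i j) F := by
  ext1 e
  rw [← map_sub, MvPowerSeries.coeff_C_mul, map_sub, MvPowerSeries.coeff_C_mul,
    MvPowerSeries.coeff_C_mul, coeff_actX, coeff_actX, nabla_spec]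

theorem actX_permOp_diagSeries (w : Equiv.Perm (Fin N)) (a : ℕ → ℝ) (i j : Fin N) :
    actX (permOp w) (diagSeries a i j) = diagSeries a (w i) j := by
  ext1 e
  rw [coeff_actX, coeff_diagSeries, coeff_diagSeries]
  split_ifs
  · simp [permOp]
  · simp

theorem actY_permOp_diagSeries (w : Equiv.Perm (Fin N)) (a : ℕ → ℝ) (i j : Fin N) :
    actY (permOp w) (diagSeries a i j) = diagSeries a i (w j) := by
  ext1 e
  obtain ⟨e', rfl⟩ : ∃ e', Finsupp.mapDomain w e' = e :=
    ⟨Finsupp.mapDomain w.symm e, by rw [← Finsupp.mapDomain_comp]; simp⟩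
  rw [actY_permOp, coeff_rename_perm, coeff_diagSeries, coeff_diagSeries,
    Finsupp.mapDomain_apply w.injective, ← Finsupp.mapDomain_single (f := w)]
  simp only [(Finsupp.mapDomain_injective w.injective).eq_iff]

theorem actX_permOp_prod {ι : Type*} (w : Equiv.Perm (Fin N)) (s : Finset ι)
    (f : ι → MvPowerSeries (Fin N) (MvPolynomial (Fin N) ℝ)) :
    actX (permOp w) (∏ i ∈ s, f i) = ∏ i ∈ s, actX (permOp w) (f i) := by
  simp only [actX_permOp, map_prod]

theorem actY_permOp_prod {ι : Type*} (w : Equiv.Perm (Fin N)) (s : Finset ι)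
    (f : ι → MvPowerSeries (Fin N) (MvPolynomial (Fin N) ℝ)) :
    actY (permOp w) (∏ i ∈ s, f i) = ∏ i ∈ s, actY (permOp w) (f i) := by
  simp only [actY_permOp, map_prod]

theorem actX_permOp_genF (k : ℝ) (w : Equiv.Perm (Fin N)) :
    actX (permOp w) (genF N k) =
      (∏ i : Fin N, binomFactor 1 (w i) i) * ∏ i : Fin N, ∏ j : Fin N, binomFactor k i j := by
  rw [genF, Finset.prod_mul_distrib, actX_permOp, map_mul, ← actX_permOp, ← actX_permOp,
    actX_permOp_prod, actX_permOp_prod,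
    ← Equiv.prod_comp w (fun i => ∏ j : Fin N, binomFactor k i j)]
  simp only [actX_permOp_prod, binomFactor_eq, actX_permOp_diagSeries]

theorem actY_permOp_genF (k : ℝ) (w : Equiv.Perm (Fin N)) :
    actY (permOp w) (genF N k) =
      (∏ i : Fin N, binomFactor 1 i (w i)) * ∏ i : Fin N, ∏ j : Fin N, binomFactor k i j := by
  have e : ∀ i : Fin N, ∏ j : Fin N, binomFactor k i j = ∏ j : Fin N, binomFactor k i (w j) :=
    fun i => (Equiv.prod_comp w (fun j => binomFactor k i j)).symm
  simp only [e]
  rw [genF, Finset.prod_mul_distrib, actY_permOp, map_mul, ← actY_permOp, ← actY_permOp,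
    actY_permOp_prod, actY_permOp_prod]
  simp only [actY_permOp_prod, binomFactor_eq, actY_permOp_diagSeries]

/-- The double product ∏ (1 − x_i y_j)^{-k} is symmetric in x, so only the two diagonal factors with
indices i and j change. -/
theorem actX_swapOp_genF {k : ℝ} {i j : Fin N} (h : i ≠ j) :
    actX (swapOp i j) (genF N k) = genF N k * ((1 - xyMul i i) * (1 - xyMul j j) *
      (binomFactor 1 i j * binomFactor 1 j i)) := by
  have hi := Finset.mem_univ i
  have hj : j ∈ Finset.univ.erase i := by simp [h.symm]
  have e1 := one_sub_xyMul_mul_binomFactor i i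
  have e2 := one_sub_xyMul_mul_binomFactor j j
  rw [swapOp, actX_permOp_genF, genF, Finset.prod_mul_distrib, ← Finset.mul_prod_erase _ _ hi,
    ← Finset.mul_prod_erase _ _ hj, ← Finset.mul_prod_erase _ (fun i => binomFactor 1 i i) hi,
    ← Finset.mul_prod_erase _ (fun i => binomFactor 1 i i) hj, Equiv.swap_apply_left,
    Equiv.swap_apply_right, Finset.prod_congr rfl (g := fun l => binomFactor 1 l l) fun l hl => by
      simp at hl; rw [Equiv.swap_apply_of_ne_of_ne hl.2 hl.1]]
  generalize (∏ l ∈ (Finset.univ.erase i).erase j, binomFactor 1 l l) = R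
  generalize (∏ l : Fin N, ∏ j : Fin N, binomFactor k l j) = G
  linear_combination (-(binomFactor 1 i j * binomFactor 1 j i) * R * G) *
    ((1 - xyMul j j) * binomFactor 1 j j * e1 + e2)

/-- On the diagonal product, permuting y by w is permuting x by the inverse of w, and a
transposition is its own inverse. -/
theorem actY_swapOp_genF (k : ℝ) (i j : Fin N) :
    actY (swapOp i j) (genF N k) = actX (swapOp i j) (genF N k) := by
  rw [swapOp, actX_permOp_genF, actY_permOp_genF,
    ← Equiv.prod_comp (Equiv.swap i j) (fun l => binomFactor 1 l (Equiv.swap i j l))]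
  simp only [Equiv.swap_apply_self]

/-- This and `actY_nabla_genF` have the same first term; they differ only in x_i y_j/(1 − x_i y_j)
against x_j y_i/(1 − x_j y_i), a discrepancy that the Euler operators compensate in `actX_opU_genF`.
-/
theorem actX_nabla_genF {k : ℝ} {i j : Fin N} (h : i ≠ j) :
    actX (nabla i j) (genF N k) = genF N k * ((1 - xyMul j j) *
      (binomFactor 1 i j * binomFactor 1 j i)) - genF N k * (xyMul i j * binomFactor 1 i j) := by
  have h0 : (MvPowerSeries.C (X i) - MvPowerSeries.C (X j) :
      MvPowerSeries (Fin N) (MvPolynomial (Fin N) ℝ)) ≠ 0 := by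
    rw [← map_sub]
    exact fun h1 => X_sub_X_ne_zero h (MvPowerSeries.C_injective (h1.trans (map_zero _).symm))
  refine mul_left_cancel₀ h0 ?_
  rw [X_sub_X_mul_actX_nabla, actX_swapOp_genF h]
  have e1 := one_sub_xyMul_mul_binomFactor i j
  have e2 := one_sub_xyMul_mul_binomFactor j i
  simp only [xyMul] at *
  generalize genF N k = G at *
  generalize (binomFactor 1 i j : MvPowerSeries (Fin N) (MvPolynomial (Fin N) ℝ)) = A at *
  generalize (binomFactor 1 j i : MvPowerSeries (Fin N) (MvPolynomial (Fin N) ℝ)) = B at *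
  generalize (MvPowerSeries.C (X i) : MvPowerSeries (Fin N) (MvPolynomial (Fin N) ℝ)) = x at *
  generalize (MvPowerSeries.C (X j) : MvPowerSeries (Fin N) (MvPolynomial (Fin N) ℝ)) = x' at *
  generalize (MvPowerSeries.X i : MvPowerSeries (Fin N) (MvPolynomial (Fin N) ℝ)) = y at *
  generalize (MvPowerSeries.X j : MvPowerSeries (Fin N) (MvPolynomial (Fin N) ℝ)) = y' at *
  -- Inserting factors (1 − x_i y_j)/(1 − x_i y_j) and (1 − x_j y_i)/(1 − x_j y_i), both equal to 1,
  -- brings all terms to a common denominator and leaves a polynomial identity.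
  have hx : x * G = x * G * ((1 - x * y') * A) * ((1 - x' * y) * B) := by rw [e1, e2]; ring
  have hA : G * (x * y' * A) = G * (x * y' * A) * ((1 - x' * y) * B) := by rw [e2]; ring
  rw [hx, hA]
  ring

theorem actY_nabla_genF {k : ℝ} {i j : Fin N} (h : i ≠ j) :
    actY (nabla i j) (genF N k) = genF N k * ((1 - xyMul j j) *
      (binomFactor 1 i j * binomFactor 1 j i)) - genF N k * (xyMul j i * binomFactor 1 j i) := by
  have h0 : (MvPowerSeries.X i - MvPowerSeries.X j :
      MvPowerSeries (Fin N) (MvPolynomial (Fin N) ℝ)) ≠ 0 :=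
    sub_ne_zero.2 fun h1 => h (MvPowerSeries.X_inj.1 h1)
  refine mul_left_cancel₀ h0 ?_
  rw [X_sub_X_mul_actY_nabla, actY_swapOp_genF, actX_swapOp_genF h]
  have e1 := one_sub_xyMul_mul_binomFactor i j
  have e2 := one_sub_xyMul_mul_binomFactor j i
  simp only [xyMul] at *
  generalize genF N k = G at *
  generalize (binomFactor 1 i j : MvPowerSeries (Fin N) (MvPolynomial (Fin N) ℝ)) = A at *
  generalize (binomFactor 1 j i : MvPowerSeries (Fin N) (MvPolynomial (Fin N) ℝ)) = B at *
  generalize (MvPowerSeries.C (X i) : MvPowerSeries (Fin N) (MvPolynomial (Fin N) ℝ)) = x at *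
  generalize (MvPowerSeries.C (X j) : MvPowerSeries (Fin N) (MvPolynomial (Fin N) ℝ)) = x' at *
  generalize (MvPowerSeries.X i : MvPowerSeries (Fin N) (MvPolynomial (Fin N) ℝ)) = y at *
  generalize (MvPowerSeries.X j : MvPowerSeries (Fin N) (MvPolynomial (Fin N) ℝ)) = y' at *
  have hx : y * G = y * G * ((1 - x * y') * A) * ((1 - x' * y) * B) := by rw [e1, e2]; ring
  have hA : G * (x' * y * B) = G * (x' * y * B) * ((1 - x * y') * A) := by rw [e1]; ring
  rw [hx, hA]
  ring

theorem leibniz_prod {ι R : Type*} [CommRing R] {E : R → R} (h1 : E 1 = 0)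
    (hE : ∀ f g, E (f * g) = E f * g + f * E g) (s : Finset ι) {f g : ι → R}
    (h : ∀ i ∈ s, E (f i) = g i * f i) : E (∏ i ∈ s, f i) = (∑ i ∈ s, g i) * ∏ i ∈ s, f i := by
  classical
  induction s using Finset.induction_on with
  | empty => simp [h1]
  | insert a s ha ih =>
    rw [Finset.prod_insert ha, Finset.sum_insert ha, hE, h a (Finset.mem_insert_self _ _),
      ih fun i hi => h i (Finset.mem_insert_of_mem hi)]
    ring

/-- The operator `x_l ∂/∂x_l`. -/
def eulerX (l : Fin N) : Module.End ℝ (MvPolynomial (Fin N) ℝ) :=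
  mulX l * (pderiv (R := ℝ) l).toLinearMap

theorem actX_eulerX_mul (l : Fin N) (f g : MvPowerSeries (Fin N) (MvPolynomial (Fin N) ℝ)) :
    actX (eulerX l) (f * g) = actX (eulerX l) f * g + f * actX (eulerX l) g := by
  ext1 e
  rw [coeff_actX, map_add, MvPowerSeries.coeff_mul, MvPowerSeries.coeff_mul,
    MvPowerSeries.coeff_mul, ← Finset.sum_add_distrib, map_sum]
  refine Finset.sum_congr rfl fun d _ => ?_
  simp only [coeff_actX, eulerX, Module.End.mul_apply, Derivation.coeFn_coe, Derivation.leibniz,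
    mulX_apply, smul_eq_mul]
  ring

/-- The operator `y_l ∂/∂y_l`. -/
def eulerY (l : Fin N) (F : MvPowerSeries (Fin N) (MvPolynomial (Fin N) ℝ)) :
    MvPowerSeries (Fin N) (MvPolynomial (Fin N) ℝ) :=
  fun e => (e l : ℝ) • MvPowerSeries.coeff e F

theorem coeff_eulerY (l : Fin N) (F : MvPowerSeries (Fin N) (MvPolynomial (Fin N) ℝ))
    (e : Fin N →₀ ℕ) :
    MvPowerSeries.coeff e (eulerY l F) = (e l : ℝ) • MvPowerSeries.coeff e F := rfl

theorem eulerY_mul (l : Fin N) (f g : MvPowerSeries (Fin N) (MvPolynomial (Fin N) ℝ)) :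
    eulerY l (f * g) = eulerY l f * g + f * eulerY l g := by
  ext1 e
  rw [coeff_eulerY, map_add, MvPowerSeries.coeff_mul, MvPowerSeries.coeff_mul,
    MvPowerSeries.coeff_mul, ← Finset.sum_add_distrib, Finset.smul_sum]
  refine Finset.sum_congr rfl fun d hd => ?_
  have hd := Finset.HasAntidiagonal.mem_antidiagonal.1 hd
  rw [coeff_eulerY, coeff_eulerY, ← hd, Finsupp.add_apply, Nat.cast_add, add_smul, smul_mul_assoc,
    mul_smul_comm]

theorem eulerX_C_mul_X_pow (l i : Fin N) (a : ℝ) (n : ℕ) :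
    eulerX l (C a * X i ^ n) = if l = i then C (n * a) * X i ^ n else 0 := by
  simp only [eulerX, Module.End.mul_apply, Derivation.coeFn_coe, mulX_apply]
  rw [pderiv_C_mul, pderiv_pow]
  split_ifs with h
  · subst h
    rw [pderiv_X_self]
    rcases n with _ | n
    · simp
    · simp [pow_succ]; ring
  · rw [pderiv_X_of_ne (Ne.symm h)]; simp

theorem actX_eulerX_diagSeries (l : Fin N) (a : ℕ → ℝ) (i j : Fin N) :
    actX (eulerX l) (diagSeries a i j) =
      if l = i then diagSeries (fun n => n * a n) i j else 0 := by
  ext1 e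
  rw [coeff_actX, coeff_diagSeries]
  split_ifs with h1 h2
  · rw [eulerX_C_mul_X_pow, if_pos h2, coeff_diagSeries, if_pos h1]
  · rw [eulerX_C_mul_X_pow, if_neg h2, map_zero]
  · rw [map_zero, coeff_diagSeries, if_neg h1]
  · rw [map_zero, map_zero]

theorem eulerY_diagSeries (l : Fin N) (a : ℕ → ℝ) (i j : Fin N) :
    eulerY l (diagSeries a i j) = if l = j then diagSeries (fun n => n * a n) i j else 0 := by
  ext1 e
  rw [coeff_eulerY, coeff_diagSeries]
  split_ifs with h1 h2
  · rw [coeff_diagSeries, if_pos h1, h2, smul_eq_C_mul, ← mul_assoc, ← map_mul]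
  · rw [h1, Finsupp.single_eq_of_ne h2]; simp
  · rw [smul_zero, coeff_diagSeries, if_neg h1]
  · rw [smul_zero, map_zero]

/-- The series `x_i y_j / (1 - x_i y_j)`. -/
def geomTail (i j : Fin N) : MvPowerSeries (Fin N) (MvPolynomial (Fin N) ℝ) :=
  xyMul i j * binomFactor 1 i j

/-- Logarithmic differentiation of the product, carried out once for both variables: p selects the
factors on which E acts, namely i = l for x_l ∂/∂x_l and j = l for y_l ∂/∂y_l. -/
theorem euler_genF (k : ℝ) (p : Fin N → Fin N → Prop) [∀ i j, Decidable (p i j)]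
    {E : MvPowerSeries (Fin N) (MvPolynomial (Fin N) ℝ) →
      MvPowerSeries (Fin N) (MvPolynomial (Fin N) ℝ)} (h1 : E 1 = 0)
    (hE : ∀ f g, E (f * g) = E f * g + f * E g)
    (h : ∀ a i j, E (diagSeries a i j) = if p i j then diagSeries (fun n => n * a n) i j else 0) :
    E (genF N k) = (∑ i, ((if p i i then geomTail i i else 0) +
      ∑ j, if p i j then k • geomTail i j else 0)) * genF N k := by
  have hb : ∀ c i j, E (binomFactor c i j) =
      (if p i j then c • geomTail i j else 0) * binomFactor c i j := by
    intro c i j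
    rw [binomFactor_eq, h, ite_mul, zero_mul, diagSeries_mul_binomSeq]
    rfl
  rw [genF]
  refine leibniz_prod h1 hE _ fun i _ => ?_
  rw [hE, hb, leibniz_prod h1 hE _ fun j _ => hb k i j, one_smul]
  ring

theorem actX_eulerX_genF (k : ℝ) (l : Fin N) :
    actX (eulerX l) (genF N k) =
      (geomTail l l + ∑ j, k • geomTail l j) * genF N k := by
  rw [euler_genF k (fun i _ => l = i) (E := actX (eulerX l)) ?_ (actX_eulerX_mul l)
    (actX_eulerX_diagSeries l)]
  · congr 1
    rw [Finset.sum_eq_single l]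
    · simp
    · intro b _ hb; simp [hb.symm]
    · simp
  · have := actX_eulerX_mul l 1 1
    simpa using this

theorem eulerY_genF (k : ℝ) (l : Fin N) :
    eulerY l (genF N k) = (geomTail l l + ∑ i, k • geomTail i l) * genF N k := by
  rw [euler_genF k (fun _ j => l = j) (E := eulerY l) ?_ (eulerY_mul l) (eulerY_diagSeries l)]
  · congr 1
    simp [Finset.sum_add_distrib]
  · have := eulerY_mul l 1 1
    simpa using this

theorem actX_add (A B : Module.End ℝ (MvPolynomial (Fin N) ℝ))
    (F : MvPowerSeries (Fin N) (MvPolynomial (Fin N) ℝ)) :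
    actX (A + B) F = actX A F + actX B F := rfl

theorem actX_smul (c : ℝ) (A : Module.End ℝ (MvPolynomial (Fin N) ℝ))
    (F : MvPowerSeries (Fin N) (MvPolynomial (Fin N) ℝ)) : actX (c • A) F = c • actX A F := rfl

theorem actX_sub (A B : Module.End ℝ (MvPolynomial (Fin N) ℝ))
    (F : MvPowerSeries (Fin N) (MvPolynomial (Fin N) ℝ)) :
    actX (A - B) F = actX A F - actX B F := by
  ext1 e
  rw [map_sub, coeff_actX, coeff_actX, coeff_actX, LinearMap.sub_apply]

theorem actX_sum {ι : Type*} (s : Finset ι) (A : ι → Module.End ℝ (MvPolynomial (Fin N) ℝ))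
    (F : MvPowerSeries (Fin N) (MvPolynomial (Fin N) ℝ)) :
    actX (∑ i ∈ s, A i) F = ∑ i ∈ s, actX (A i) F := by
  ext1 e
  rw [map_sum, coeff_actX, LinearMap.sum_apply]
  rfl

theorem actX_one (F : MvPowerSeries (Fin N) (MvPolynomial (Fin N) ℝ)) : actX 1 F = F := rfl

theorem actY_add (A B : Module.End ℝ (MvPolynomial (Fin N) ℝ))
    (F : MvPowerSeries (Fin N) (MvPolynomial (Fin N) ℝ)) :
    actY (A + B) F = actY A F + actY B F := by
  ext1 e
  simp only [map_add, coeff_actY, LinearMap.add_apply, coeff_add, add_smul, Finset.sum_add_distrib]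

theorem actY_smul (c : ℝ) (A : Module.End ℝ (MvPolynomial (Fin N) ℝ))
    (F : MvPowerSeries (Fin N) (MvPolynomial (Fin N) ℝ)) : actY (c • A) F = c • actY A F := by
  ext1 e
  change _ = c • MvPowerSeries.coeff e (actY A F)
  simp only [coeff_actY, LinearMap.smul_apply, coeff_smul, smul_assoc, Finset.smul_sum]

theorem actY_sub (A B : Module.End ℝ (MvPolynomial (Fin N) ℝ))
    (F : MvPowerSeries (Fin N) (MvPolynomial (Fin N) ℝ)) :
    actY (A - B) F = actY A F - actY B F := by
  ext1 e
  simp only [map_sub, coeff_actY, LinearMap.sub_apply, coeff_sub, sub_smul, Finset.sum_sub_distrib]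

theorem actY_sum {ι : Type*} (s : Finset ι) (A : ι → Module.End ℝ (MvPolynomial (Fin N) ℝ))
    (F : MvPowerSeries (Fin N) (MvPolynomial (Fin N) ℝ)) :
    actY (∑ i ∈ s, A i) F = ∑ i ∈ s, actY (A i) F := by
  ext1 e
  simp only [map_sum, coeff_actY, LinearMap.sum_apply, coeff_sum, Finset.sum_smul]
  exact Finset.sum_comm

theorem opU_eq_nabla (k : ℝ) (i : Fin N) :
    opU k i = (pderiv (R := ℝ) i).toLinearMap * mulX i + k • 1 +
      k • ∑ j ∈ Finset.univ.filter (fun j => j ≠ i),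
        (nabla i j - if j < i then swapOp i j else 0) := by
  refine LinearMap.ext fun f => ?_
  rw [opU_apply]
  simp only [LinearMap.add_apply, LinearMap.smul_apply, LinearMap.sum_apply, LinearMap.sub_apply,
    Module.End.mul_apply, Module.End.one_apply, Derivation.coeFn_coe, mulX_apply]
  congr 2
  refine Finset.sum_congr rfl fun j _ => ?_
  split_ifs <;> rfl

theorem actX_pderiv_mul_mulX (i : Fin N) (F : MvPowerSeries (Fin N) (MvPolynomial (Fin N) ℝ)) :
    actX ((pderiv (R := ℝ) i).toLinearMap * mulX i) F = F + actX (eulerX i) F := by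
  change _ = actX 1 F + _
  rw [← actX_add]
  congr 1
  refine LinearMap.ext fun f => ?_
  simp [eulerX, mulX_apply, Derivation.leibniz]
  ring

theorem actY_pderiv_mul_mulX (i : Fin N) (F : MvPowerSeries (Fin N) (MvPolynomial (Fin N) ℝ)) :
    actY ((pderiv (R := ℝ) i).toLinearMap * mulX i) F = F + eulerY i F := by
  ext1 e
  have h : ∀ d : Fin N →₀ ℕ, ((pderiv (R := ℝ) i).toLinearMap * mulX i) (monomial d 1) =
      ((d i : ℝ) + 1) • monomial d 1 := fun d => by
    have := pderiv_X_mul_mon i d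
    simpa [mon, mulX_apply] using this
  rw [coeff_actY, map_add, coeff_eulerY, Finset.sum_eq_single e]
  · rw [h, coeff_smul, coeff_monomial, if_pos rfl, smul_eq_mul, mul_one, add_smul, one_smul,
      add_comm]
  · intro d _ hd
    rw [h, coeff_smul, coeff_monomial, if_neg hd, smul_zero, zero_smul]
  · intro he
    exact absurd (mem_antidiag.2 rfl) he

/-- The transposition terms of U_i agree in x and y. The Euler parts differ by k Σ_{j≠i} of x_i
y_j/(1 − x_i y_j) − x_j y_i/(1 − x_j y_i), which is exactly what the divided differences take away
again. -/
theorem actX_opU_genF (k : ℝ) (i : Fin N) :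
    actX (opU k i) (genF N k) = actY (opU k i) (genF N k) := by
  have hs : ∀ j, actX (if j < i then swapOp i j else 0) (genF N k) =
      actY (if j < i then swapOp i j else 0) (genF N k) := by
    intro j
    split_ifs
    · exact (actY_swapOp_genF k i j).symm
    · ext1 e; simp [coeff_actX, coeff_actY]
  have h1 : ∑ j, k • geomTail i j =
      k • geomTail i i + k • ∑ j ∈ Finset.univ.filter (fun j => j ≠ i), geomTail i j := by
    rw [Finset.filter_ne', ← Finset.smul_sum, ← Finset.add_sum_erase _ _ (Finset.mem_univ i),
      smul_add]
  have h2 : ∑ j, k • geomTail j i =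
      k • geomTail i i + k • ∑ j ∈ Finset.univ.filter (fun j => j ≠ i), geomTail j i := by
    rw [Finset.filter_ne', ← Finset.smul_sum,
      ← Finset.add_sum_erase _ (fun j => geomTail j i) (Finset.mem_univ i), smul_add]
  rw [opU_eq_nabla, actX_add, actX_add, actX_smul, actX_smul, actX_sum, actX_pderiv_mul_mulX,
    actX_eulerX_genF, actY_add, actY_add, actY_smul, actY_smul, actY_sum, actY_pderiv_mul_mulX,
    eulerY_genF, actX_one, actY_one, h1, h2]
  have e1 : ∀ j ∈ Finset.univ.filter (fun j => j ≠ i),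
      actX (nabla i j - if j < i then swapOp i j else 0) (genF N k) =
      (genF N k * ((1 - xyMul j j) * (binomFactor 1 i j * binomFactor 1 j i)) -
        actY (if j < i then swapOp i j else 0) (genF N k)) - geomTail i j * genF N k := by
    intro j hj
    rw [actX_sub, hs, actX_nabla_genF (by simp at hj; tauto), geomTail]
    ring
  have e2 : ∀ j ∈ Finset.univ.filter (fun j => j ≠ i),
      actY (nabla i j - if j < i then swapOp i j else 0) (genF N k) =
      (genF N k * ((1 - xyMul j j) * (binomFactor 1 i j * binomFactor 1 j i)) -
        actY (if j < i then swapOp i j else 0) (genF N k)) - geomTail j i * genF N k := by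
    intro j hj
    rw [actY_sub, actY_nabla_genF (by simp at hj; tauto), geomTail]
    ring
  rw [Finset.sum_congr rfl e1, Finset.sum_congr rfl e2, Finset.sum_sub_distrib,
    Finset.sum_sub_distrib (g := fun j => geomTail j i * genF N k), ← Finset.sum_mul,
    ← Finset.sum_mul, smul_sub, smul_sub, add_mul, add_mul, add_mul, add_mul, smul_mul_assoc,
    smul_mul_assoc, smul_mul_assoc]
  abel

/-! ### Triangularity of the U_i on the p_α. -/

theorem coefAt_eq_zero_of_mem_lowerSpan {α β : Fin N → ℕ} {f : MvPolynomial (Fin N) ℝ}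
    (hf : f ∈ lowerSpan β) (h : ¬ (∑ l, α l = ∑ l, β l ∧ TriLt α β)) : coefAt α f = 0 := by
  induction hf using Submodule.span_induction with
  | mem x hx =>
    obtain ⟨γ, hγ, rfl⟩ := hx
    rw [coefAt_mon, if_neg]
    rintro rfl
    exact h hγ
  | zero => exact map_zero _
  | add x y _ _ hx hy => rw [map_add, hx, hy, add_zero]
  | smul c x _ hx => rw [map_smul, hx, smul_zero]

/-- Comparing coefficients of y^α in the symmetry of the generating function: the matrix of U_i on
the p_α is the transpose of its matrix on monomials, so triangularity is inherited with the order
reversed. -/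
theorem opU_pPoly (k : ℝ) (i : Fin N) (α : Fin N → ℕ) :
    opU k i (pPoly k α) = ∑ d ∈ Finset.finsuppAntidiag Finset.univ (∑ l, α l),
      coefAt α (opU k i (mon d)) • pPoly k d := by
  have h := congrArg (MvPowerSeries.coeff (Finsupp.equivFunOnFinite.symm α)) (actX_opU_genF k i)
  rw [coeff_actX, coeff_actY, Finsupp.degree_eq_sum] at h
  simp only [pPoly, mon, Finsupp.equivFunOnFinite_symm_coe]
  exact h

/-- The `U_i` are triangular on the `p_α`. -/
theorem opU_pPoly_sub_mem (k : ℝ) (i : Fin N) (α : Fin N → ℕ) :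
    opU k i (pPoly k α) - kappa k α i • pPoly k α ∈
      Submodule.span ℝ (pPoly k '' {β | ∑ l, β l = ∑ l, α l ∧ TriLt α β}) := by
  have hα : Finsupp.equivFunOnFinite.symm α ∈
      Finset.finsuppAntidiag Finset.univ (∑ l, α l) := by
    rw [mem_antidiag, Finsupp.degree_eq_sum]; rfl
  have hd : ∀ d : Fin N → ℕ, coefAt α (opU k i (mon d)) =
      kappa k d i * (if d = α then 1 else 0) +
        coefAt α (opU k i (mon d) - kappa k d i • mon d) := fun d => by
    rw [map_sub, map_smul, coefAt_mon, smul_eq_mul]; ring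
  rw [opU_pPoly, ← Finset.add_sum_erase _ _ hα, Finsupp.coe_equivFunOnFinite_symm, hd, if_pos rfl,
    coefAt_eq_zero_of_mem_lowerSpan (opU_mon_sub_mem k i α) fun h => TriLt.irrefl _ h.2,
    mul_one, add_zero, add_sub_cancel_left]
  refine Submodule.sum_mem _ fun d hd' => ?_
  rw [Finset.mem_erase, mem_antidiag, Finsupp.degree_eq_sum] at hd'
  have hne : (d : Fin N → ℕ) ≠ α := fun h => hd'.1 (by rw [← h]; simp)
  by_cases h : ∑ l, α l = ∑ l, d l ∧ TriLt α d
  · exact Submodule.smul_mem _ _ (Submodule.subset_span ⟨d, ⟨hd'.2, h.2⟩, rfl⟩)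
  · rw [hd, if_neg hne, coefAt_eq_zero_of_mem_lowerSpan (opU_mon_sub_mem k i d) h, mul_zero,
      add_zero, zero_smul]
    exact Submodule.zero_mem _

theorem perm_inv_apply_self (w : Equiv.Perm (Fin N)) (i : Fin N) : w⁻¹ (w i) = i :=
  w.symm_apply_apply i

theorem perm_apply_inv_self (w : Equiv.Perm (Fin N)) (i : Fin N) : w (w⁻¹ i) = i :=
  w.apply_symm_apply i

/-! ### Joint eigenvectors of commuting triangular operators. -/

section Triangular

variable {M I ι : Type*} [AddCommGroup M] [Module ℝ M]

/-- For commuting operators `U_i` which are triangular on a finite family `v_β`, `β ∈ Q`, and a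
system of scalars `c` different from all the diagonal entries, there is an operator which commutes
with the `U_i`, kills the span of the family, and fixes the joint eigenvectors with
eigenvalues `c`, also modulo invariant subspaces. -/
theorem exists_annihilator {U : I → Module.End ℝ M} (hU : ∀ i j, Commute (U i) (U j))
    {v : ι → M} {κ : ι → I → ℝ} {r : ι → ι → Prop} [IsStrictOrder ι r] {c : I → ℝ}
    (Q : Finset ι) (hQ : ∀ β ∈ Q, ∀ i, U i (v β) - κ β i • v β ∈
      Submodule.span ℝ (v '' {γ | γ ∈ Q ∧ r β γ})) (hc : ∀ β ∈ Q, κ β ≠ c) :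
    ∃ P : Module.End ℝ M, (∀ i, Commute P (U i)) ∧
      (∀ x ∈ Submodule.span ℝ (v '' (Q : Set ι)), P x = 0) ∧
      ∀ W : Submodule ℝ M, (∀ i, ∀ x ∈ W, U i x ∈ W) → ∀ x, (∀ i, U i x - c i • x ∈ W) →
        P x - x ∈ W := by
  classical
  induction Q using Finset.strongInduction with
  | H Q ih =>
  rcases Q.eq_empty_or_nonempty with rfl | hne
  · refine ⟨1, fun i => Commute.one_left _, fun x hx => ?_, fun W _ x _ => ?_⟩
    · simpa using hx
    · simp
  obtain ⟨β, hβ, hmin⟩ := (Q.finite_toSet.wellFoundedOn (r := r)).has_min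
    Set.univ ⟨⟨hne.choose, hne.choose_spec⟩, trivial⟩
  obtain ⟨β, hβQ⟩ := β
  replace hmin : ∀ γ ∈ Q, ¬ r γ β := fun γ hγ => hmin ⟨γ, hγ⟩ trivial
  obtain ⟨P, hP1, hP2, hP3⟩ := ih (Q.erase β) (Finset.erase_ssubset hβQ)
    (fun γ hγ i => by
      refine Submodule.span_mono (Set.image_mono ?_) (hQ γ (Finset.mem_of_mem_erase hγ) i)
      rintro δ ⟨h1, h2⟩
      refine ⟨Finset.mem_erase.2 ⟨?_, h1⟩, h2⟩
      rintro rfl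
      exact hmin γ (Finset.mem_of_mem_erase hγ) h2)
    (fun γ hγ => hc γ (Finset.mem_of_mem_erase hγ))
  obtain ⟨i, hi⟩ := Function.ne_iff.1 (hc β hβQ)
  have hd : c i - κ β i ≠ 0 := sub_ne_zero.2 hi.symm
  -- B sends v_β into the span of the remaining family and is the identity on vectors with `U
  -- i`-eigenvalue `c i`.
  set B : Module.End ℝ M := (c i - κ β i)⁻¹ • (U i - κ β i • 1) with hB
  have hBU : ∀ j, Commute B (U j) := fun j =>
    ((hU i j).sub_left ((Commute.one_left _).smul_left _)).smul_left _
  refine ⟨P * B, fun j => (hP1 j).mul_left (hBU j), fun x hx => ?_, fun W hW x hx => ?_⟩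
  · induction hx using Submodule.span_induction with
    | mem x hx =>
      obtain ⟨γ, hγ, rfl⟩ := hx
      by_cases h : γ = β
      · subst h
        rw [Module.End.mul_apply]
        refine hP2 _ ?_
        have := hQ γ hγ i
        rw [hB, LinearMap.smul_apply, LinearMap.sub_apply, LinearMap.smul_apply,
          Module.End.one_apply]
        refine Submodule.smul_mem _ _ (Submodule.span_mono (Set.image_mono ?_) this)
        rintro δ ⟨h1, h2⟩
        refine Finset.mem_coe.2 (Finset.mem_erase.2 ⟨?_, h1⟩)
        rintro rfl
        exact irrefl_of r δ h2
      · have hPB : P * B = B * P :=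
          ((hP1 i).sub_right ((Commute.one_right P).smul_right _)).smul_right _
        rw [hPB, Module.End.mul_apply, hP2, map_zero]
        exact Submodule.subset_span ⟨γ, Finset.mem_coe.2 (Finset.mem_erase.2 ⟨h, hγ⟩), rfl⟩
    | zero => exact map_zero _
    | add x y _ _ hx hy => rw [map_add, hx, hy, add_zero]
    | smul a x _ hx => rw [map_smul, hx, smul_zero]
  · have h1 : B x - x ∈ W := by
      have e : B x - x = (c i - κ β i)⁻¹ • (U i x - c i • x) := by
        have : x = (c i - κ β i)⁻¹ • ((c i - κ β i) • x) := by rw [smul_smul, inv_mul_cancel₀ hd,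
          one_smul]
        rw [hB, LinearMap.smul_apply, LinearMap.sub_apply, LinearMap.smul_apply,
          Module.End.one_apply]
        nth_rewrite 3 [this]
        module
      rw [e]
      exact Submodule.smul_mem _ _ (hx i)
    have hBW : ∀ y ∈ W, B y ∈ W := fun y hy =>
      Submodule.smul_mem _ _ (Submodule.sub_mem _ (hW i y hy) (Submodule.smul_mem _ _ hy))
    have h2 : P (B x) - B x ∈ W := by
      refine hP3 W hW _ fun j => ?_
      have e : U j (B x) - c j • B x = B (U j x - c j • x) := by
        rw [map_sub, map_smul]
        congr 1
        exact (LinearMap.congr_fun (hBU j) x).symm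
      rw [e]
      exact hBW _ (hx j)
    rw [Module.End.mul_apply, ← sub_add_sub_cancel _ (B x)]
    exact Submodule.add_mem _ h2 h1

theorem invariant_span_of_triangular {U : I → Module.End ℝ M} {v : ι → M} {κ : ι → I → ℝ}
    {r : ι → ι → Prop} {Q : Set ι} (hQ : ∀ β ∈ Q, ∀ i, U i (v β) - κ β i • v β ∈
      Submodule.span ℝ (v '' {γ | γ ∈ Q ∧ r β γ})) (i : I) {x : M}
    (hx : x ∈ Submodule.span ℝ (v '' Q)) : U i x ∈ Submodule.span ℝ (v '' Q) := by
  induction hx using Submodule.span_induction with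
  | mem x hx =>
    obtain ⟨β, hβ, rfl⟩ := hx
    rw [← sub_add_cancel (U i (v β)) (κ β i • v β)]
    refine Submodule.add_mem _ (Submodule.span_mono (Set.image_mono fun γ hγ => hγ.1) (hQ β hβ i))
      (Submodule.smul_mem _ _ (Submodule.subset_span ⟨β, hβ, rfl⟩))
  | zero => rw [map_zero]; exact Submodule.zero_mem _
  | add x y _ _ hx hy => rw [map_add]; exact Submodule.add_mem _ hx hy
  | smul a x _ hx => rw [map_smul]; exact Submodule.smul_mem _ _ hx

/-- The eigenvector is P v_γ for the annihilator P of the family: P kills U_i v_γ − κ_i v_γ and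
commutes with U_i, and it fixes v_γ modulo the invariant span. -/
theorem exists_eigenvector_of_triangular {U : I → Module.End ℝ M}
    (hU : ∀ i j, Commute (U i) (U j)) {v : ι → M} {κ : ι → I → ℝ} {r : ι → ι → Prop}
    [IsStrictOrder ι r] {Q : Set ι} (hf : Q.Finite)
    (hQ : ∀ β ∈ Q, ∀ i, U i (v β) - κ β i • v β ∈ Submodule.span ℝ (v '' {γ | γ ∈ Q ∧ r β γ}))
    {γ : ι} (hγ : ∀ i, U i (v γ) - κ γ i • v γ ∈ Submodule.span ℝ (v '' Q))
    (hc : ∀ β ∈ Q, κ β ≠ κ γ) :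
    ∃ f, (∀ i, U i f = κ γ i • f) ∧ f - v γ ∈ Submodule.span ℝ (v '' Q) := by
  obtain ⟨P, h1, h2, h3⟩ := exists_annihilator hU (v := v) (κ := κ) (r := r) hf.toFinset
    (by simpa using hQ) (by simpa using hc)
  rw [Set.Finite.coe_toFinset] at h2
  refine ⟨P (v γ), fun i => ?_, h3 _ (fun i x hx => invariant_span_of_triangular hQ i hx) _ hγ⟩
  have := h2 _ (hγ i)
  rw [map_sub, map_smul, sub_eq_zero] at this
  rw [← this]
  exact (LinearMap.congr_fun (h1 i) (v γ)).symm

/-- The annihilator of the family both kills f and fixes it. -/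
theorem eq_zero_of_eigenvector_mem_span {U : I → Module.End ℝ M}
    (hU : ∀ i j, Commute (U i) (U j)) {v : ι → M} {κ : ι → I → ℝ} {r : ι → ι → Prop}
    [IsStrictOrder ι r] {Q : Set ι} (hf : Q.Finite)
    (hQ : ∀ β ∈ Q, ∀ i, U i (v β) - κ β i • v β ∈ Submodule.span ℝ (v '' {γ | γ ∈ Q ∧ r β γ}))
    {c : I → ℝ} (hc : ∀ β ∈ Q, κ β ≠ c) {f : M} (hfc : ∀ i, U i f = c i • f)
    (hfQ : f ∈ Submodule.span ℝ (v '' Q)) : f = 0 := by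
  obtain ⟨P, h1, h2, h3⟩ := exists_annihilator hU (v := v) (κ := κ) (r := r) hf.toFinset
    (by simpa using hQ) (by simpa using hc)
  rw [Set.Finite.coe_toFinset] at h2
  have := h3 ⊥ (fun i x hx => by rw [(Submodule.mem_bot ℝ).1 hx, map_zero]; exact zero_mem _) f
    fun i => by rw [hfc, sub_self]; exact zero_mem _
  rw [h2 f hfQ, Submodule.mem_bot, zero_sub, neg_eq_zero] at this
  exact this

end Triangular

/-! ### The eigenvalues κ: spacing, injectivity and behaviour under permutations. -/

/-- The indices that precede `i` when `α` is sorted. -/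
def before (α : Fin N → ℕ) (i : Fin N) : Finset (Fin N) :=
  Finset.univ.filter fun s => α i < α s ∨ (s < i ∧ α s = α i)

theorem mem_before {α : Fin N → ℕ} {i s : Fin N} :
    s ∈ before α i ↔ α i < α s ∨ (s < i ∧ α s = α i) := by simp [before]

theorem kappa_eq (k : ℝ) (α : Fin N → ℕ) (i : Fin N) :
    kappa k α i = N * k - k * (before α i).card + α i + 1 := by
  rw [kappa, before, Finset.filter_or, Finset.card_union_of_disjoint, Nat.cast_add]
  rw [Finset.disjoint_filter]
  rintro s _ h1 ⟨_, h2⟩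
  omega

theorem before_ssubset {α : Fin N → ℕ} {i s : Fin N} (h : s ∈ before α i) :
    before α s ⊂ before α i := by
  rw [Finset.ssubset_iff_of_subset]
  · exact ⟨s, h, fun h1 => by rw [mem_before] at h1; simp at h1⟩
  · intro a ha
    rw [mem_before] at *
    simp only [Fin.lt_def] at *
    omega

theorem mem_before_or {α : Fin N → ℕ} {i s : Fin N} (h : s ≠ i) :
    s ∈ before α i ∨ i ∈ before α s := by
  rw [mem_before, mem_before]
  rw [ne_eq, Fin.ext_iff] at h
  simp only [Fin.lt_def]
  omega

theorem kappa_sub_of_mem_before {k : ℝ} (hk : 0 ≤ k) {α : Fin N → ℕ} {i s : Fin N}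
    (h : s ∈ before α i) : k + α s - α i ≤ kappa k α s - kappa k α i := by
  have h1 : ((before α s).card : ℝ) + 1 ≤ (before α i).card := by
    exact_mod_cast Finset.card_lt_card (before_ssubset h)
  rw [kappa_eq, kappa_eq]
  nlinarith

theorem kappa_sub_ge {k : ℝ} (hk : 0 ≤ k) {α : Fin N → ℕ} {i s : Fin N} (h : α i < α s) :
    k + 1 ≤ kappa k α s - kappa k α i := by
  have h1 := kappa_sub_of_mem_before hk (mem_before.2 (Or.inl h))
  have h2 : (α i : ℝ) + 1 ≤ α s := by exact_mod_cast h
  linarith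

theorem kappa_lt_iff {k : ℝ} (hk : 0 < k) {α : Fin N → ℕ} {i s : Fin N} :
    kappa k α i < kappa k α s ↔ s ∈ before α i := by
  have key : ∀ {i s : Fin N}, s ∈ before α i → kappa k α i < kappa k α s := by
    intro i s h
    have h1 := kappa_sub_of_mem_before hk.le h
    have h2 : (α i : ℝ) ≤ α s := by
      rw [mem_before] at h
      exact_mod_cast (by omega : α i ≤ α s)
    linarith
  refine ⟨fun h => ?_, key⟩
  have hne : s ≠ i := by rintro rfl; exact lt_irrefl _ h
  rcases mem_before_or (α := α) hne with h1 | h1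
  · exact h1
  · exact absurd (key h1) (not_lt.2 h.le)

/-- For k > 0 the indices preceding i are those with a larger κ-value; for k = 0 their number is
multiplied by 0. So κ determines α. The formula uses the values of κ and not their positions, hence
also applies after a permutation. -/
theorem eq_of_kappa {k : ℝ} (hk : 0 ≤ k) (α : Fin N → ℕ) (i : Fin N) :
    (α i : ℝ) = kappa k α i - 1 - N * k +
      k * (Finset.univ.filter fun s => kappa k α i < kappa k α s).card := by
  rcases hk.eq_or_lt with rfl | hk
  · rw [kappa_eq]; ring
  · have : (Finset.univ.filter fun s => kappa k α i < kappa k α s) = before α i := by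
      ext s
      simp [kappa_lt_iff hk]
    rw [this, kappa_eq]; ring

theorem eq_of_kappa_eq {k : ℝ} (hk : 0 ≤ k) {α β : Fin N → ℕ} (w : Equiv.Perm (Fin N))
    (h : ∀ i, kappa k α (w i) = kappa k β i) (i : Fin N) : α (w i) = β i := by
  have e : (Finset.univ.filter fun s => kappa k α (w i) < kappa k α s).card =
      (Finset.univ.filter fun s => kappa k β i < kappa k β s).card := by
    refine (Finset.card_bij (fun s _ => w s) (fun s hs => ?_) (fun _ _ _ _ h => w.injective h)
      fun s hs => ⟨w⁻¹ s, ?_, by simp⟩).symm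
    · simpa [h] using hs
    · simp only [Finset.mem_filter, Finset.mem_univ, true_and] at hs ⊢
      rw [← h, ← h]
      simpa using hs
  have h1 := eq_of_kappa hk α (w i)
  rw [e, h, ← eq_of_kappa hk β i] at h1
  exact_mod_cast h1

theorem kappa_injective {k : ℝ} (hk : 0 ≤ k) :
    Function.Injective (kappa k : (Fin N → ℕ) → Fin N → ℝ) := fun _ _ h =>
  funext fun i => eq_of_kappa_eq hk 1 (fun i => congrFun h i) i

/-- A permutation that keeps the order of equal entries carries the set of predecessors of a onto
that of w(a). -/
theorem kappa_permComp (k : ℝ) {α : Fin N → ℕ} {w : Equiv.Perm (Fin N)}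
    (h : ∀ a b, α a = α b → a < b → w a < w b) (a : Fin N) :
    kappa k (permComp w α) (w a) = kappa k α a := by
  have hiff : ∀ s a, α s = α a → (w s < w a ↔ s < a) := by
    intro s a hs
    refine ⟨fun h1 => ?_, h s a hs⟩
    by_contra h2
    rcases (not_lt.1 h2).eq_or_lt with rfl | h3
    · exact lt_irrefl _ h1
    · exact lt_asymm h1 (h a s hs.symm h3)
  have e : (before (permComp w α) (w a)).card = (before α a).card := by
    refine (Finset.card_bij (fun s _ => w s) (fun s hs => ?_) (fun _ _ _ _ h => w.injective h)
      fun s hs => ⟨w⁻¹ s, ?_, by simp⟩).symm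
    · rw [mem_before] at hs ⊢
      simp only [permComp, perm_inv_apply_self]
      exact hs.imp id fun h1 => ⟨(hiff s a h1.2).2 h1.1, h1.2⟩
    · obtain ⟨s, rfl⟩ := w.surjective s
      rw [mem_before] at hs
      simp only [permComp, perm_inv_apply_self] at hs ⊢
      rw [mem_before]
      exact hs.imp id fun h1 => ⟨(hiff s a h1.2).1 h1.1, h1.2⟩
  rw [kappa_eq, kappa_eq, e]
  simp [permComp]

theorem swap_lt_swap_of_adjacent {i j : Fin N} (hij : (j : ℕ) = i + 1) {a b : Fin N} (hab : a < b)
    (h : ¬ (a = i ∧ b = j)) : Equiv.swap i j a < Equiv.swap i j b := by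
  rw [Equiv.swap_apply_def, Equiv.swap_apply_def]
  simp only [Fin.ext_iff, Fin.lt_def] at *
  split_ifs <;> omega

theorem kappa_swap (k : ℝ) {α : Fin N → ℕ} {i j : Fin N} (hij : (j : ℕ) = i + 1)
    (h : α i ≠ α j) (l : Fin N) :
    kappa k (permComp (Equiv.swap i j) α) l = kappa k α (Equiv.swap i j l) := by
  have := kappa_permComp k (α := α) (w := Equiv.swap i j) (fun a b hab h1 =>
    swap_lt_swap_of_adjacent hij h1 fun h2 => h (by rw [← h2.1, ← h2.2, hab])) (Equiv.swap i j l)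
  rwa [Equiv.swap_apply_self] at this

theorem kappa_sub_of_eq (k : ℝ) {α : Fin N → ℕ} {i j : Fin N} (hij : (j : ℕ) = i + 1)
    (h : α i = α j) : kappa k α i = kappa k α j + k := by
  have e : before α j = insert i (before α i) := by
    ext s
    rw [Finset.mem_insert, mem_before, mem_before]
    simp only [Fin.ext_iff, Fin.lt_def]
    constructor
    · omega
    · rintro (h1 | h1)
      · obtain rfl := Fin.ext h1; omega
      · omega
  have hi : i ∉ before α i := by rw [mem_before]; simp
  rw [kappa_eq, kappa_eq, e, Finset.card_insert_of_notMem hi, h]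
  push_cast
  ring

/-! ### Leading monomials of joint eigenfunctions. -/

instance : IsStrictOrder (Fin N → ℕ) (fun α β => TriLt α β) where
  irrefl := TriLt.irrefl
  trans _ _ _ := TriLt.trans

instance : IsStrictOrder (Fin N → ℕ) (fun α β => StrictDom β α) where
  irrefl := StrictDom.irrefl
  trans _ _ _ h1 h2 := h2.trans h1

theorem coefAt_sum_mon (f : MvPolynomial (Fin N) ℝ) :
    f = ∑ d ∈ f.support, coefAt d f • mon d := by
  conv_lhs => rw [f.as_sum]
  refine Finset.sum_congr rfl fun d _ => ?_
  simp [coefAt, mon, smul_monomial]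

/-- At a maximal β of the support, no other monomial of f contributes to the coefficient of x^β in
U_i f, so κ(β) is the eigenvalue. -/
theorem exists_coefAt_ne_zero_of_eigen {k : ℝ} {f : MvPolynomial (Fin N) ℝ} (hf : f ≠ 0)
    {c : Fin N → ℝ} (hc : ∀ i, opU k i f = c i • f) :
    ∃ β, coefAt β f ≠ 0 ∧ kappa k β = c := by
  set S : Set (Fin N → ℕ) := {β | coefAt β f ≠ 0} with hS
  have hfin : S.Finite := by
    refine (f.support.finite_toSet.image fun d : Fin N →₀ ℕ => (d : Fin N → ℕ)).subset fun β hβ => ?_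
    exact ⟨Finsupp.equivFunOnFinite.symm β, by simpa [hS, coefAt] using hβ, by simp⟩
  have hne : ∃ β, coefAt β f ≠ 0 := by
    by_contra h
    push Not at h
    refine hf ?_
    rw [coefAt_sum_mon f]
    exact Finset.sum_eq_zero fun d _ => by rw [h, zero_smul]
  obtain ⟨⟨β, hβ⟩, -, hmax⟩ := (hfin.wellFoundedOn (r := fun α β => TriLt β α)).has_min
    Set.univ ⟨⟨hne.choose, hne.choose_spec⟩, trivial⟩
  refine ⟨β, hβ, funext fun i => ?_⟩
  have h1 : coefAt β (opU k i f) = kappa k β i * coefAt β f := by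
    conv_lhs => rw [coefAt_sum_mon f]
    conv_rhs => rw [coefAt_sum_mon f]
    rw [map_sum, map_sum, map_sum, Finset.mul_sum]
    refine Finset.sum_congr rfl fun d _ => ?_
    rw [map_smul, map_smul, map_smul, smul_eq_mul, smul_eq_mul]
    by_cases hd : coefAt d f = 0
    · rw [hd]; ring
    have h2 := coefAt_eq_zero_of_mem_lowerSpan (α := β) (opU_mon_sub_mem k i d)
      fun h => hmax ⟨d, hd⟩ trivial h.2
    rw [map_sub, map_smul, sub_eq_zero, smul_eq_mul] at h2
    rw [h2, coefAt_mon]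
    split_ifs with h3
    · rw [h3]; ring
    · ring
  rw [hc, map_smul, smul_eq_mul] at h1
  exact (mul_right_cancel₀ hβ h1).symm

theorem coefAt_permOp (w : Equiv.Perm (Fin N)) (α : Fin N → ℕ) (f : MvPolynomial (Fin N) ℝ) :
    coefAt (permComp w α) (permOp w f) = coefAt α f := by
  have e : Finsupp.equivFunOnFinite.symm (permComp w α) =
      Finsupp.mapDomain w (Finsupp.equivFunOnFinite.symm α) := by
    ext l
    obtain ⟨l, rfl⟩ := w.surjective l
    rw [Finsupp.mapDomain_apply w.injective]
    simp [permComp]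
  rw [coefAt, coefAt, lcoeff_apply, lcoeff_apply, e, permOp, AlgHom.toLinearMap_apply,
    coeff_rename_mapDomain _ w.injective]

theorem opU_swapOp_left (k : ℝ) {i j : Fin N} (hij : (j : ℕ) = i + 1)
    (f : MvPolynomial (Fin N) ℝ) :
    opU k i (swapOp i j f) = swapOp i j (opU k j f) + k • f :=
  LinearMap.congr_fun (opU_mul_swapOp k hij) f

theorem opU_swapOp_right (k : ℝ) {i j : Fin N} (hij : (j : ℕ) = i + 1)
    (f : MvPolynomial (Fin N) ℝ) :
    opU k j (swapOp i j f) = swapOp i j (opU k i f) - k • f := by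
  have := LinearMap.congr_fun (swapOp_mul_opU k hij) f
  simp only [Module.End.mul_apply, LinearMap.add_apply, LinearMap.smul_apply,
    Module.End.one_apply] at this
  rw [this, add_sub_cancel_right]

theorem opU_swapOp_of_ne (k : ℝ) {i j l : Fin N} (hij : (j : ℕ) = i + 1) (hi : l ≠ i)
    (hj : l ≠ j) (f : MvPolynomial (Fin N) ℝ) :
    opU k l (swapOp i j f) = swapOp i j (opU k l f) :=
  (LinearMap.congr_fun (swapOp_mul_opU_of_ne k hij hi hj) f).symm

/-- For s = (i j), the relation κ_i = κ_j + k absorbs the extra terms of the exchange relations, so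
sf − f is an eigenfunction for κ(α) with the two values interchanged. If it were nonzero it would
contain a monomial x^β with β = sα = α; but the coefficients of x^α in sf and in f agree. -/
theorem swapOp_eq_self_of_isEigen {k : ℝ} (hk : 0 ≤ k) {α : Fin N → ℕ}
    {f : MvPolynomial (Fin N) ℝ} (hf : IsEigen k α f) {i j : Fin N} (hij : (j : ℕ) = i + 1)
    (h : α i = α j) : swapOp i j f = f := by
  rw [← sub_eq_zero]
  by_contra hne
  have hκ := kappa_sub_of_eq k hij h
  have hji : j ≠ i := fun h => by rw [h] at hij; omega
  obtain ⟨β, hβ, hc⟩ := exists_coefAt_ne_zero_of_eigen (k := k) hne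
    (c := fun l => kappa k α (Equiv.swap i j l)) fun l => by
      rcases eq_or_ne l i with rfl | hi
      · rw [map_sub, opU_swapOp_left k hij, hf, hf, map_smul, Equiv.swap_apply_left, hκ]
        module
      rcases eq_or_ne l j with rfl | hj
      · rw [map_sub, opU_swapOp_right k hij, hf, hf, map_smul, Equiv.swap_apply_right, hκ]
        module
      · rw [map_sub, opU_swapOp_of_ne k hij hi hj, hf, map_smul,
          Equiv.swap_apply_of_ne_of_ne hi hj]
        module
  have hs : permComp (Equiv.swap i j) α = α := by
    rw [permComp_swap, ← h, Function.update_eq_self, h, Function.update_eq_self]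
  have e : β = α := by
    rw [← hs]
    funext l
    rw [permComp_swap_apply]
    exact (eq_of_kappa_eq hk (Equiv.swap i j) (fun l => (congrFun hc l).symm) l).symm
  refine hβ ?_
  rw [e, map_sub, sub_eq_zero]
  conv_lhs => rw [← hs]
  exact coefAt_permOp _ _ _

/-! ### Permutations of an interval and induction along descents. -/

theorem mem_interval {ℓ m : ℕ} {i : Fin N} : i ∈ interval N ℓ m ↔ ℓ ≤ (i : ℕ) ∧ (i : ℕ) < ℓ + m := by
  simp [interval]

theorem mem_permsOf {I : Finset (Fin N)} {w : Equiv.Perm (Fin N)} :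
    w ∈ permsOf I ↔ ∀ i, i ∉ I → w i = i := by simp [permsOf]

theorem apply_mem_of_mem_permsOf {I : Finset (Fin N)} {w : Equiv.Perm (Fin N)}
    (hw : w ∈ permsOf I) {i : Fin N} (hi : i ∈ I) : w i ∈ I := by
  by_contra h
  have := mem_permsOf.1 hw (w i) h
  exact h (by rwa [w.injective this])

theorem mul_mem_permsOf {I : Finset (Fin N)} {u v : Equiv.Perm (Fin N)}
    (hu : u ∈ permsOf I) (hv : v ∈ permsOf I) : u * v ∈ permsOf I := by
  rw [mem_permsOf] at *
  intro i hi
  rw [Equiv.Perm.mul_apply, hv i hi, hu i hi]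

theorem inv_mem_permsOf {I : Finset (Fin N)} {u : Equiv.Perm (Fin N)}
    (hu : u ∈ permsOf I) : u⁻¹ ∈ permsOf I := by
  rw [mem_permsOf] at *
  intro i hi
  rw [Equiv.Perm.inv_eq_iff_eq, hu i hi]

theorem swap_mem_permsOf {I : Finset (Fin N)} {i j : Fin N} (hi : i ∈ I) (hj : j ∈ I) :
    Equiv.swap i j ∈ permsOf I := by
  rw [mem_permsOf]
  intro l hl
  exact Equiv.swap_apply_of_ne_of_ne (fun h => hl (h ▸ hi)) (fun h => hl (h ▸ hj))

theorem eq_one_of_strictMono {w : Equiv.Perm (Fin N)} (h : StrictMono w) : w = 1 := by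
  have h' : StrictMono (w⁻¹ : Equiv.Perm (Fin N)) := by
    intro a b hab
    by_contra hc
    rcases (not_lt.1 hc).eq_or_lt with h1 | h1
    · exact hab.ne (w⁻¹.injective h1.symm)
    · have := h h1
      simp only [perm_apply_inv_self] at this
      exact lt_asymm hab this
  ext1 i
  refine le_antisymm ?_ h.le_apply
  have := h.monotone (h'.le_apply (x := i))
  rwa [perm_apply_inv_self] at this

theorem exists_descent {ℓ m : ℕ} {w : Equiv.Perm (Fin N)} (hw : w ∈ permsOf (interval N ℓ m))
    (h1 : w ≠ 1) : ∃ i ∈ interval N ℓ m, ∃ j ∈ interval N ℓ m, (j : ℕ) = i + 1 ∧ w j < w i := by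
  by_contra hcon
  push Not at hcon
  refine h1 (eq_one_of_strictMono ?_)
  have adj : ∀ i j : Fin N, (j : ℕ) = i + 1 → w i < w j := by
    intro i j hij
    have hne : w i ≠ w j := fun h => by
      have := congrArg Fin.val (w.injective h); omega
    by_cases hi : i ∈ interval N ℓ m
    · by_cases hj : j ∈ interval N ℓ m
      · exact lt_of_le_of_ne (hcon i hi j hj hij) hne
      · have := apply_mem_of_mem_permsOf hw hi
        rw [mem_permsOf.1 hw j hj, Fin.lt_def]
        rw [mem_interval] at *
        omega
    · by_cases hj : j ∈ interval N ℓ m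
      · have := apply_mem_of_mem_permsOf hw hj
        rw [mem_permsOf.1 hw i hi, Fin.lt_def]
        rw [mem_interval] at *
        omega
      · rw [mem_permsOf.1 hw i hi, mem_permsOf.1 hw j hj, Fin.lt_def]
        omega
  rcases N with _ | n
  · exact fun i => i.elim0
  · exact Fin.strictMono_iff_lt_succ.2 fun i => adj _ _ (by simp)

/-- The weights N − l decrease with l, so moving the larger value to the right lowers the sum. This
is the termination measure of `perm_induction`. -/
theorem sum_weight_swap_lt {w : Equiv.Perm (Fin N)} {i j : Fin N} (hij : (j : ℕ) = i + 1)
    (h : w j < w i) : ∑ l : Fin N, (N - (l : ℕ)) * ((w * Equiv.swap i j) l : ℕ) <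
      ∑ l : Fin N, (N - (l : ℕ)) * (w l : ℕ) := by
  have hji : j ≠ i := fun h => by rw [h] at hij; omega
  have hi := Finset.mem_univ i
  have hj : j ∈ Finset.univ.erase i := by simp [hji]
  rw [← Finset.add_sum_erase _ _ hi, ← Finset.add_sum_erase _ _ hj,
    ← Finset.add_sum_erase _ (fun l : Fin N => (N - (l : ℕ)) * (w l : ℕ)) hi,
    ← Finset.add_sum_erase _ (fun l : Fin N => (N - (l : ℕ)) * (w l : ℕ)) hj,
    Finset.sum_congr rfl (g := fun l : Fin N => (N - (l : ℕ)) * (w l : ℕ)) fun l hl => by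
      simp at hl
      rw [Equiv.Perm.mul_apply, Equiv.swap_apply_of_ne_of_ne hl.2 hl.1],
    Equiv.Perm.mul_apply, Equiv.Perm.mul_apply, Equiv.swap_apply_left, Equiv.swap_apply_right,
    ← add_assoc, ← add_assoc, add_lt_add_iff_right]
  rw [Fin.lt_def] at h
  obtain ⟨a, ha⟩ : ∃ a, N - (j : ℕ) = a := ⟨_, rfl⟩
  have ha' : N - (i : ℕ) = a + 1 := by have := j.2; omega
  rw [ha, ha']
  nlinarith

/-- Induction on the length of a permutation, removing descents. -/
theorem perm_induction {ℓ m : ℕ} {P : Equiv.Perm (Fin N) → Prop} (h1 : P 1)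
    (hs : ∀ w ∈ permsOf (interval N ℓ m), ∀ i ∈ interval N ℓ m, ∀ j ∈ interval N ℓ m,
      (j : ℕ) = i + 1 → w j < w i → P (w * Equiv.swap i j) → P w)
    (w : Equiv.Perm (Fin N)) (hw : w ∈ permsOf (interval N ℓ m)) : P w := by
  induction hn : ∑ l : Fin N, (N - (l : ℕ)) * (w l : ℕ) using Nat.strong_induction_on
    generalizing w with
  | _ n ih =>
  by_cases hw1 : w = 1
  · rw [hw1]; exact h1
  obtain ⟨i, hi, j, hj, hij, hd⟩ := exists_descent hw hw1
  exact hs w hw i hi j hj hij hd (ih _ (hn ▸ sum_weight_swap_lt hij hd) _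
    (mul_mem_permsOf hw (swap_mem_permsOf hi hj)) rfl)

/-- A permutation preserving a partition has its descents only between equal parts, so they can be
removed with `swapOp_eq_self_of_isEigen`. -/
theorem permOp_eq_self_of_isEigen {k : ℝ} (hk : 0 ≤ k) {lam : Fin N → ℕ} (hlam : Antitone lam)
    {f : MvPolynomial (Fin N) ℝ} (hf : IsEigen k lam f) (u : Equiv.Perm (Fin N))
    (hu : ∀ i, lam (u i) = lam i) : permOp u f = f := by
  have key : ∀ u ∈ permsOf (interval N 0 N), (∀ i, lam (u i) = lam i) → permOp u f = f := by
    refine perm_induction (fun _ => by rw [permOp_one]; rfl) fun w _ i _ j _ hij hd ih hw => ?_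
    have e : lam i = lam j := by
      refine le_antisymm ?_ (hlam (by rw [Fin.le_def]; omega))
      rw [← hw i, ← hw j]
      exact hlam hd.le
    have h1 : permOp (w * Equiv.swap i j) f = f := by
      refine ih fun l => ?_
      rw [Equiv.Perm.mul_apply, hw, Equiv.swap_apply_def]
      split_ifs with c1 c2
      · rw [c1, e]
      · rw [c2, e]
      · rfl
    rw [permOp_mul, Module.End.mul_apply] at h1
    rwa [← swapOp, swapOp_eq_self_of_isEigen hk hf hij e] at h1
  exact key u (mem_permsOf.2 fun i hi => absurd (mem_interval.2 ⟨Nat.zero_le _, by omega⟩) hi) hu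

/-! ### Existence of ω_λ and ζ_α. -/

theorem sortPerm_stable (α : Fin N → ℕ) {a b : Fin N} (hab : a < b)
    (h : α (sortPerm α a) = α (sortPerm α b)) : sortPerm α a < sortPerm α b :=
  (Tuple.eq_sort_iff.1 (rfl : sortPerm α = Tuple.sort _)).2 a b hab
    (congrArg OrderDual.toDual h)

theorem sortComp_eq_self {lam : Fin N → ℕ} (h : Antitone lam) : sortComp lam = lam := by
  have : sortPerm lam = Equiv.refl _ :=
    Tuple.sort_eq_refl_iff_monotone.2 fun i j hij => OrderDual.toDual_le_toDual.2 (h hij)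
  rw [sortComp_eq_comp, this]
  rfl

theorem permComp_sortPerm (α : Fin N → ℕ) : permComp (sortPerm α) (sortComp α) = α := by
  funext i
  exact congrArg α (perm_apply_inv_self _ i)

theorem sum_sortComp (α : Fin N → ℕ) : ∑ l, sortComp α l = ∑ l, α l :=
  Equiv.sum_comp (sortPerm α) α

theorem not_strictDom_of_sortComp_eq {lam β : Fin N → ℕ} (h : sortComp β = lam) :
    ¬ StrictDom β lam := by
  intro h1
  refine StrictDom.irrefl β (h1.trans ⟨fun j => ?_, fun h2 => h1.2 h2.symm⟩)
  rw [← h]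
  exact sum_le_sum_sortComp β j rfl

/-- A partition is the dominance maximum of its orbit, so nothing with the same sorting lies above
it. This matches the index set of `omegaPart` with the triangularity order. -/
theorem triLt_iff_of_antitone {lam β : Fin N → ℕ} (h : Antitone lam) :
    TriLt lam β ↔ StrictDom (sortComp β) lam := by
  rw [TriLt, sortComp_eq_self h]
  refine ⟨fun h1 => h1.resolve_right fun h2 => ?_, Or.inl⟩
  exact not_strictDom_of_sortComp_eq h2.1.symm h2.2

theorem finite_sum_eq (n : ℕ) : {β : Fin N → ℕ | ∑ l, β l = n}.Finite := by
  refine (Set.finite_Iic (fun _ : Fin N => n)).subset fun β hβ l => ?_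
  have hβ : ∑ l, β l = n := hβ
  rw [← hβ]
  exact Finset.single_le_sum (f := β) (fun _ _ => Nat.zero_le _) (Finset.mem_univ l)

theorem omegaPart_spec {k : ℝ} (hk : 0 ≤ k) {lam : Fin N → ℕ} (hlam : Antitone lam) :
    IsEigen k lam (omegaPart k lam) ∧ omegaPart k lam - pPoly k lam ∈ Submodule.span ℝ
      (pPoly k '' {β | ∑ i, β i = ∑ i, lam i ∧ StrictDom (sortComp β) lam}) := by
  refine Classical.epsilon_spec (p := fun f => IsEigen k lam f ∧ f - pPoly k lam ∈
    Submodule.span ℝ (pPoly k '' {β | ∑ i, β i = ∑ i, lam i ∧ StrictDom (sortComp β) lam})) ?_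
  simp only [← triLt_iff_of_antitone hlam]
  refine exists_eigenvector_of_triangular (opU_commute k) (κ := kappa k)
    (r := fun α β => TriLt α β)
    ((finite_sum_eq (∑ i, lam i)).subset fun β hβ => hβ.1) (fun β hβ i => ?_)
    (fun i => opU_pPoly_sub_mem k i lam) fun β hβ h => ?_
  · refine Submodule.span_mono (Set.image_mono ?_) (opU_pPoly_sub_mem k i β)
    exact fun γ hγ => ⟨⟨hγ.1.trans hβ.1, hβ.2.trans hγ.2⟩, hγ.2⟩
  · rw [kappa_injective hk h] at hβ
    exact TriLt.irrefl _ hβ.2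

theorem isEigen_omegaPart {k : ℝ} (hk : 0 ≤ k) (α : Fin N → ℕ) :
    IsEigen k (sortComp α) (omegaPart k (sortComp α)) :=
  (omegaPart_spec hk (sortComp_antitone α)).1

/-- The sorting permutation of wα may differ from w times that of α, but only by a permutation
preserving α⁺, which fixes the eigenfunction ω of α⁺. -/
theorem omega_permComp {k : ℝ} (hk : 0 ≤ k) (w : Equiv.Perm (Fin N)) (α : Fin N → ℕ) :
    omega k (permComp w α) = permOp w (omega k α) := by
  have h1 : sortPerm (permComp w α) =
      w * sortPerm α * ((w * sortPerm α)⁻¹ * sortPerm (permComp w α)) := by group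
  have h2 : permOp ((w * sortPerm α)⁻¹ * sortPerm (permComp w α)) (omegaPart k (sortComp α)) =
      omegaPart k (sortComp α) := by
    refine permOp_eq_self_of_isEigen hk (sortComp_antitone α) (isEigen_omegaPart hk α) _ fun i => ?_
    conv_rhs => rw [← sortComp_permComp w α]
    have e : ∀ i, sortComp α i = permComp w α ((w * sortPerm α) i) := fun i => by
      rw [permComp, Equiv.Perm.mul_apply, perm_inv_apply_self]; rfl
    rw [e, Equiv.Perm.mul_apply _ (sortPerm (permComp w α)), perm_apply_inv_self]
    rfl
  rw [omega, omega, sortComp_permComp, h1, permOp_mul, Module.End.mul_apply, h2, permOp_mul,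
    Module.End.mul_apply]

/-- The T_i x_i are equivariant under all of S_N, so the eigenvalue equation of ω for α⁺ can be
transported by the sorting permutation. As sorting is stable, it carries the indices below l to the
predecessors of its value at l; only the difference with the indices below i remains. -/
theorem opU_omega {k : ℝ} (hk : 0 ≤ k) (α : Fin N → ℕ) (i : Fin N) :
    opU k i (omega k α) - kappa k α i • omega k α =
      k • (∑ j ∈ before α i, swapOp i j (omega k α) -
        ∑ j ∈ Finset.univ.filter (fun j => j < i), swapOp i j (omega k α)) := by
  set w := sortPerm α with hw
  obtain ⟨l, rfl⟩ := w.surjective i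
  have hκ : kappa k α (w l) = kappa k (sortComp α) l := by
    conv_lhs => rw [← permComp_sortPerm α]
    exact kappa_permComp k (fun a b hab h => sortPerm_stable α h hab) l
  have hbef : ∀ a b, a < b ↔ w a ∈ before α (w b) := by
    have h1 : ∀ {a b}, a < b → w a ∈ before α (w b) := by
      intro a b hab
      rw [mem_before]
      have h2 : α (w b) ≤ α (w a) := sortComp_antitone α hab.le
      rcases h2.eq_or_lt with h3 | h3
      · exact Or.inr ⟨sortPerm_stable α hab h3.symm, h3.symm⟩
      · exact Or.inl h3
    intro a b
    refine ⟨h1, fun h2 => ?_⟩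
    by_contra h3
    rcases (not_lt.1 h3).eq_or_lt with h4 | h4
    · subst h4; rw [mem_before] at h2; simp at h2
    · exact (before_ssubset (h1 h4)).2.elim (before_ssubset h2).1
  have hD : dunklD k l (omegaPart k (sortComp α)) =
      kappa k (sortComp α) l • omegaPart k (sortComp α) - k • omegaPart k (sortComp α) +
        k • ∑ j ∈ Finset.univ.filter (fun j => j < l), swapOp l j (omegaPart k (sortComp α)) := by
    rw [← isEigen_omegaPart hk α l, opU_eq, murphy]
    simp only [LinearMap.sub_apply, LinearMap.add_apply, LinearMap.smul_apply,
      LinearMap.sum_apply, Module.End.one_apply]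
    abel
  have hDw : dunklD k (w l) (omega k α) = kappa k α (w l) • omega k α - k • omega k α +
      k • ∑ j ∈ before α (w l), swapOp (w l) j (omega k α) := by
    have h1 := LinearMap.congr_fun (permOp_mul_dunklD k w l) (omegaPart k (sortComp α))
    rw [Module.End.mul_apply, Module.End.mul_apply, hD, map_add, map_sub, map_smul, map_smul,
      map_smul, map_sum] at h1
    rw [hκ]
    refine h1.symm.trans (congrArg (fun x => kappa k (sortComp α) l • omega k α -
      k • omega k α + k • x) ?_)
    refine Finset.sum_equiv w (fun j => ?_) fun j _ => ?_
    · rw [← hbef]; simp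
    · exact LinearMap.congr_fun (permOp_mul_swapOp w l j) _
  rw [opU_eq, murphy]
  simp only [LinearMap.sub_apply, LinearMap.add_apply, LinearMap.smul_apply,
    LinearMap.sum_apply, Module.End.one_apply, hDw]
  module

/-- A transposition (i j) survives in `opU_omega` only if it moves a larger entry to the left, that
is, replaces α by a composition strictly dominating it. -/
theorem opU_omega_sub_mem {k : ℝ} (hk : 0 ≤ k) (α : Fin N → ℕ) (i : Fin N) :
    opU k i (omega k α) - kappa k α i • omega k α ∈ Submodule.span ℝ
      (omega k '' {β | sortComp β = sortComp α ∧ StrictDom β α}) := by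
  have hs : ∀ j, swapOp i j (omega k α) = omega k (permComp (Equiv.swap i j) α) := fun j =>
    (omega_permComp hk _ α).symm
  rw [opU_omega hk, before, Finset.sum_filter, Finset.sum_filter, ← Finset.sum_sub_distrib]
  refine Submodule.smul_mem _ _ (Submodule.sum_mem _ fun j _ => ?_)
  rw [hs]
  rcases lt_trichotomy j i with hj | rfl | hj
  · rw [if_pos hj]
    by_cases h : α i < α j ∨ j < i ∧ α j = α i
    · rw [if_pos h, sub_self]; exact Submodule.zero_mem _
    · rw [if_neg h, zero_sub]
      refine Submodule.neg_mem _ (Submodule.subset_span ⟨_, ⟨sortComp_permComp _ _, ?_⟩, rfl⟩)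
      rw [Equiv.swap_comm]
      exact strictDom_swap hj (by simp only [hj, true_and] at h; omega)
  · simp
  · rw [if_neg hj.not_gt, sub_zero]
    split_ifs with h
    · refine Submodule.subset_span ⟨_, ⟨sortComp_permComp _ _, ?_⟩, rfl⟩
      exact strictDom_swap hj (h.resolve_right fun h1 => lt_asymm hj h1.1)
    · exact Submodule.zero_mem _

theorem finite_sortComp_eq (α : Fin N → ℕ) : {β : Fin N → ℕ | sortComp β = sortComp α}.Finite := by
  refine (finite_sum_eq (∑ l, α l)).subset fun β hβ => ?_
  have hβ : sortComp β = sortComp α := hβ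
  change ∑ l, β l = ∑ l, α l
  rw [← sum_sortComp β, hβ, sum_sortComp]

theorem zeta_spec {k : ℝ} (hk : 0 ≤ k) (α : Fin N → ℕ) :
    IsEigen k α (zeta k α) ∧ zeta k α - omega k α ∈ Submodule.span ℝ
      (omega k '' {β | sortComp β = sortComp α ∧ StrictDom β α}) := by
  refine Classical.epsilon_spec (p := fun f => IsEigen k α f ∧ f - omega k α ∈
    Submodule.span ℝ (omega k '' {β | sortComp β = sortComp α ∧ StrictDom β α})) ?_
  refine exists_eigenvector_of_triangular (opU_commute k) (κ := kappa k)
    (r := fun α β => StrictDom β α)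
    ((finite_sortComp_eq α).subset fun β hβ => hβ.1) (fun β hβ i => ?_)
    (fun i => opU_omega_sub_mem hk α i) fun β hβ h => ?_
  · refine Submodule.span_mono (Set.image_mono ?_) (opU_omega_sub_mem hk β i)
    exact fun γ hγ => ⟨⟨hγ.1.trans hβ.1, hγ.2.trans hβ.2⟩, hγ.2⟩
  · rw [kappa_injective hk h] at hβ
    exact StrictDom.irrefl _ hβ.2

theorem isEigen_zeta {k : ℝ} (hk : 0 ≤ k) (α : Fin N → ℕ) : IsEigen k α (zeta k α) :=
  (zeta_spec hk α).1

/-! ### Adjacent transpositions acting on ζ_α. -/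

theorem eq_of_prefix_sum_eq {α β : Fin N → ℕ} {i j : Fin N} (hij : (j : ℕ) = i + 1)
    (h : ∀ m, m ≠ i → ∑ l ∈ Finset.Iic m, α l = ∑ l ∈ Finset.Iic m, β l) {l : Fin N}
    (hi : l ≠ i) (hj : l ≠ j) : α l = β l := by
  have e1 := h l hi
  have hl : l ∈ Finset.Iic l := by simp
  rw [← Finset.add_sum_erase _ _ hl, ← Finset.add_sum_erase _ _ hl] at e1
  suffices ∑ i ∈ (Finset.Iic l).erase l, α i = ∑ i ∈ (Finset.Iic l).erase l, β i by omega
  by_cases h0 : (l : ℕ) = 0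
  · have : (Finset.Iic l).erase l = ∅ := by
      ext a
      simp only [Finset.mem_erase, Finset.mem_Iic, Finset.notMem_empty, iff_false, not_and, ne_eq,
        Fin.ext_iff, Fin.le_def]
      omega
    rw [this, Finset.sum_empty, Finset.sum_empty]
  · have : (Finset.Iic l).erase l = Finset.Iic ⟨l - 1, by omega⟩ := by
      ext a
      simp only [Finset.mem_erase, Finset.mem_Iic, ne_eq, Fin.ext_iff, Fin.le_def]
      omega
    rw [this]
    refine h _ fun h1 => hj (Fin.ext ?_)
    rw [hij, ← h1]
    simp only
    omega

/-- The transposition changes no partial sum except the i-th. If both dominances held, δ and α would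
agree off i and j; equal sums and equal sums of squares, with δ_i ≥ α_i > α_j, then force δ = α. -/
theorem not_strictDom_swap {α δ : Fin N → ℕ} {i j : Fin N} (hij : (j : ℕ) = i + 1)
    (hα : α j < α i) (hδ : sortComp δ = sortComp α) (h : StrictDom δ α) :
    ¬ StrictDom (permComp (Equiv.swap i j) α) (permComp (Equiv.swap i j) δ) := by
  intro hc
  have hji : j ≠ i := fun h => by rw [h] at hij; omega
  have hsw : ∀ (f : Fin N → ℕ) (m : Fin N), m ≠ i →
      ∑ l ∈ Finset.Iic m, permComp (Equiv.swap i j) f l = ∑ l ∈ Finset.Iic m, f l := by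
    intro f m hm
    refine Finset.sum_equiv (Equiv.swap i j) (fun l => ?_) fun l _ => permComp_swap_apply _ _ _ _
    rw [Finset.mem_Iic, Finset.mem_Iic, Equiv.swap_apply_def]
    rw [ne_eq, Fin.ext_iff] at hm
    split_ifs with c1 c2
    · subst c1; rw [Fin.le_def, Fin.le_def]; omega
    · subst c2; rw [Fin.le_def, Fin.le_def]; omega
    · rfl
  have hpre : ∀ m, m ≠ i → ∑ l ∈ Finset.Iic m, δ l = ∑ l ∈ Finset.Iic m, α l := fun m hm => by
    refine le_antisymm ?_ (h.1 m)
    rw [← hsw δ m hm, ← hsw α m hm]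
    exact hc.1 m
  have hne : ∀ l, l ≠ i → l ≠ j → δ l = α l := fun l hi hj => eq_of_prefix_sum_eq hij hpre hi hj
  have hi := Finset.mem_univ i
  have hj : j ∈ Finset.univ.erase i := by simp [hji]
  have e1 : ∑ l, δ l = ∑ l, α l := by rw [← sum_sortComp, hδ, sum_sortComp]
  have e2 : ∑ l, δ l ^ 2 = ∑ l, α l ^ 2 := by
    have : ∀ α : Fin N → ℕ, ∑ l, sortComp α l ^ 2 = ∑ l, α l ^ 2 := fun α =>
      Equiv.sum_comp (sortPerm α) fun l => α l ^ 2
    rw [← this, hδ, this]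
  have hrest : ∀ l ∈ (Finset.univ.erase i).erase j, δ l = α l := fun l hl => by
    simp at hl; exact hne l hl.2 hl.1
  rw [← Finset.add_sum_erase _ _ hi, ← Finset.add_sum_erase _ _ hj, ← Finset.add_sum_erase _ α hi,
    ← Finset.add_sum_erase _ α hj, Finset.sum_congr rfl hrest, ← add_assoc, ← add_assoc,
    add_left_inj] at e1
  rw [← Finset.add_sum_erase _ _ hi, ← Finset.add_sum_erase _ _ hj,
    ← Finset.add_sum_erase _ (fun l => α l ^ 2) hi,
    ← Finset.add_sum_erase _ (fun l => α l ^ 2) hj,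
    Finset.sum_congr rfl fun l hl => congrArg (· ^ 2) (hrest l hl), ← add_assoc, ← add_assoc,
    add_left_inj] at e2
  have e3 : α i ≤ δ i := by
    have h1 := h.1 i
    have hm : i ∈ Finset.Iic i := by simp
    rw [← Finset.add_sum_erase _ (fun l => α l) hm, ← Finset.add_sum_erase _ (fun l => δ l) hm,
      Finset.sum_congr rfl (g := fun l => α l) fun l hl => hne l ?_ ?_] at h1
    · omega
    · exact (Finset.mem_erase.1 hl).1
    · rintro rfl
      have := (Finset.mem_Iic.1 (Finset.mem_erase.1 hl).2)
      rw [Fin.le_def] at this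
      omega
  have e4 : δ i = α i := by
    by_contra h1
    have h2 : α i < δ i := lt_of_le_of_ne e3 (Ne.symm h1)
    obtain ⟨a, ha⟩ := Nat.exists_eq_add_of_lt h2
    have hb : α j = δ j + a + 1 := by omega
    rw [ha, hb] at e2
    nlinarith
  refine h.2 (funext fun l => ?_)
  rcases eq_or_ne l i with rfl | h1
  · exact e4
  rcases eq_or_ne l j with rfl | h2
  · omega
  · exact hne l h1 h2

/-- The action of an adjacent transposition on a non-symmetric Jack polynomial. -/
theorem swapOp_zeta {k : ℝ} (hk : 0 ≤ k) {α : Fin N → ℕ} {i j : Fin N} (hij : (j : ℕ) = i + 1)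
    (hα : α j < α i) :
    swapOp i j (zeta k α) = zeta k (permComp (Equiv.swap i j) α) +
      (k / (kappa k α i - kappa k α j)) • zeta k α := by
  set γ := permComp (Equiv.swap i j) α with hγ
  set c := k / (kappa k α i - kappa k α j) with hc
  have hlt : i < j := by rw [Fin.lt_def]; omega
  have hd := kappa_sub_ge hk hα
  -- This is the choice of c: it cancels the multiple k ζ_α produced by the exchange relations.
  have hck : c * kappa k α i = k + c * kappa k α j := by
    have : kappa k α i - kappa k α j ≠ 0 := by linarith
    rw [hc]; field_simp; ring
  have hsγ : permComp (Equiv.swap i j) γ = α := by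
    rw [hγ, ← permComp_mul, Equiv.swap_mul_self, permComp_one]
  have hαγ : StrictDom α γ := by
    have := strictDom_swap (β := γ) hlt (by simpa [hγ, permComp_swap_apply] using hα)
    rwa [hsγ] at this
  -- Q is closed upwards in dominance and omits γ = sα, so the span of its ω_β contains no nonzero
  -- eigenvector for κ(γ).
  set Q : Set (Fin N → ℕ) := {β | sortComp β = sortComp γ ∧ β ≠ γ ∧ ¬ StrictDom γ β} with hQ
  have hsort : sortComp γ = sortComp α := sortComp_permComp _ _
  have heig := isEigen_zeta hk α
  rw [← sub_eq_zero]
  refine eq_zero_of_eigenvector_mem_span (opU_commute k) (v := omega k) (κ := kappa k)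
    (r := fun α β => StrictDom β α) (Q := Q) ((finite_sortComp_eq γ).subset fun β hβ => hβ.1)
    (fun β hβ i => ?_) (c := kappa k γ) (fun β hβ h => hβ.2.1 (kappa_injective hk h))
    (fun l => ?_) ?_
  · refine Submodule.span_mono (Set.image_mono ?_) (opU_omega_sub_mem hk β i)
    intro δ hδ
    refine ⟨⟨hδ.1.trans hβ.1, ?_, fun h => hβ.2.2 (h.trans hδ.2)⟩, hδ.2⟩
    rintro rfl
    exact hβ.2.2 hδ.2
  · rw [← sub_sub, sub_right_comm, map_sub, isEigen_zeta hk γ l, smul_sub]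
    congr 1
    rw [hγ, kappa_swap k hij hα.ne', map_sub, map_smul]
    rcases eq_or_ne l i with rfl | hi
    · rw [opU_swapOp_left k hij, heig, heig, map_smul, Equiv.swap_apply_left, smul_smul, hck]
      module
    rcases eq_or_ne l j with rfl | hj
    · rw [opU_swapOp_right k hij, heig, heig, map_smul, Equiv.swap_apply_right, smul_sub,
        smul_smul _ c, mul_comm _ c, hck]
      module
    · rw [opU_swapOp_of_ne k hij hi hj, heig, map_smul, Equiv.swap_apply_of_ne_of_ne hi hj]
      module
  · have hαQ : α ∈ Q := ⟨hsort.symm, fun h => StrictDom.irrefl γ (by rwa [h] at hαγ),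
      fun h => StrictDom.irrefl _ (h.trans hαγ)⟩
    have h1 : zeta k γ - omega k γ ∈ Submodule.span ℝ (omega k '' Q) := by
      refine Submodule.span_mono (Set.image_mono ?_) (zeta_spec hk γ).2
      exact fun β hβ => ⟨hβ.1, fun h => hβ.2.2 h, fun h => StrictDom.irrefl _ (h.trans hβ.2)⟩
    have h2 : zeta k α ∈ Submodule.span ℝ (omega k '' Q) := by
      rw [← sub_add_cancel (zeta k α) (omega k α)]
      refine Submodule.add_mem _ (Submodule.span_mono (Set.image_mono ?_) (zeta_spec hk α).2)
        (Submodule.subset_span ⟨α, hαQ, rfl⟩)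
      exact fun β hβ => ⟨hβ.1.trans hsort.symm,
        fun h => StrictDom.irrefl γ (StrictDom.trans (h ▸ hβ.2) hαγ),
        fun h => StrictDom.irrefl γ (h.trans (hβ.2.trans hαγ))⟩
    -- The transposition sends a term δ ≻ α to sδ, which is neither sα nor strictly dominated by it.
    have h3 : swapOp i j (zeta k α) - omega k γ ∈ Submodule.span ℝ (omega k '' Q) := by
      rw [hγ, omega_permComp hk, ← swapOp, ← map_sub]
      have h4 := Submodule.mem_map_of_mem (f := swapOp i j) (zeta_spec hk α).2
      rw [Submodule.map_span, ← Set.image_comp] at h4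
      refine Submodule.span_mono ?_ h4
      rintro _ ⟨δ, hδ, rfl⟩
      refine ⟨permComp (Equiv.swap i j) δ, ⟨?_, fun h => hδ.2.2 ?_, ?_⟩, omega_permComp hk _ _⟩
      · rw [sortComp_permComp, hδ.1, hsort]
      · rw [← hsγ, ← h, ← permComp_mul, Equiv.swap_mul_self, permComp_one]
      · exact not_strictDom_swap hij hα hδ.1 hδ.2
    have e : swapOp i j (zeta k α) - (zeta k γ + c • zeta k α) =
        (swapOp i j (zeta k α) - omega k γ) - (zeta k γ - omega k γ) - c • zeta k α := by abel
    rw [e]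
    exact Submodule.sub_mem _ (Submodule.sub_mem _ h3 h1) (Submodule.smul_mem _ _ h2)

/-! ### Two Lagrange interpolation identities. -/

/-- The Lagrange basis polynomials sum to 1; evaluate at 0. -/
theorem sum_prod_div_sub {ι : Type*} [DecidableEq ι] {J : Finset ι} {x : ι → ℝ}
    (hx : Set.InjOn x J) (hJ : J.Nonempty) :
    ∑ r ∈ J, ∏ i ∈ J.erase r, x i / (x i - x r) = 1 := by
  have h := congrArg (Polynomial.eval 0) (Lagrange.sum_basis hx hJ)
  rw [Polynomial.eval_finsetSum, Polynomial.eval_one] at h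
  rw [← h]
  refine Finset.sum_congr rfl fun r hr => ?_
  rw [Lagrange.basis, Polynomial.eval_prod]
  refine Finset.prod_congr rfl fun i hi => ?_
  have hne : x i ≠ x r := fun e =>
    (Finset.mem_erase.1 hi).1 (hx (Finset.mem_erase.1 hi).2 hr e)
  have h1 : x i - x r ≠ 0 := sub_ne_zero.2 hne
  have h2 : x r - x i ≠ 0 := sub_ne_zero.2 hne.symm
  simp only [Lagrange.basisDivisor, Polynomial.eval_mul, Polynomial.eval_C, Polynomial.eval_sub,
    Polynomial.eval_X]
  field_simp
  ring

/-- Interpolate ∏ (X − x_i − k) − ∏ (X − x_i) at the x_r. Its coefficient in degree |J| − 1 is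
−k|J|, while its value at x_r is −k ∏_{i≠r} (x_r − x_i − k); dividing by −k requires k ≠ 0. -/
theorem sum_prod_one_add_div_sub {ι : Type*} [DecidableEq ι] {J : Finset ι} {x : ι → ℝ}
    (hx : Set.InjOn x J) (k : ℝ) :
    ∑ r ∈ J, ∏ i ∈ J.erase r, (1 + k / (x i - x r)) = J.card := by
  rcases eq_or_ne k 0 with rfl | hk
  · simp
  rcases J.eq_empty_or_nonempty with rfl | hJ
  · simp
  set P : Polynomial ℝ := Lagrange.nodal J (fun i => x i + k) - Lagrange.nodal J x with hP
  have hm1 := Lagrange.nodal_monic (s := J) (v := fun i => x i + k)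
  have hm2 := Lagrange.nodal_monic (s := J) (v := x)
  have hdeg : P.degree < J.card := by
    rw [← Lagrange.degree_nodal (s := J) (v := fun i => x i + k)]
    refine Polynomial.degree_sub_lt_left ?_ hm1.ne_zero ?_
    · rw [Lagrange.degree_nodal, Lagrange.degree_nodal]
    · rw [hm1.leadingCoeff, hm2.leadingCoeff]
  have hco : P.coeff (J.card - 1) = -(J.card * k) := by
    have e : ∀ v : ι → ℝ, (Lagrange.nodal J v).coeff (J.card - 1) = -∑ i ∈ J, v i := fun v =>
      Polynomial.prod_X_sub_C_coeff_card_pred J v hJ.card_pos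
    rw [hP, Polynomial.coeff_sub, e, e, Finset.sum_add_distrib, Finset.sum_const, nsmul_eq_mul]
    ring
  rw [Lagrange.coeff_eq_sum hx hdeg] at hco
  have hterm : ∀ r ∈ J, P.eval (x r) / ∏ j ∈ J.erase r, (x r - x j) =
      -k * ∏ i ∈ J.erase r, (1 + k / (x i - x r)) := by
    intro r hr
    rw [hP, Polynomial.eval_sub, Lagrange.eval_nodal_at_node hr, Lagrange.eval_nodal, sub_zero,
      ← Finset.mul_prod_erase _ _ hr, show x r - (x r + k) = -k by ring, mul_div_assoc,
      ← Finset.prod_div_distrib]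
    congr 1
    refine Finset.prod_congr rfl fun i hi => ?_
    have hne : x i ≠ x r := fun e =>
      (Finset.mem_erase.1 hi).1 (hx (Finset.mem_erase.1 hi).2 hr e)
    have h1 : x i - x r ≠ 0 := sub_ne_zero.2 hne
    have h2 : x r - x i ≠ 0 := sub_ne_zero.2 hne.symm
    field_simp
    ring
  rw [Finset.sum_congr rfl hterm, ← Finset.mul_sum] at hco
  have : k * (∑ r ∈ J, ∏ i ∈ J.erase r, (1 + k / (x i - x r)) - J.card) = 0 := by linarith
  exact sub_eq_zero.1 ((mul_eq_zero.1 this).resolve_left hk)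

/-! ### Products over pairs and over inversions. -/

/-- The product of `h i j` over all `i < j` in `I`. -/
def pairProd (I : Finset (Fin N)) (h : Fin N → Fin N → ℝ) : ℝ :=
  ∏ i ∈ I, ∏ j ∈ I, if i < j then h i j else 1

theorem pairProd_eq (I : Finset (Fin N)) (h : Fin N → Fin N → ℝ) :
    pairProd I h = ∏ q ∈ (I ×ˢ I).filter (fun q => q.1 < q.2), h q.1 q.2 := by
  rw [Finset.prod_filter, Finset.prod_product, pairProd]

theorem pairProd_congr {I : Finset (Fin N)} {h h' : Fin N → Fin N → ℝ}
    (e : ∀ i ∈ I, ∀ j ∈ I, i < j → h i j = h' i j) : pairProd I h = pairProd I h' := by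
  refine Finset.prod_congr rfl fun i hi => Finset.prod_congr rfl fun j hj => ?_
  split_ifs with c
  · exact e i hi j hj c
  · rfl

theorem pairProd_mul (I : Finset (Fin N)) (h h' : Fin N → Fin N → ℝ) :
    pairProd I (fun i j => h i j * h' i j) = pairProd I h * pairProd I h' := by
  rw [pairProd, pairProd, pairProd, ← Finset.prod_mul_distrib]
  refine Finset.prod_congr rfl fun i _ => ?_
  rw [← Finset.prod_mul_distrib]
  refine Finset.prod_congr rfl fun j _ => ?_
  split_ifs
  · rfl
  · rw [one_mul]

theorem pairProd_one (I : Finset (Fin N)) : pairProd I (fun _ _ => 1) = 1 := by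
  simp [pairProd]

theorem pairProd_single {I : Finset (Fin N)} {a b : Fin N} (ha : a ∈ I) (hb : b ∈ I) (hab : a < b)
    (c : ℝ) : pairProd I (fun i j => if i = a ∧ j = b then c else 1) = c := by
  rw [pairProd, Finset.prod_eq_single_of_mem a ha, Finset.prod_eq_single_of_mem b hb]
  · rw [if_pos hab, if_pos ⟨rfl, rfl⟩]
  · intro j _ hj
    rw [if_neg (fun h : a = a ∧ j = b => hj h.2), ite_self]
  · intro i _ hi
    refine Finset.prod_eq_one fun j _ => ?_
    rw [if_neg (fun h : i = a ∧ j = b => hi h.1), ite_self]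

theorem pairProd_ne_zero {I : Finset (Fin N)} {h : Fin N → Fin N → ℝ}
    (e : ∀ i ∈ I, ∀ j ∈ I, i < j → h i j ≠ 0) : pairProd I h ≠ 0 := by
  refine Finset.prod_ne_zero_iff.2 fun i hi => Finset.prod_ne_zero_iff.2 fun j hj => ?_
  split_ifs with c
  · exact e i hi j hj c
  · exact one_ne_zero

/-- Splitting off an index `r`; `d` is an order-preserving reindexing of the other indices. -/
theorem pairProd_insert {I J : Finset (Fin N)} {r : Fin N} (hr : r ∉ J) {d : Fin N → Fin N}
    (hd : StrictMonoOn d I) (hJ : I.image d = J) (h : Fin N → Fin N → ℝ) :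
    pairProd (insert r J) h = (∏ i ∈ J, if i < r then h i r else h r i) *
      pairProd I (fun i j => h (d i) (d j)) := by
  have e1 : pairProd I (fun i j => h (d i) (d j)) = pairProd J h := by
    rw [pairProd, pairProd, ← hJ, Finset.prod_image hd.injOn]
    refine Finset.prod_congr rfl fun i hi => ?_
    rw [Finset.prod_image hd.injOn]
    refine Finset.prod_congr rfl fun j hj => ?_
    simp only [hd.lt_iff_lt hi hj]
  rw [e1, pairProd, pairProd, Finset.prod_insert hr, Finset.prod_insert hr, if_neg (lt_irrefl r),
    one_mul, Finset.prod_congr rfl (s₁ := J) fun i _ => Finset.prod_insert (s := J) hr,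
    Finset.prod_mul_distrib, ← mul_assoc, ← Finset.prod_mul_distrib]
  congr 1
  refine Finset.prod_congr rfl fun i hi => ?_
  have hne : i ≠ r := fun h => hr (h ▸ hi)
  rcases lt_or_gt_of_ne hne with c | c
  · rw [if_pos c, if_pos c, if_neg c.not_gt, one_mul]
  · rw [if_pos c, if_neg c.not_gt, if_neg c.not_gt, mul_one]

theorem prod_permsOf {M : Type*} [CommMonoid M] {I : Finset (Fin N)} {w : Equiv.Perm (Fin N)}
    (hw : w ∈ permsOf I) (f : Fin N → M) : ∏ i ∈ I, f (w i) = ∏ i ∈ I, f i := by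
  refine Finset.prod_equiv w (fun i => ⟨apply_mem_of_mem_permsOf hw, fun h => ?_⟩) fun _ _ => rfl
  have := apply_mem_of_mem_permsOf (inv_mem_permsOf hw) h
  rwa [perm_inv_apply_self] at this

theorem StrictlyDecreasingOn.lt_iff {α : Fin N → ℕ} {I : Finset (Fin N)}
    (hα : StrictlyDecreasingOn α I) {i j : Fin N} (hi : i ∈ I) (hj : j ∈ I) :
    α j < α i ↔ i < j := by
  refine ⟨fun h => ?_, hα i hi j hj⟩
  rcases lt_trichotomy i j with h1 | rfl | h1
  · exact h1
  · exact absurd h (lt_irrefl _)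
  · exact absurd (hα j hj i hi h1) (lt_asymm h)

/-- Two equal entries of α are not both at places of I, and w permutes the interval I within itself,
so it does not change the order of a place in I and one outside. -/
theorem kappa_permComp_of_mem (k : ℝ) {α : Fin N → ℕ} {ℓ m : ℕ}
    (hα : StrictlyDecreasingOn α (interval N ℓ m)) {w : Equiv.Perm (Fin N)}
    (hw : w ∈ permsOf (interval N ℓ m)) (a : Fin N) :
    kappa k (permComp w α) (w a) = kappa k α a := by
  refine kappa_permComp k (fun a b hab h => ?_) a
  by_cases ha : a ∈ interval N ℓ m
  · by_cases hb : b ∈ interval N ℓ m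
    · exact absurd hab (hα a ha b hb h).ne'
    · have := apply_mem_of_mem_permsOf hw ha
      rw [mem_permsOf.1 hw b hb]
      rw [mem_interval] at *
      rw [Fin.lt_def] at *
      omega
  · by_cases hb : b ∈ interval N ℓ m
    · have := apply_mem_of_mem_permsOf hw hb
      rw [mem_permsOf.1 hw a ha]
      rw [mem_interval] at *
      rw [Fin.lt_def] at *
      omega
    · rwa [mem_permsOf.1 hw a ha, mem_permsOf.1 hw b hb]

/-- The product of `1 + ε k / (x_i - x_j)` over the inversions of `w` in `I`. -/
def invProd (k ε : ℝ) (x : Fin N → ℝ) (w : Equiv.Perm (Fin N)) (I : Finset (Fin N)) : ℝ :=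
  pairProd I fun i j => if w j < w i then 1 + ε * k / (x i - x j) else 1

/-- Write the pair i < j of `calE` as i = w(b), j = w(a). As α decreases on I, the condition on the
entries becomes a < b, so the product runs over the inversions of w, and κ travels with the entries.
-/
theorem calE_permComp (k ε : ℝ) {α : Fin N → ℕ} {ℓ m : ℕ}
    (hα : StrictlyDecreasingOn α (interval N ℓ m)) {w : Equiv.Perm (Fin N)}
    (hw : w ∈ permsOf (interval N ℓ m)) :
    calE k ε (permComp w α) (interval N ℓ m) =
      invProd k ε (kappa k α) w (interval N ℓ m) := by
  rw [calE, Finset.prod_filter, Finset.prod_product, Finset.prod_comm, ← prod_permsOf hw]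
  refine Finset.prod_congr rfl fun a ha => ?_
  rw [← prod_permsOf hw]
  refine Finset.prod_congr rfl fun b hb => ?_
  simp only [kappa_permComp_of_mem k hα hw, permComp, perm_inv_apply_self, hα.lt_iff ha hb]
  by_cases h1 : w b < w a <;> by_cases h2 : a < b <;> simp [h1, h2]

theorem sigmaI_apply {ℓ m : ℕ} (h : ℓ + m ≤ N) {i : Fin N} (hi : i ∈ interval N ℓ m) :
    (sigmaI ℓ m h i : ℕ) = 2 * ℓ + m - 1 - i := by
  rw [mem_interval] at hi
  change ((if hi : ℓ ≤ (i : ℕ) ∧ (i : ℕ) < ℓ + m then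
    (⟨2 * ℓ + m - 1 - (i : ℕ), by omega⟩ : Fin N) else i : Fin N) : ℕ) = _
  rw [dif_pos hi]

theorem sigmaI_mem {ℓ m : ℕ} (h : ℓ + m ≤ N) : sigmaI ℓ m h ∈ permsOf (interval N ℓ m) := by
  rw [mem_permsOf]
  intro i hi
  rw [mem_interval] at hi
  change (if hi : ℓ ≤ (i : ℕ) ∧ (i : ℕ) < ℓ + m then
    (⟨2 * ℓ + m - 1 - (i : ℕ), by omega⟩ : Fin N) else i) = i
  rw [dif_neg hi]

theorem calE_revComp (k ε : ℝ) {α : Fin N → ℕ} {ℓ m : ℕ} (h : ℓ + m ≤ N)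
    (hα : StrictlyDecreasingOn α (interval N ℓ m)) :
    calE k ε (revComp α ℓ m h) (interval N ℓ m) =
      pairProd (interval N ℓ m) fun i j => 1 + ε * k / (kappa k α i - kappa k α j) := by
  rw [revComp, calE_permComp k ε hα (sigmaI_mem h)]
  refine pairProd_congr fun i hi j hj hij => if_pos ?_
  rw [Fin.lt_def, sigmaI_apply h hi, sigmaI_apply h hj]
  rw [mem_interval] at hi hj
  rw [Fin.lt_def] at hij
  omega

/-- Interchanging two adjacent values reverses the order of no other pair, so (a, b) is the only new
inversion. -/
theorem invProd_swap_mul (k ε : ℝ) (x : Fin N → ℝ) {I : Finset (Fin N)} {w : Equiv.Perm (Fin N)}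
    {a b : Fin N} (ha : a ∈ I) (hb : b ∈ I) (hab : a < b) (hw : (w b : ℕ) = w a + 1) :
    invProd k ε x (Equiv.swap (w a) (w b) * w) I =
      invProd k ε x w I * (1 + ε * k / (x a - x b)) := by
  conv_rhs => rw [← pairProd_single ha hb hab (1 + ε * k / (x a - x b))]
  rw [invProd, invProd, ← pairProd_mul]
  refine pairProd_congr fun i _ j _ hij => ?_
  by_cases h : i = a ∧ j = b
  · obtain ⟨rfl, rfl⟩ := h
    have h1 : w i < w j := by rw [Fin.lt_def]; omega
    simp [h1, h1.not_gt]
  · rw [if_neg h, mul_one]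
    have h1 : (Equiv.swap (w a) (w b) * w) j < (Equiv.swap (w a) (w b) * w) i ↔ w j < w i := by
      rw [Equiv.Perm.mul_apply, Equiv.Perm.mul_apply]
      constructor
      · intro h1
        have h2 := swap_lt_swap_of_adjacent hw h1 fun h3 => ?_
        · rwa [Equiv.swap_apply_self, Equiv.swap_apply_self] at h2
        · obtain ⟨h3, h4⟩ := h3
          rw [Equiv.swap_apply_eq_iff, Equiv.swap_apply_left] at h3
          rw [Equiv.swap_apply_eq_iff, Equiv.swap_apply_right] at h4
          exact h ⟨w.injective h4, w.injective h3⟩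
      · intro h1
        refine swap_lt_swap_of_adjacent hw h1 fun h2 => ?_
        rw [w.injective h2.1, w.injective h2.2] at hij
        exact lt_asymm hij hab
    simp only [h1]

theorem invProd_one (k ε : ℝ) (x : Fin N → ℝ) (I : Finset (Fin N)) : invProd k ε x 1 I = 1 := by
  rw [← pairProd_one I]
  exact pairProd_congr fun i _ j _ hij => if_neg hij.not_gt

theorem one_add_div_pos {k ε d : ℝ} (hk : 0 ≤ k) (hε : ε = 1 ∨ ε = -1) (hd : k + 1 ≤ d) :
    0 < 1 + ε * k / d := by
  have h0 : 0 < d := by linarith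
  rcases hε with rfl | rfl
  · positivity
  · have : k / d < 1 := (div_lt_one h0).2 (by linarith)
    rw [neg_one_mul, neg_div]
    linarith

theorem StrictlyDecreasingOn.kappa_sub_ge {k : ℝ} (hk : 0 ≤ k) {α : Fin N → ℕ}
    {I : Finset (Fin N)} (hα : StrictlyDecreasingOn α I) {i j : Fin N} (hi : i ∈ I) (hj : j ∈ I)
    (hij : i < j) : k + 1 ≤ kappa k α i - kappa k α j :=
  DunklJack.kappa_sub_ge hk (hα i hi j hj hij)

theorem StrictlyDecreasingOn.kappa_injOn {k : ℝ} (hk : 0 ≤ k) {α : Fin N → ℕ}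
    {I : Finset (Fin N)} (hα : StrictlyDecreasingOn α I) : Set.InjOn (kappa k α) I := by
  intro i hi j hj h
  rcases lt_trichotomy i j with h1 | h1 | h1
  · have := hα.kappa_sub_ge hk hi hj h1; linarith
  · exact h1
  · have := hα.kappa_sub_ge hk hj hi h1; linarith

theorem invProd_ne_zero {k ε : ℝ} (hk : 0 ≤ k) (hε : ε = 1 ∨ ε = -1) {α : Fin N → ℕ}
    {I : Finset (Fin N)} (hα : StrictlyDecreasingOn α I) (w : Equiv.Perm (Fin N)) :
    invProd k ε (kappa k α) w I ≠ 0 := by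
  refine pairProd_ne_zero fun i hi j hj hij => ?_
  split_ifs
  · exact (one_add_div_pos hk hε (hα.kappa_sub_ge hk hi hj hij)).ne'
  · exact one_ne_zero

/-! ### Symmetry of j and a under S_I. -/

/-- The common form of `j_{α;I}` (trivial character, `ε = 1`) and `a_{α;I}` (sign character,
`ε = -1`). -/
def altSum (k ε : ℝ) (χ : Equiv.Perm (Fin N) →* ℝ) (α : Fin N → ℕ) (ℓ m : ℕ) :
    MvPolynomial (Fin N) ℝ :=
  (pairProd (interval N ℓ m) fun i j => 1 + ε * k / (kappa k α i - kappa k α j)) •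
    ∑ w ∈ permsOf (interval N ℓ m),
      (χ w / invProd k ε (kappa k α) w (interval N ℓ m)) • zeta k (permComp w α)

theorem sum_permsOf_mul_left {M : Type*} [AddCommMonoid M] {I : Finset (Fin N)}
    {u : Equiv.Perm (Fin N)} (hu : u ∈ permsOf I) (F : Equiv.Perm (Fin N) → M) :
    ∑ w ∈ permsOf I, F (u * w) = ∑ w ∈ permsOf I, F w := by
  refine Finset.sum_equiv (Equiv.mulLeft u) (fun w => ⟨mul_mem_permsOf hu, fun h => ?_⟩)
    fun _ _ => rfl
  have := mul_mem_permsOf (inv_mem_permsOf hu) h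
  rwa [Equiv.coe_mulLeft, inv_mul_cancel_left] at this

theorem sum_permsOf_mul_right {M : Type*} [AddCommMonoid M] {I : Finset (Fin N)}
    {u : Equiv.Perm (Fin N)} (hu : u ∈ permsOf I) (F : Equiv.Perm (Fin N) → M) :
    ∑ w ∈ permsOf I, F (w * u) = ∑ w ∈ permsOf I, F w := by
  refine Finset.sum_equiv (Equiv.mulRight u) (fun w => ⟨fun h => mul_mem_permsOf h hu,
    fun h => ?_⟩) fun _ _ => rfl
  have := mul_mem_permsOf h (inv_mem_permsOf hu)
  rwa [Equiv.coe_mulRight, mul_inv_cancel_right] at this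

theorem sum_permsOf_inv {M : Type*} [AddCommMonoid M] {I : Finset (Fin N)}
    (F : Equiv.Perm (Fin N) → M) : ∑ w ∈ permsOf I, F w⁻¹ = ∑ w ∈ permsOf I, F w := by
  refine Finset.sum_equiv (Equiv.inv _) (fun w => ⟨inv_mem_permsOf, fun h => ?_⟩) fun _ _ => rfl
  have := inv_mem_permsOf h
  rwa [Equiv.inv_apply, inv_inv] at this

/-- With s = (i j), the terms for w and sw add up to a multiple of (1 + ε s) ζ_{wα}: the additional
inversion of sw supplies exactly the denominator needed in the exchange formula. -/
theorem swapOp_altSum {k ε : ℝ} (hk : 0 ≤ k) (hε : ε = 1 ∨ ε = -1)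
    {χ : Equiv.Perm (Fin N) →* ℝ} (hχ : ∀ i j : Fin N, i ≠ j → χ (Equiv.swap i j) = ε)
    {α : Fin N → ℕ} {ℓ m : ℕ} (hα : StrictlyDecreasingOn α (interval N ℓ m)) {i j : Fin N}
    (hi : i ∈ interval N ℓ m) (hj : j ∈ interval N ℓ m) (hij : (j : ℕ) = i + 1) :
    swapOp i j (altSum k ε χ α ℓ m) = ε • altSum k ε χ α ℓ m := by
  have hji : i ≠ j := fun h => by rw [h] at hij; omega
  have hεε : ε * ε = 1 := by rcases hε with rfl | rfl <;> norm_num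
  set f : Equiv.Perm (Fin N) → MvPolynomial (Fin N) ℝ := fun w =>
    (χ w / invProd k ε (kappa k α) w (interval N ℓ m)) • zeta k (permComp w α) with hf
  have key1 : ∀ w ∈ permsOf (interval N ℓ m), w⁻¹ i < w⁻¹ j →
      swapOp i j (f w + f (Equiv.swap i j * w)) = ε • (f w + f (Equiv.swap i j * w)) := by
    intro w hw hlt
    obtain ⟨a, rfl⟩ := w.surjective i
    obtain ⟨b, rfl⟩ := w.surjective j
    have hinv := inv_mem_permsOf hw
    have ha := apply_mem_of_mem_permsOf hinv hi
    have hb := apply_mem_of_mem_permsOf hinv hj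
    rw [perm_inv_apply_self] at ha hb
    rw [perm_inv_apply_self, perm_inv_apply_self] at hlt
    have hz := swapOp_zeta hk (α := permComp w α) hij
      (by simpa only [permComp, perm_inv_apply_self] using hα a ha b hb hlt)
    rw [kappa_permComp_of_mem k hα hw, kappa_permComp_of_mem k hα hw, ← permComp_mul,
      ← sub_eq_iff_eq_add] at hz
    have hpos := one_add_div_pos hk hε (hα.kappa_sub_ge hk ha hb hlt)
    have hE := invProd_ne_zero hk hε hα w
    have hsum : f w + f (Equiv.swap (w a) (w b) * w) =
        (χ w / (invProd k ε (kappa k α) w (interval N ℓ m) *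
          (1 + ε * k / (kappa k α a - kappa k α b)))) •
          (zeta k (permComp w α) + ε • swapOp (w a) (w b) (zeta k (permComp w α))) := by
      simp only [hf]
      rw [invProd_swap_mul k ε _ ha hb hlt hij, ← hz, map_mul, hχ _ _ hji]
      have e1 : χ w / invProd k ε (kappa k α) w (interval N ℓ m) =
          (χ w / (invProd k ε (kappa k α) w (interval N ℓ m) *
          (1 + ε * k / (kappa k α a - kappa k α b)))) *
          (1 + ε * k / (kappa k α a - kappa k α b)) := by
        field_simp
      rw [e1, mul_div_assoc ε k]
      module
    have hs : swapOp (w a) (w b) (swapOp (w a) (w b) (zeta k (permComp w α))) =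
        zeta k (permComp w α) := LinearMap.congr_fun (swapOp_mul_self (w a) (w b)) _
    have hmod : ∀ (c : ℝ) (x y : MvPolynomial (Fin N) ℝ),
        ε • c • (x + ε • y) = c • (ε • x + (ε * ε) • y) := fun c x y => by module
    rw [hsum, map_smul, map_add, map_smul, hs, hmod, hεε, one_smul,
      add_comm (ε • _)]
  have key : ∀ w ∈ permsOf (interval N ℓ m),
      swapOp i j (f w + f (Equiv.swap i j * w)) = ε • (f w + f (Equiv.swap i j * w)) := by
    intro w hw
    rcases lt_or_gt_of_ne (w⁻¹.injective.ne hji) with h | h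
    · exact key1 w hw h
    · have := key1 (Equiv.swap i j * w) (mul_mem_permsOf (swap_mem_permsOf hi hj) hw) (by
        rw [mul_inv_rev, Equiv.swap_inv, Equiv.Perm.mul_apply, Equiv.Perm.mul_apply,
          Equiv.swap_apply_left, Equiv.swap_apply_right]
        exact h)
      rwa [← mul_assoc, Equiv.swap_mul_self, one_mul, add_comm] at this
  -- Summing over all w, not over pairs {w, sw}, counts every term twice.
  have h2 : swapOp i j (∑ w ∈ permsOf (interval N ℓ m), f w) =
      ε • ∑ w ∈ permsOf (interval N ℓ m), f w := by
    have h3 := Finset.sum_congr rfl key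
    rw [← map_sum, ← Finset.smul_sum, Finset.sum_add_distrib,
      sum_permsOf_mul_left (swap_mem_permsOf hi hj), ← two_smul ℝ, map_smul, smul_comm ε] at h3
    exact smul_right_injective _ (two_ne_zero' ℝ) h3
  rw [altSum, map_smul, h2, smul_comm]

theorem permOp_altSum {k ε : ℝ} (hk : 0 ≤ k) (hε : ε = 1 ∨ ε = -1)
    {χ : Equiv.Perm (Fin N) →* ℝ} (hχ : ∀ i j : Fin N, i ≠ j → χ (Equiv.swap i j) = ε)
    {α : Fin N → ℕ} {ℓ m : ℕ} (hα : StrictlyDecreasingOn α (interval N ℓ m))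
    {w : Equiv.Perm (Fin N)} (hw : w ∈ permsOf (interval N ℓ m)) :
    permOp w (altSum k ε χ α ℓ m) = χ w • altSum k ε χ α ℓ m := by
  refine perm_induction (ℓ := ℓ) (m := m)
    (P := fun w => permOp w (altSum k ε χ α ℓ m) = χ w • altSum k ε χ α ℓ m) ?_ ?_ w hw
  · rw [permOp_one, map_one, one_smul]; rfl
  · intro w _ i hi j hj hij _ ih
    have hji : i ≠ j := fun h => by rw [h] at hij; omega
    have hεε : ε * ε = 1 := by rcases hε with rfl | rfl <;> norm_num
    have e : permOp w = permOp (w * Equiv.swap i j) * swapOp i j := by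
      rw [swapOp, ← permOp_mul, mul_assoc, Equiv.swap_mul_self, mul_one]
    rw [e, Module.End.mul_apply, swapOp_altSum hk hε hχ hα hi hj hij, map_smul, ih, map_mul,
      hχ i j hji, smul_smul, mul_left_comm, hεε, mul_one]

/-! ### Removing the last place of the interval. -/

theorem interval_succ {ℓ s : ℕ} {t : Fin N} (ht : (t : ℕ) = ℓ + s) :
    interval N ℓ (s + 1) = insert t (interval N ℓ s) := by
  ext i
  rw [Finset.mem_insert, mem_interval, mem_interval, Fin.ext_iff]
  omega

theorem notMem_interval {ℓ s : ℕ} {t : Fin N} (ht : (t : ℕ) = ℓ + s) : t ∉ interval N ℓ s := by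
  rw [mem_interval]
  omega

theorem card_interval {ℓ s : ℕ} (h : ℓ + s ≤ N) : (interval N ℓ s).card = s := by
  induction s with
  | zero =>
    rw [Finset.card_eq_zero, Finset.eq_empty_iff_forall_notMem]
    intro i
    rw [mem_interval]; omega
  | succ s ih =>
    have ht : ((⟨ℓ + s, by omega⟩ : Fin N) : ℕ) = ℓ + s := rfl
    rw [interval_succ ht, Finset.card_insert_of_notMem (notMem_interval ht), ih (by omega)]

theorem permsOf_mono {I J : Finset (Fin N)} (h : I ⊆ J) {w : Equiv.Perm (Fin N)}
    (hw : w ∈ permsOf I) : w ∈ permsOf J := by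
  rw [mem_permsOf] at *
  exact fun i hi => hw i fun h1 => hi (h h1)

/-- The coset decomposition of a sum over `S_J` for `J = I ∪ {t}`. -/
theorem sum_permsOf_insert {M : Type*} [AddCommMonoid M] {I : Finset (Fin N)} {t : Fin N}
    (ht : t ∉ I) {d : Fin N → Equiv.Perm (Fin N)} (hd : ∀ i ∈ insert t I, d i ∈ permsOf (insert t I))
    (hdt : ∀ i ∈ insert t I, d i t = i) (F : Equiv.Perm (Fin N) → M) :
    ∑ w ∈ permsOf (insert t I), F w = ∑ i ∈ insert t I, ∑ w ∈ permsOf I, F (d i * w) := by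
  rw [← Finset.sum_product']
  have htI : t ∈ insert t I := Finset.mem_insert_self _ _
  refine Finset.sum_bij' (fun w _ => (w t, (d (w t))⁻¹ * w)) (fun p _ => d p.1 * p.2)
    (fun w hw => ?_) (fun p hp => ?_) (fun w _ => ?_) (fun p hp => ?_) (fun w _ => ?_)
  · have h1 := apply_mem_of_mem_permsOf hw htI
    refine Finset.mem_product.2 ⟨h1, mem_permsOf.2 fun i hi => ?_⟩
    by_cases hit : i = t
    · rw [hit, Equiv.Perm.mul_apply, Equiv.Perm.inv_eq_iff_eq, hdt _ h1]
    · exact mem_permsOf.1 (mul_mem_permsOf (inv_mem_permsOf (hd _ h1)) hw) i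
        (by simp [hit, hi])
  · obtain ⟨h1, h2⟩ := Finset.mem_product.1 hp
    exact mul_mem_permsOf (hd _ h1) (permsOf_mono (Finset.subset_insert _ _) h2)
  · exact mul_inv_cancel_left _ _
  · obtain ⟨h1, h2⟩ := Finset.mem_product.1 hp
    have e : (d p.1 * p.2) t = p.1 := by
      rw [Equiv.Perm.mul_apply, mem_permsOf.1 h2 t ht, hdt _ h1]
    simp only [e, inv_mul_cancel_left]
  · rw [mul_inv_cancel_left]

theorem cycleIcc_val {r t : Fin N} (h : r ≤ t) (i : Fin N) :
    (Fin.cycleIcc r t i : ℕ) =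
      if (i : ℕ) < r then (i : ℕ) else if (i : ℕ) < t then i + 1 else if i = t then r else i := by
  have : NeZero N := ⟨by rintro rfl; exact t.elim0⟩
  split_ifs with h1 h2 h3
  · rw [Fin.cycleIcc_of_lt (Fin.lt_def.2 h1)]
  · rw [Fin.cycleIcc_of_ge_of_lt (Fin.le_def.2 (not_lt.1 h1)) (Fin.lt_def.2 h2)]
    exact Fin.val_add_one_of_lt' (by omega)
  · rw [h3, Fin.cycleIcc_of_last h]
  · rw [Fin.cycleIcc_of_gt (lt_of_le_of_ne (Fin.le_def.2 (not_lt.1 h2)) (Ne.symm h3))]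

section Cycle

variable {ℓ s : ℕ} {t r : Fin N}

theorem le_last_of_mem (ht : (t : ℕ) = ℓ + s) (hr : r ∈ interval N ℓ (s + 1)) : r ≤ t := by
  rw [mem_interval] at hr
  rw [Fin.le_def]; omega

theorem cycleIcc_mem (ht : (t : ℕ) = ℓ + s) (hr : r ∈ interval N ℓ (s + 1)) :
    Fin.cycleIcc r t ∈ permsOf (interval N ℓ (s + 1)) := by
  rw [mem_permsOf]
  intro i hi
  refine Fin.ext ?_
  rw [cycleIcc_val (le_last_of_mem ht hr)]
  rw [mem_interval] at hi hr
  split_ifs with h1 h2 h3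
  · rfl
  · omega
  · rw [h3] at hi
    omega
  · rfl

theorem cycleIcc_last (ht : (t : ℕ) = ℓ + s) (hr : r ∈ interval N ℓ (s + 1)) :
    Fin.cycleIcc r t t = r := by
  have : NeZero N := ⟨by rintro rfl; exact t.elim0⟩
  exact Fin.cycleIcc_of_last (le_last_of_mem ht hr)

theorem cycleIcc_strictMonoOn (ht : (t : ℕ) = ℓ + s) (hr : r ∈ interval N ℓ (s + 1)) :
    StrictMonoOn (Fin.cycleIcc r t) (interval N ℓ s) := by
  intro i hi j hj hij
  have hi := mem_interval.1 (Finset.mem_coe.1 hi)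
  have hj := mem_interval.1 (Finset.mem_coe.1 hj)
  rw [Fin.lt_def] at *
  rw [cycleIcc_val (le_last_of_mem ht hr), cycleIcc_val (le_last_of_mem ht hr)]
  split_ifs <;> omega

theorem image_cycleIcc (ht : (t : ℕ) = ℓ + s) (hr : r ∈ interval N ℓ (s + 1)) :
    (interval N ℓ s).image (Fin.cycleIcc r t) = (interval N ℓ (s + 1)).erase r := by
  have h1 := cycleIcc_last ht hr
  have hmem := cycleIcc_mem ht hr
  ext i
  rw [Finset.mem_image, Finset.mem_erase]
  constructor
  · rintro ⟨a, ha, rfl⟩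
    refine ⟨fun h => ?_, apply_mem_of_mem_permsOf hmem
      (by rw [interval_succ ht]; exact Finset.mem_insert_of_mem ha)⟩
    rw [(Fin.cycleIcc r t).injective (h.trans h1.symm)] at ha
    exact notMem_interval ht ha
  · rintro ⟨hne, hi⟩
    refine ⟨(Fin.cycleIcc r t)⁻¹ i, ?_, perm_apply_inv_self _ _⟩
    have h2 := apply_mem_of_mem_permsOf (inv_mem_permsOf hmem) hi
    rw [interval_succ ht, Finset.mem_insert] at h2
    refine h2.resolve_left fun h => hne ?_
    rw [Equiv.Perm.inv_eq_iff_eq, h1] at h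
    exact h

/-- The composition `α` with its entry at `r` moved to the last position `t`. -/
def moveLast (α : Fin N → ℕ) (r t : Fin N) : Fin N → ℕ := permComp (Fin.cycleIcc r t)⁻¹ α

theorem moveLast_apply (α : Fin N → ℕ) (r t i : Fin N) :
    moveLast α r t i = α (Fin.cycleIcc r t i) := by
  rw [moveLast, permComp, inv_inv]

theorem moveLast_dec {α : Fin N → ℕ} (hα : StrictlyDecreasingOn α (interval N ℓ (s + 1)))
    (ht : (t : ℕ) = ℓ + s) (hr : r ∈ interval N ℓ (s + 1)) :
    StrictlyDecreasingOn (moveLast α r t) (interval N ℓ s) := by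
  intro i hi j hj hij
  rw [moveLast_apply, moveLast_apply]
  have hsub : ∀ {i}, i ∈ interval N ℓ s → i ∈ interval N ℓ (s + 1) := fun h => by
    rw [interval_succ ht]; exact Finset.mem_insert_of_mem h
  exact hα _ (apply_mem_of_mem_permsOf (cycleIcc_mem ht hr) (hsub hi)) _
    (apply_mem_of_mem_permsOf (cycleIcc_mem ht hr) (hsub hj))
    (cycleIcc_strictMonoOn ht hr hi hj hij)

theorem kappa_moveLast (k : ℝ) {α : Fin N → ℕ}
    (hα : StrictlyDecreasingOn α (interval N ℓ (s + 1)))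
    (ht : (t : ℕ) = ℓ + s) (hr : r ∈ interval N ℓ (s + 1)) (i : Fin N) :
    kappa k (moveLast α r t) i = kappa k α (Fin.cycleIcc r t i) := by
  have := kappa_permComp_of_mem k hα (inv_mem_permsOf (cycleIcc_mem ht hr)) (Fin.cycleIcc r t i)
  rwa [perm_inv_apply_self] at this

theorem pairProd_succ (ht : (t : ℕ) = ℓ + s) (hr : r ∈ interval N ℓ (s + 1))
    (h : Fin N → Fin N → ℝ) :
    pairProd (interval N ℓ (s + 1)) h =
      (∏ i ∈ (interval N ℓ (s + 1)).erase r, if i < r then h i r else h r i) *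
        pairProd (interval N ℓ s) fun i j => h (Fin.cycleIcc r t i) (Fin.cycleIcc r t j) := by
  conv_lhs => rw [← Finset.insert_erase hr]
  exact pairProd_insert (Finset.notMem_erase _ _) (cycleIcc_strictMonoOn ht hr)
    (image_cycleIcc ht hr) h

/-- The permutation sends r to the last place t, so the pairs (r, i) with i > r are its inversions
involving r; the cycle is increasing on the remaining places. -/
theorem invProd_mul_cycleIcc_inv (k ε : ℝ) {α : Fin N → ℕ}
    (hα : StrictlyDecreasingOn α (interval N ℓ (s + 1)))
    (ht : (t : ℕ) = ℓ + s) (hr : r ∈ interval N ℓ (s + 1)) {w : Equiv.Perm (Fin N)}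
    (hw : w ∈ permsOf (interval N ℓ s)) :
    invProd k ε (kappa k α) (w * (Fin.cycleIcc r t)⁻¹) (interval N ℓ (s + 1)) =
      (∏ i ∈ (interval N ℓ (s + 1)).erase r,
        if i < r then 1 else 1 + ε * k / (kappa k α r - kappa k α i)) *
        invProd k ε (kappa k (moveLast α r t)) w (interval N ℓ s) := by
  have hmem : w * (Fin.cycleIcc r t)⁻¹ ∈ permsOf (interval N ℓ (s + 1)) :=
    mul_mem_permsOf (permsOf_mono (by rw [interval_succ ht]; exact Finset.subset_insert _ _) hw)
      (inv_mem_permsOf (cycleIcc_mem ht hr))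
  have hwr : (w * (Fin.cycleIcc r t)⁻¹) r = t := by
    have hc : (Fin.cycleIcc r t)⁻¹ r = t := by
      rw [Equiv.Perm.inv_eq_iff_eq, cycleIcc_last ht hr]
    rw [Equiv.Perm.mul_apply, hc, mem_permsOf.1 hw t (notMem_interval ht)]
  rw [invProd, pairProd_succ ht hr]
  congr 1
  · refine Finset.prod_congr rfl fun i hi => ?_
    obtain ⟨hne, hi⟩ := Finset.mem_erase.1 hi
    have h1 : (w * (Fin.cycleIcc r t)⁻¹) i < t := by
      refine lt_of_le_of_ne (le_last_of_mem ht (apply_mem_of_mem_permsOf hmem hi)) fun h => ?_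
      exact hne ((w * (Fin.cycleIcc r t)⁻¹).injective (h.trans hwr.symm))
    rw [hwr, if_neg h1.not_gt, if_pos h1]
  · refine pairProd_congr fun i _ j _ _ => ?_
    rw [kappa_moveLast k hα ht hr, kappa_moveLast k hα ht hr]
    simp only [Equiv.Perm.mul_apply, perm_inv_apply_self]

/-- The sum is sorted by the entry r moved to the last place. The factors of the prefactor for pairs
(r, i) with i > r cancel against the inversions of the cycle, leaving those with i < r. -/
theorem altSum_succ {k ε : ℝ} (hk : 0 ≤ k) (hε : ε = 1 ∨ ε = -1) (χ : Equiv.Perm (Fin N) →* ℝ)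
    {α : Fin N → ℕ} (hα : StrictlyDecreasingOn α (interval N ℓ (s + 1)))
    (ht : (t : ℕ) = ℓ + s) :
    altSum k ε χ α ℓ (s + 1) = ∑ r ∈ interval N ℓ (s + 1),
      (χ (Fin.cycleIcc r t)⁻¹ * ∏ i ∈ (interval N ℓ (s + 1)).erase r,
        if i < r then 1 + ε * k / (kappa k α i - kappa k α r) else 1) •
        altSum k ε χ (moveLast α r t) ℓ s := by
  have hI := interval_succ ht
  -- The coset decomposition sorts by w(t), whereas here the position r with w(r) = t is wanted;
  -- hence the passage to inverses.
  rw [altSum, ← sum_permsOf_inv]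
  nth_rewrite 2 [hI]
  rw [sum_permsOf_insert (notMem_interval ht) (d := fun r => Fin.cycleIcc r t)
    (fun r hr => hI ▸ cycleIcc_mem ht (hI ▸ hr)) (fun r hr => cycleIcc_last ht (hI ▸ hr)), ← hI,
    Finset.smul_sum]
  refine Finset.sum_congr rfl fun r hr => ?_
  have hdec := moveLast_dec hα ht hr
  rw [altSum, smul_smul, Finset.smul_sum, Finset.smul_sum, ← sum_permsOf_inv]
  refine Finset.sum_congr rfl fun w hw => ?_
  rw [mul_inv_rev, inv_inv, invProd_mul_cycleIcc_inv k ε hα ht hr hw, permComp_mul, ← moveLast,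
    pairProd_succ ht hr, smul_smul, smul_smul, map_mul]
  congr 1
  have hE := invProd_ne_zero hk hε hdec w
  have hB : (∏ i ∈ (interval N ℓ (s + 1)).erase r,
      if i < r then 1 else 1 + ε * k / (kappa k α r - kappa k α i)) ≠ 0 := by
    refine Finset.prod_ne_zero_iff.2 fun i hi => ?_
    obtain ⟨hne, hi⟩ := Finset.mem_erase.1 hi
    split_ifs with h
    · exact one_ne_zero
    · exact (one_add_div_pos hk hε (hα.kappa_sub_ge hk hr hi
        (lt_of_le_of_ne (not_lt.1 h) hne.symm))).ne'
  have hAB : (∏ i ∈ (interval N ℓ (s + 1)).erase r,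
      if i < r then 1 + ε * k / (kappa k α i - kappa k α r)
        else 1 + ε * k / (kappa k α r - kappa k α i)) =
      (∏ i ∈ (interval N ℓ (s + 1)).erase r,
        if i < r then 1 + ε * k / (kappa k α i - kappa k α r) else 1) *
      ∏ i ∈ (interval N ℓ (s + 1)).erase r,
        if i < r then 1 else 1 + ε * k / (kappa k α r - kappa k α i) := by
    rw [← Finset.prod_mul_distrib]
    refine Finset.prod_congr rfl fun i _ => ?_
    split_ifs
    · rw [mul_one]
    · rw [one_mul]
  rw [hAB]
  simp only [kappa_moveLast k hα ht hr]
  have hE' : invProd k ε (fun i => kappa k α (Fin.cycleIcc r t i)) w (interval N ℓ s) ≠ 0 := by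
    rwa [← funext (kappa_moveLast k hα ht hr)]
  rw [show kappa k (moveLast α r t) = fun i => kappa k α (Fin.cycleIcc r t i) from
    funext (kappa_moveLast k hα ht hr)]
  field_simp

end Cycle

/-! ### Symmetrization of ζ_α and its identification with j. -/

/-- The sum `∑_{w ∈ S_I} w f`. -/
def symSum (ℓ m : ℕ) : Module.End ℝ (MvPolynomial (Fin N) ℝ) :=
  ∑ w ∈ permsOf (interval N ℓ m), permOp w

theorem symSum_swapOp {ℓ m : ℕ} {i j : Fin N} (hi : i ∈ interval N ℓ m) (hj : j ∈ interval N ℓ m)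
    (f : MvPolynomial (Fin N) ℝ) : symSum ℓ m (swapOp i j f) = symSum ℓ m f := by
  have : symSum ℓ m * swapOp i j = symSum ℓ m := by
    rw [symSum, Finset.sum_mul]
    simp only [swapOp, ← permOp_mul]
    exact sum_permsOf_mul_right (swap_mem_permsOf hi hj) _
  exact LinearMap.congr_fun this f

/-- Symmetrizing `swapOp_zeta` absorbs the transposition, so each inversion (a, b) contributes the
factor 1 − k/(κ_a − κ_b). -/
theorem symSum_zeta {k : ℝ} (hk : 0 ≤ k) {α : Fin N → ℕ} {ℓ m : ℕ}
    (hα : StrictlyDecreasingOn α (interval N ℓ m)) {w : Equiv.Perm (Fin N)}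
    (hw : w ∈ permsOf (interval N ℓ m)) :
    symSum ℓ m (zeta k (permComp w α)) =
      invProd k (-1) (kappa k α) w (interval N ℓ m) • symSum ℓ m (zeta k α) := by
  suffices h : ∀ w ∈ permsOf (interval N ℓ m), symSum ℓ m (zeta k (permComp w⁻¹ α)) =
      invProd k (-1) (kappa k α) w⁻¹ (interval N ℓ m) • symSum ℓ m (zeta k α) by
    have := h w⁻¹ (inv_mem_permsOf hw)
    rwa [inv_inv] at this
  refine perm_induction ?_ fun w hw i hi j hj hij hlt ih => ?_
  · rw [inv_one, invProd_one, one_smul, permComp_one]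
  · have hji : i ≠ j := fun h => by rw [h] at hij; omega
    obtain ⟨u, hu⟩ : ∃ u, u = Equiv.swap i j * w⁻¹ := ⟨_, rfl⟩
    have hw' : w⁻¹ = Equiv.swap i j * u := by
      rw [hu, ← mul_assoc, Equiv.swap_mul_self, one_mul]
    have hum : u ∈ permsOf (interval N ℓ m) :=
      hu ▸ mul_mem_permsOf (swap_mem_permsOf hi hj) (inv_mem_permsOf hw)
    rw [mul_inv_rev, Equiv.swap_inv, ← hu] at ih
    have hui : u⁻¹ i = w j := by rw [hu]; simp
    have huj : u⁻¹ j = w i := by rw [hu]; simp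
    obtain ⟨a, rfl⟩ := u.surjective i
    obtain ⟨b, rfl⟩ := u.surjective j
    rw [perm_inv_apply_self] at hui huj
    rw [← hui, ← huj] at hlt
    have hinv := inv_mem_permsOf hum
    have ha := apply_mem_of_mem_permsOf hinv hi
    have hb := apply_mem_of_mem_permsOf hinv hj
    rw [perm_inv_apply_self] at ha hb
    have hz := swapOp_zeta hk (α := permComp u α) hij
      (by simpa only [permComp, perm_inv_apply_self] using hα a ha b hb hlt)
    rw [kappa_permComp_of_mem k hα hum, kappa_permComp_of_mem k hα hum, ← permComp_mul,
      ← sub_eq_iff_eq_add] at hz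
    rw [hw', ← hz, map_sub, map_smul, symSum_swapOp hi hj, ih,
      invProd_swap_mul k (-1) _ ha hb hlt hij, neg_one_mul, neg_div]
    module

/-- The identity and the transpositions (i t) represent the cosets of the smaller symmetric group.
-/
theorem symSum_succ {ℓ s : ℕ} {t : Fin N} (ht : (t : ℕ) = ℓ + s) :
    (symSum ℓ (s + 1) : Module.End ℝ (MvPolynomial (Fin N) ℝ)) =
      (1 + ∑ i ∈ interval N ℓ s, swapOp i t) * symSum ℓ s := by
  have hI := interval_succ ht
  have htI : t ∈ insert t (interval N ℓ s) := Finset.mem_insert_self _ _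
  rw [symSum, hI, sum_permsOf_insert (notMem_interval ht) (d := fun i => Equiv.swap i t)
    (fun i hi => swap_mem_permsOf hi htI) (fun i _ => Equiv.swap_apply_right _ _),
    Finset.sum_insert (notMem_interval ht), add_mul, one_mul, Finset.sum_mul, symSum]
  simp only [permOp_mul, Equiv.swap_self, ← Finset.mul_sum]
  congr 1
  change permOp 1 * _ = _
  rw [permOp_one, one_mul]

theorem permsOf_interval_zero (ℓ : ℕ) : permsOf (interval N ℓ 0) = {1} := by
  ext w
  rw [mem_permsOf, Finset.mem_singleton]
  refine ⟨fun h => Equiv.ext fun i => h i ?_, fun h => by simp [h]⟩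
  rw [mem_interval]; omega

theorem interval_zero (ℓ : ℕ) : interval N ℓ 0 = ∅ := by
  ext i
  simp only [mem_interval, Finset.notMem_empty, iff_false]
  omega

theorem altSum_zero (k ε : ℝ) (χ : Equiv.Perm (Fin N) →* ℝ) (α : Fin N → ℕ) (ℓ : ℕ) :
    altSum k ε χ α ℓ 0 = zeta k α := by
  rw [altSum, permsOf_interval_zero, Finset.sum_singleton, invProd_one, map_one, permComp_one,
    interval_zero]
  simp [pairProd]

theorem symSum_zero (ℓ : ℕ) (f : MvPolynomial (Fin N) ℝ) : symSum ℓ 0 f = f := by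
  rw [symSum, permsOf_interval_zero, Finset.sum_singleton, permOp_one, Module.End.one_apply]

theorem symSum_zeta_moveLast {k : ℝ} (hk : 0 ≤ k) {ℓ s : ℕ} {t r : Fin N} {α : Fin N → ℕ}
    (hα : StrictlyDecreasingOn α (interval N ℓ (s + 1)))
    (ht : (t : ℕ) = ℓ + s) (hr : r ∈ interval N ℓ (s + 1)) :
    symSum ℓ (s + 1) (zeta k (moveLast α r t)) =
      (∏ i ∈ (interval N ℓ (s + 1)).erase r,
        if i < r then 1 else 1 + -1 * k / (kappa k α r - kappa k α i)) •
        symSum ℓ (s + 1) (zeta k α) := by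
  have h1 : (1 : Equiv.Perm (Fin N)) ∈ permsOf (interval N ℓ s) := mem_permsOf.2 fun _ _ => rfl
  rw [moveLast, symSum_zeta hk hα (inv_mem_permsOf (cycleIcc_mem ht hr))]
  have := invProd_mul_cycleIcc_inv k (-1) hα ht hr h1
  rw [one_mul, invProd_one, mul_one] at this
  rw [this]

/-- The invariant element `j_{α;I}` is the symmetrization of `ζ_α`. -/
theorem altSum_one_eq_symSum {k : ℝ} (hk : 0 ≤ k) {ℓ s : ℕ} (h : ℓ + s ≤ N) {α : Fin N → ℕ}
    (hα : StrictlyDecreasingOn α (interval N ℓ s)) :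
    altSum k 1 1 α ℓ s = symSum ℓ s (zeta k α) := by
  induction s generalizing α with
  | zero => rw [altSum_zero, symSum_zero]
  | succ s ih =>
    set t : Fin N := ⟨ℓ + s, by omega⟩ with ht'
    have ht : (t : ℕ) = ℓ + s := rfl
    have hinv : ∀ i ∈ interval N ℓ s, swapOp i t (altSum k 1 1 α ℓ (s + 1)) =
        altSum k 1 1 α ℓ (s + 1) := fun i hi => by
      have := permOp_altSum hk (Or.inl rfl) (χ := (1 : Equiv.Perm (Fin N) →* ℝ))
        (fun _ _ _ => rfl) hα (w := Equiv.swap i t) (swap_mem_permsOf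
          (by rw [interval_succ ht]; exact Finset.mem_insert_of_mem hi)
          (by rw [interval_succ ht]; exact Finset.mem_insert_self _ _))
      rwa [MonoidHom.one_apply, one_smul] at this
    -- The coset sum is applied to j in two ways: here by invariance, below by expanding over r and
    -- completing the smaller symmetrizations.
    have h1 : (1 + ∑ i ∈ interval N ℓ s, swapOp i t) (altSum k 1 1 α ℓ (s + 1)) =
        ((s : ℝ) + 1) • altSum k 1 1 α ℓ (s + 1) := by
      rw [LinearMap.add_apply, LinearMap.sum_apply, Finset.sum_congr rfl hinv, Finset.sum_const,
        card_interval (by omega), Module.End.one_apply, ← Nat.cast_smul_eq_nsmul ℝ]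
      module
    have h2 : (1 + ∑ i ∈ interval N ℓ s, swapOp i t) (altSum k 1 1 α ℓ (s + 1)) =
        ((s : ℝ) + 1) • symSum ℓ (s + 1) (zeta k α) := by
      -- The second Lagrange identity splits s + 1 into the contributions of the individual r.
      have hcard : ((s : ℝ) + 1) = ∑ r ∈ interval N ℓ (s + 1),
          ∏ i ∈ (interval N ℓ (s + 1)).erase r, (1 + k / (kappa k α i - kappa k α r)) := by
        rw [sum_prod_one_add_div_sub (hα.kappa_injOn hk), card_interval h]
        push_cast
        rfl
      rw [altSum_succ hk (Or.inl rfl) 1 hα ht, map_sum, hcard, Finset.sum_smul]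
      refine Finset.sum_congr rfl fun r hr => ?_
      rw [map_smul, ih (by omega) (moveLast_dec hα ht hr), ← Module.End.mul_apply,
        ← symSum_succ ht, symSum_zeta_moveLast hk hα ht hr, smul_smul, MonoidHom.one_apply,
        one_mul, ← Finset.prod_mul_distrib]
      congr 1
      refine Finset.prod_congr rfl fun i _ => ?_
      split_ifs
      · rw [mul_one, one_mul]
      · rw [one_mul, ← neg_sub (kappa k α i), neg_one_mul, neg_div_neg_eq]
    exact smul_right_injective _ (by positivity : (s : ℝ) + 1 ≠ 0) (h1.symm.trans h2)

/-! ### The skew operator on the alternating element. -/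

theorem prod_ofFn_apply {M : Type*} [AddCommGroup M] [Module ℝ M] {n : ℕ}
    {A : Fin n → Module.End ℝ M} {c : Fin n → ℝ} {v : M} (h : ∀ r, A r v = c r • v) :
    (List.ofFn A).prod v = (∏ r, c r) • v := by
  induction n with
  | zero => simp
  | succ n ih =>
    rw [List.ofFn_succ, List.prod_cons, Module.End.mul_apply, ih fun r => h r.succ, map_smul, h,
      smul_smul, Fin.prod_univ_succ, mul_comm]

theorem prod_fin_interval {ℓ s : ℕ} (h : ℓ + s ≤ N) (x : Fin N → ℝ) :
    ∏ r : Fin s, x ⟨ℓ + r, by omega⟩ = ∏ i ∈ interval N ℓ s, x i := by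
  refine Finset.prod_bij (fun r _ => ⟨ℓ + r, by omega⟩) (fun r _ => ?_) (fun a _ b _ hab => ?_)
    (fun i hi => ?_) fun _ _ => rfl
  · rw [mem_interval]; simp only; omega
  · rw [Fin.mk.injEq] at hab
    exact Fin.ext (by omega)
  · rw [mem_interval] at hi
    exact ⟨⟨i - ℓ, by omega⟩, Finset.mem_univ _, Fin.ext (by simp only; omega)⟩

/-- The symmetrization is a combination of the ζ_{wα}, and the product of the U_i over the interval
has the same eigenvalue ∏ κ_i(α) on all of them. -/
theorem prod_opU_symSum_zeta {k : ℝ} (hk : 0 ≤ k) {ℓ s : ℕ} (h : ℓ + s ≤ N) {α : Fin N → ℕ}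
    (hα : StrictlyDecreasingOn α (interval N ℓ s)) :
    (List.ofFn fun r : Fin s => opU k (⟨ℓ + r, by omega⟩ : Fin N)).prod
        (symSum ℓ s (zeta k α)) =
      (∏ i ∈ interval N ℓ s, kappa k α i) • symSum ℓ s (zeta k α) := by
  rw [← altSum_one_eq_symSum hk h hα, altSum, map_smul, map_sum,
    smul_comm (∏ i ∈ interval N ℓ s, kappa k α i)]
  congr 1
  rw [Finset.smul_sum]
  refine Finset.sum_congr rfl fun w hw => ?_
  rw [map_smul, prod_ofFn_apply (c := fun r : Fin s => kappa k (permComp w α) ⟨ℓ + r, by omega⟩)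
      fun r => isEigen_zeta hk (permComp w α) _,
    prod_fin_interval h (kappa k (permComp w α)), smul_comm, ← prod_permsOf hw]
  simp only [kappa_permComp_of_mem k hα hw]

/-- The sign character with real values. -/
def signReal : Equiv.Perm (Fin N) →* ℝ :=
  ((Int.castRingHom ℝ : ℤ →* ℝ).comp (Units.coeHom ℤ)).comp Equiv.Perm.sign

theorem signReal_apply (w : Equiv.Perm (Fin N)) :
    signReal w = ((Equiv.Perm.sign w : ℤ) : ℝ) := rfl

theorem signReal_swap {i j : Fin N} (h : i ≠ j) : signReal (Equiv.swap i j) = -1 := by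
  rw [signReal_apply, Equiv.Perm.sign_swap h]; simp

/-- The sign is spread as one factor −1 over each i > r, ready to be merged with the other products
over i ≠ r. -/
theorem signReal_cycleIcc_inv {ℓ s : ℕ} {t r : Fin N} (ht : (t : ℕ) = ℓ + s)
    (hr : r ∈ interval N ℓ (s + 1)) :
    signReal (Fin.cycleIcc r t)⁻¹ =
      ∏ i ∈ (interval N ℓ (s + 1)).erase r, if i < r then (1 : ℝ) else -1 := by
  have e : ((interval N ℓ (s + 1)).erase r).filter (fun i => ¬ i < r) = Finset.Ioc r t := by
    ext i
    rw [mem_interval] at hr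
    simp only [Finset.mem_filter, Finset.mem_erase, mem_interval, Finset.mem_Ioc, Fin.lt_def,
      Fin.le_def, ne_eq, Fin.ext_iff]
    omega
  rw [Finset.prod_ite, Finset.prod_const_one, one_mul, Finset.prod_const, e, Fin.card_Ioc,
    signReal_apply, Equiv.Perm.sign_inv, Fin.sign_cycleIcc_of_le (le_last_of_mem ht hr)]
  simp

/-- The skew operator maps the alternating element to a multiple of the invariant element. -/
theorem psi_altSum {k : ℝ} (hk : 0 ≤ k) {ℓ s : ℕ} (h : ℓ + s ≤ N) {α : Fin N → ℕ}
    (hα : StrictlyDecreasingOn α (interval N ℓ s)) :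
    psi k ℓ s h (altSum k (-1) signReal α ℓ s) =
      (pairProd (interval N ℓ s) fun i j => kappa k α i - kappa k α j - k) •
        symSum ℓ s (zeta k α) := by
  induction s generalizing α with
  -- Starting at the empty interval, where ψ_0 = 1, makes length one an instance of the general
  -- step.
  | zero => rw [altSum_zero, symSum_zero, interval_zero]; simp [pairProd, psi]
  | succ s ih =>
    set t : Fin N := ⟨ℓ + s, by omega⟩ with ht'
    have ht : (t : ℕ) = ℓ + s := rfl
    set Φ : Module.End ℝ (MvPolynomial (Fin N) ℝ) :=
      (List.ofFn fun r : Fin s => opU k (⟨ℓ + r, by omega⟩ : Fin N)).prod *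
        psi k ℓ s (by omega) with hΦ
    have hpsi : psi k ℓ (s + 1) h = Φ - ∑ i ∈ interval N ℓ s, swapOp i t * Φ * swapOp i t := rfl
    have hinv : ∀ i ∈ interval N ℓ s, swapOp i t (altSum k (-1) signReal α ℓ (s + 1)) =
        -altSum k (-1) signReal α ℓ (s + 1) := fun i hi => by
      have hit : i ≠ t := fun e => notMem_interval ht (e ▸ hi)
      have := permOp_altSum hk (Or.inr rfl) (χ := (signReal : Equiv.Perm (Fin N) →* ℝ))
        (fun _ _ => signReal_swap) hα (w := Equiv.swap i t) (swap_mem_permsOf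
          (by rw [interval_succ ht]; exact Finset.mem_insert_of_mem hi)
          (by rw [interval_succ ht]; exact Finset.mem_insert_self _ _))
      rwa [signReal_swap hit, neg_one_smul] at this
    -- The inner (i t) acts by −1 on the alternating element, so the subtracted conjugates become
    -- added left translates.
    have h1 : psi k ℓ (s + 1) h (altSum k (-1) signReal α ℓ (s + 1)) =
        (1 + ∑ i ∈ interval N ℓ s, swapOp i t) (Φ (altSum k (-1) signReal α ℓ (s + 1))) := by
      rw [hpsi, LinearMap.sub_apply, LinearMap.add_apply, LinearMap.sum_apply,
        LinearMap.sum_apply, Module.End.one_apply, sub_eq_add_neg, ← Finset.sum_neg_distrib]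
      congr 1
      refine Finset.sum_congr rfl fun i hi => ?_
      rw [Module.End.mul_apply, Module.End.mul_apply, hinv i hi, map_neg, map_neg, neg_neg]
    have hx := hα.kappa_injOn hk
    have hne : (interval N ℓ (s + 1)).Nonempty := ⟨t, by
      rw [interval_succ ht]; exact Finset.mem_insert_self _ _⟩
    rw [h1, altSum_succ hk (Or.inr rfl) signReal hα ht, map_sum, map_sum]
    -- The scalar is multiplied by 1 = Σ_r ∏_{i≠r} κ_i/(κ_i − κ_r), so that both sides can be
    -- compared for each r separately.
    conv_rhs => rw [← mul_one (pairProd _ _), ← sum_prod_div_sub hx hne, Finset.mul_sum,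
      Finset.sum_smul]
    refine Finset.sum_congr rfl fun r hr => ?_
    have hdec := moveLast_dec hα ht hr
    have hΦr : Φ (altSum k (-1) signReal (moveLast α r t) ℓ s) =
        ((pairProd (interval N ℓ s) fun i j =>
          kappa k (moveLast α r t) i - kappa k (moveLast α r t) j - k) *
          ∏ i ∈ interval N ℓ s, kappa k (moveLast α r t) i) •
            symSum ℓ s (zeta k (moveLast α r t)) := by
      rw [hΦ, Module.End.mul_apply, ih (by omega) hdec, map_smul,
        prod_opU_symSum_zeta hk (by omega) hdec, smul_smul]
    rw [map_smul, map_smul, hΦr, map_smul, ← Module.End.mul_apply, ← symSum_succ ht,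
      symSum_zeta_moveLast hk hα ht hr, smul_smul, smul_smul, pairProd_succ ht hr,
      signReal_cycleIcc_inv ht hr]
    congr 1
    simp only [kappa_moveLast k hα ht hr]
    rw [← Finset.prod_image (s := interval N ℓ s) (g := Fin.cycleIcc r t) (f := kappa k α)
      (fun _ _ _ _ e => (Fin.cycleIcc r t).injective e), image_cycleIcc ht hr]
    generalize pairProd (interval N ℓ s) (fun i j => kappa k α (Fin.cycleIcc r t i) -
      kappa k α (Fin.cycleIcc r t j) - k) = D
    have hrearr : ∀ a b c e : ℝ, a * b * (D * c) * e = (a * b * c * e) * D := fun a b c e => by ring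
    rw [hrearr, mul_right_comm _ D, ← Finset.prod_mul_distrib, ← Finset.prod_mul_distrib,
      ← Finset.prod_mul_distrib, ← Finset.prod_mul_distrib]
    congr 1
    -- For i < r both sides are κ_i (κ_i − κ_r − k)/(κ_i − κ_r). For i > r the sign turns (κ_r − κ_i
    -- − k)/(κ_r − κ_i) into (κ_r − κ_i − k)/(κ_i − κ_r), as required.
    refine Finset.prod_congr rfl fun i hi => ?_
    obtain ⟨hir, hi⟩ := Finset.mem_erase.1 hi
    have hd : kappa k α i - kappa k α r ≠ 0 := sub_ne_zero.2 fun e => hir (hx hi hr e)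
    have hd' : kappa k α r - kappa k α i ≠ 0 := sub_ne_zero.2 fun e => hir (hx hi hr e.symm)
    split_ifs
    · field_simp
      ring
    · field_simp
      ring

/-! ### Comparison with the defining formulas of a and j. -/

theorem aAlt_eq (k : ℝ) {α : Fin N → ℕ} {ℓ m : ℕ} (h : ℓ + m ≤ N)
    (hα : StrictlyDecreasingOn α (interval N ℓ m)) :
    aAlt k α ℓ m h = altSum k (-1) signReal α ℓ m := by
  rw [aAlt, altSum, calE_revComp k (-1) h hα]
  congr 1
  refine Finset.sum_congr rfl fun w hw => ?_
  rw [calE_permComp k (-1) hα hw, signReal_apply]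

theorem jInv_eq (k : ℝ) {α : Fin N → ℕ} {ℓ m : ℕ} (h : ℓ + m ≤ N)
    (hα : StrictlyDecreasingOn α (interval N ℓ m)) :
    jInv k α ℓ m h = altSum k 1 1 α ℓ m := by
  rw [jInv, altSum, calE_revComp k 1 h hα, Finset.sum_image]
  · congr 1
    refine Finset.sum_congr rfl fun w hw => ?_
    rw [calE_permComp k 1 hα hw, MonoidHom.one_apply]
  -- The sum over the orbit is a sum over S_I because the entries of α in I are distinct, so w ↦ wα
  -- is injective on S_I.
  · intro u hu v hv huv
    have huv : permComp u α = permComp v α := huv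
    rw [← inv_inj]
    refine Equiv.ext fun i => ?_
    have hu' := inv_mem_permsOf (Finset.mem_coe.1 hu)
    have hv' := inv_mem_permsOf (Finset.mem_coe.1 hv)
    by_cases hi : i ∈ interval N ℓ m
    · have e : α (u⁻¹ i) = α (v⁻¹ i) := congrFun huv i
      have h1 := hα.lt_iff (apply_mem_of_mem_permsOf hu' hi) (apply_mem_of_mem_permsOf hv' hi)
      have h2 := hα.lt_iff (apply_mem_of_mem_permsOf hv' hi) (apply_mem_of_mem_permsOf hu' hi)
      rw [e, lt_self_iff_false, false_iff, not_lt] at h1 h2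
      exact le_antisymm h2 h1
    · rw [mem_permsOf.1 hu' i hi, mem_permsOf.1 hv' i hi]

end DunklJack

end

theorem corollary4p13 {N : ℕ} (k : ℝ) (hk : 0 ≤ k) (ℓ m : ℕ) (hm : 1 ≤ m) (h : ℓ + m ≤ N)
    (α : Fin N → ℕ) (hα : DunklJack.StrictlyDecreasingOn α (DunklJack.interval N ℓ m)) :
    DunklJack.psi k ℓ m h (DunklJack.aAlt k α ℓ m h) =
      (∏ q ∈ (DunklJack.interval N ℓ m ×ˢ DunklJack.interval N ℓ m).filter (fun q => q.1 < q.2),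
        (DunklJack.kappa k α q.1 - DunklJack.kappa k α q.2 - k)) •
        DunklJack.jInv k α ℓ m h := by
  rw [DunklJack.aAlt_eq k h hα, DunklJack.jInv_eq k h hα, DunklJack.psi_altSum hk h hα,
    DunklJack.altSum_one_eq_symSum hk h hα, DunklJack.pairProd_eq]
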